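/- **Setting.** Let $d\ge 0$, let $\Theta\subset\mathbb{R}^d$ be open and let $(E,\mathcal F)$ be a measurable space. A family of probability measures $(P_\theta)_{\theta\in\Theta}$ on $E$ is a *regular model* if - there is a $\sigma$-finite measure $\mu$ with $P_\theta=f(\cdot,\theta)\,\mu$ and $f(\cdot,\theta)>0$ $\mu$-a.e., for every $\theta\in\Theta$; - $\theta\mapsto f(x,\theta)$ is continuous on $\Theta$ for $\mu$-almost every $x$; - there is $\phi:E\times\Theta\to\mathbb{R}^d$ with $\phi(\cdot,\theta)\in L^2(\mu)$ and $\int|\sqrt{f(x,\theta+h)}-\sqrt{f(x,\theta)}-(\phi(x,\theta),h)|^2\,d\mu(x)=o(\|h\|^2)$ as $h\to0$, for every $\theta\in\Theta$; - $\theta\mapsto\phi(\cdot,\theta)$ is continuous from $\Theta$ to $L^2(\mu)$, and $\theta\mapsto P_\theta$ is injective on $\Theta$. Its Fisher information matrix is $J(\theta)=4\int\phi(x,\theta)\phi(x,\theta)^t\,d\mu(x)$. An *error structure* on a probability space $(W,\mathcal W,m)$ is a pair $(\mathbb D,\Gamma)$ with $\mathbb D$ a dense vector subspace of $L^2(m)$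 and $\Gamma:\mathbb D\times\mathbb D\to L^1(m)$ positive, symmetric and bilinear, such that 1. for $U\in\mathbb D^n$, $V\in\mathbb D^p$ and $C^1$ Lipschitz functions $F:\mathbb R^n\to\mathbb R$, $G:\mathbb R^p\to\mathbb R$, one has $F(U),G(V)\in\mathbb D$ and $\Gamma[F(U),G(V)]=\sum_{i,j}F_i'(U)G_j'(V)\Gamma[U_i,V_j]$; 2. $1\in\mathbb D$; 3. $\mathbb D$ is complete for the norm $\left(\|U\|_{L^2(m)}^2+\frac12\int\Gamma[U,U]\,dm\right)^{1/2}$. Write $\Gamma[U]=\Gamma[U,U]$, and let $\mathrm{Lip}^1(\Theta)$ be the set of Lipschitz functions of class $C^1$ on $\Theta$. For a probability measure $\rho$ on $\Theta$, *Hypothesis E* states that there is an error structure $(\mathbb D,\Gamma)$ on $(\Theta,\mathcal B(\Theta),\rho)$ with $\mathrm{Lip}^1(\Theta)\subset\mathbb D$ and $\Gamma[F]=F'J^{-1}(F')^t$ for all $F\in\mathrm{Lip}^1(\Theta)$, and that it can be taken with $\mathbb D$ minimal for inclusion (contained in the domain of every other such structure) and with $\mathrm{Lip}^1(\Theta)$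 dense in $\mathbb D$ for the norm in 3. **Proposition.** (a) Let $\Theta=\prod_{i=1}^d\,]\theta_0^i,\theta_1^i[$ with real numbers $\theta_0^i\le\theta_1^i$, and let $\rho$ be a probability measure on $\Theta$ that has, with respect to Lebesgue measure on $\Theta$, a positive density $q\in\mathrm{Lip}^1(\Theta)$. Let $(P_\theta)_{\theta\in\Theta}$ be a regular model, with Fisher information $J$, that extends to a regular model on an open set $\Theta'\supset\overline\Theta$ whose Fisher information matrix is invertible at every point of $\overline\Theta$. Then the form $\Gamma[F]=F'J^{-1}(F')^t$ on $\mathrm{Lip}^1(\Theta)$ is closable (if $F_n\in\mathrm{Lip}^1(\Theta)$, $F_n\to0$ in $L^2(\rho)$ and $\Gamma[F_n-F_m]\to0$ in $L^1(\rho)$ as $n,m\to\infty$, then $\Gamma[F_n]\to0$ in $L^1(\rho)$), and Hypothesis E holds. (b) Let $\Theta=\mathbb R$, let $(P_\theta)_{\theta\in\mathbb R}$ be a regular model whose Fisher information $J$ does not vanish, and let $\rho$ be a probability measure on $\mathbb R$ with $\int\theta^2\,d\rho(\theta)<\infty$ and $1/J\in L^1(\rho)$. Then Hypothesis E is equivalent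 to Hamza's conditions for the measure $\nu=\frac1J\,\rho$: $\nu$ is absolutely continuous with respect to Lebesgue measure, and its density $a$ vanishes Lebesgue-a.e. on its singular set, that is, on the set of those $x$ such that $\int_{x-\varepsilon}^{x+\varepsilon}\frac{dy}{a(y)}=\infty$ for every $\varepsilon>0$ (with $1/0=\infty$). The equivalence also holds if the minimality of $\mathbb D$ and the density of $\mathrm{Lip}^1(\mathbb R)$ are dropped from Hypothesis E. -/

import Mathlib

open MeasureTheory Filter Topology Set
open scoped ENNReal NNReal Matrix

noncomputable section

namespace FisherError

/-! ### Error structures -/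

/-- An error structure `(W, 𝓦, m, 𝔻, Γ)` on a probability space `(W, 𝓦, m)`: a dense subspace
`𝔻` of `L²(m)` and a positive symmetric bilinear map `Γ : 𝔻 × 𝔻 → L¹(m)` with the functional
calculus of class `C¹ ∩ Lip`, with `1 ∈ 𝔻`, and such that `𝔻` is complete for the graph norm
`(‖U‖²_{L²} + ½ ∫ Γ[U, U] dm)^{1/2}`. -/
structure ErrorStructure {W : Type*} [MeasurableSpace W] (m : Measure W)
    [IsProbabilityMeasure m] where
  /-- the domain `𝔻` -/
  domain : Submodule ℝ (Lp ℝ 2 m)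
  dense_domain : Dense (domain : Set (Lp ℝ 2 m))
  /-- the quadratic error operator -/
  Γ : domain →ₗ[ℝ] domain →ₗ[ℝ] Lp ℝ 1 m
  symm : ∀ U V : domain, Γ U V = Γ V U
  nonneg : ∀ U : domain, 0 ≤ Γ U U
  functional_calculus : ∀ (n p : ℕ) (U : Fin n → domain) (V : Fin p → domain)
    (F : (Fin n → ℝ) → ℝ) (G : (Fin p → ℝ) → ℝ),
    ContDiff ℝ 1 F → (∃ K : ℝ≥0, LipschitzWith K F) →
    ContDiff ℝ 1 G → (∃ K : ℝ≥0, LipschitzWith K G) →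
    ∃ X Y : domain,
      (X.1 =ᵐ[m] fun w => F fun i => (U i).1 w) ∧
      (Y.1 =ᵐ[m] fun w => G fun j => (V j).1 w) ∧
      (Γ X Y =ᵐ[m] fun w => ∑ i, ∑ j,
        fderiv ℝ F (fun k => (U k).1 w) (Pi.single i 1) *
          fderiv ℝ G (fun k => (V k).1 w) (Pi.single j 1) * Γ (U i) (V j) w)
  one_mem : Lp.const 2 m (1 : ℝ) ∈ domain
  complete : ∀ U : ℕ → domain,
    (∀ ε > 0, ∃ N, ∀ k ≥ N, ∀ l ≥ N,
      Real.sqrt (‖U k - U l‖ ^ 2 + 1 / 2 * ∫ w, Γ (U k - U l) (U k - U l) w ∂m) < ε) →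
    ∃ L : domain, Tendsto (fun k =>
      Real.sqrt (‖U k - L‖ ^ 2 + 1 / 2 * ∫ w, Γ (U k - L) (U k - L) w ∂m)) atTop (𝓝 0)

/-- The graph norm `(‖U‖²_{L²} + ℰ[U])^{1/2}` with `ℰ[U] = ½ ∫ Γ[U] dm`. -/
def ErrorStructure.graphNorm {W : Type*} [MeasurableSpace W] {m : Measure W}
    [IsProbabilityMeasure m] (S : ErrorStructure m) (U : S.domain) : ℝ :=
  Real.sqrt (‖U‖ ^ 2 + 1 / 2 * ∫ w, S.Γ U U w ∂m)

/-! ### Regular statistical models -/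

/-- A regular statistical model `(P_θ)_{θ ∈ Θ}` with sample space `E`, parametrized by an open
set `Θ ⊆ ℝᵈ`. -/
structure RegularModel (E : Type*) [MeasurableSpace E] {d : ℕ}
    (Θ : Set (EuclideanSpace ℝ (Fin d))) where
  isOpen : IsOpen Θ
  /-- the laws -/
  P : EuclideanSpace ℝ (Fin d) → Measure E
  isProbabilityMeasure : ∀ θ ∈ Θ, IsProbabilityMeasure (P θ)
  /-- the dominating measure -/
  μ : Measure E
  sigmaFinite : SigmaFinite μ
  /-- the densities `dP_θ / dμ` -/
  f : E → EuclideanSpace ℝ (Fin d) → ℝ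
  measurable_f : ∀ θ ∈ Θ, AEMeasurable (fun x => f x θ) μ
  f_pos : ∀ θ ∈ Θ, ∀ᵐ x ∂μ, 0 < f x θ
  P_eq : ∀ θ ∈ Θ, P θ = μ.withDensity fun x => ENNReal.ofReal (f x θ)
  continuous_f : ∀ᵐ x ∂μ, ContinuousOn (fun θ => f x θ) Θ
  /-- the derivative in quadratic mean of `θ ↦ √f(·, θ)` -/
  φ : E → EuclideanSpace ℝ (Fin d) → EuclideanSpace ℝ (Fin d)
  memLp_φ : ∀ θ ∈ Θ, MemLp (fun x => φ x θ) 2 μ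
  differentiable : ∀ θ ∈ Θ,
    (fun h : EuclideanSpace ℝ (Fin d) =>
      ∫ x, (Real.sqrt (f x (θ + h)) - Real.sqrt (f x θ) - inner ℝ (φ x θ) h) ^ 2 ∂μ)
      =o[𝓝 0] fun h => ‖h‖ ^ 2
  continuous_φ : ∀ θ ∈ Θ,
    Tendsto (fun η => ∫ x, ‖φ x η - φ x θ‖ ^ 2 ∂μ) (𝓝[Θ] θ) (𝓝 0)
  identifiable : InjOn P Θ

/-- The Fisher information matrix `J(θ) = 4 ∫ φ(x, θ) φ(x, θ)ᵗ dμ(x)`. -/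
def RegularModel.fisher {E : Type*} [MeasurableSpace E] {d : ℕ}
    {Θ : Set (EuclideanSpace ℝ (Fin d))} (M : RegularModel E Θ)
    (θ : EuclideanSpace ℝ (Fin d)) : Matrix (Fin d) (Fin d) ℝ :=
  Matrix.of fun i j => 4 * ∫ x, M.φ x θ i * M.φ x θ j ∂M.μ

/-! ### The fundamental identification -/

section Identification

variable {d : ℕ}

/-- `Lip¹(Θ)`: the functions that are `C¹` and Lipschitz on the open set `Θ` (the values
outside `Θ` are irrelevant). -/
def IsLip1 (Θ : Set (EuclideanSpace ℝ (Fin d))) (F : EuclideanSpace ℝ (Fin d) → ℝ) : Prop :=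
  ContDiffOn ℝ 1 F Θ ∧ ∃ K : ℝ≥0, LipschitzOnWith K F Θ

/-- The vector of partial derivatives `F'(θ)`. -/
def grad (F : EuclideanSpace ℝ (Fin d) → ℝ) (θ : EuclideanSpace ℝ (Fin d)) : Fin d → ℝ :=
  fun i => fderiv ℝ F θ (EuclideanSpace.single i 1)

/-- `F' J⁻¹ (F')ᵗ`, as a function of `θ`. -/
def gammaForm (J : EuclideanSpace ℝ (Fin d) → Matrix (Fin d) (Fin d) ℝ)
    (F : EuclideanSpace ℝ (Fin d) → ℝ) (θ : EuclideanSpace ℝ (Fin d)) : ℝ :=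
  grad F θ ⬝ᵥ ((J θ)⁻¹ *ᵥ grad F θ)

/-- Closability, with respect to `L²(ρ)`, of the form `F ↦ F' J⁻¹ (F')ᵗ ∈ L¹(ρ)` on `Lip¹(Θ)`. -/
def IsClosable (J : EuclideanSpace ℝ (Fin d) → Matrix (Fin d) (Fin d) ℝ)
    (Θ : Set (EuclideanSpace ℝ (Fin d))) (ρ : Measure (EuclideanSpace ℝ (Fin d))) : Prop :=
  ∀ F : ℕ → EuclideanSpace ℝ (Fin d) → ℝ, (∀ n, IsLip1 Θ (F n)) →
    Tendsto (fun n => ∫⁻ θ, ‖F n θ‖ₑ ^ 2 ∂ρ) atTop (𝓝 0) →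
    Tendsto (fun k : ℕ × ℕ => ∫⁻ θ, ‖gammaForm J (F k.1 - F k.2) θ‖ₑ ∂ρ) atTop (𝓝 0) →
    Tendsto (fun n => ∫⁻ θ, ‖gammaForm J (F n) θ‖ₑ ∂ρ) atTop (𝓝 0)

/-- `Lip¹(Θ) ⊆ 𝔻` and `Γ[F] = F' J⁻¹ (F')ᵗ` for all `F ∈ Lip¹(Θ)`. -/
def Identifies (J : EuclideanSpace ℝ (Fin d) → Matrix (Fin d) (Fin d) ℝ)
    (Θ : Set (EuclideanSpace ℝ (Fin d))) {ρ : Measure (EuclideanSpace ℝ (Fin d))}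
    [IsProbabilityMeasure ρ] (S : ErrorStructure ρ) : Prop :=
  ∀ F, IsLip1 Θ F → ∃ X : S.domain, X.1 =ᵐ[ρ] F ∧ S.Γ X X =ᵐ[ρ] gammaForm J F

/-- Hypothesis (E): there is an error structure on `(Θ, ρ)` with `Lip¹(Θ) ⊆ 𝔻` and
`Γ[F] = F' J⁻¹ (F')ᵗ` on `Lip¹(Θ)`, whose domain is minimal for inclusion and in which
`Lip¹(Θ)` is dense for the graph norm. Here `ρ` is a measure carried by `Θ`. -/
def HypothesisE (J : EuclideanSpace ℝ (Fin d) → Matrix (Fin d) (Fin d) ℝ)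
    (Θ : Set (EuclideanSpace ℝ (Fin d))) (ρ : Measure (EuclideanSpace ℝ (Fin d)))
    [IsProbabilityMeasure ρ] : Prop :=
  ∃ S : ErrorStructure ρ, Identifies J Θ S ∧
    (∀ S' : ErrorStructure ρ, Identifies J Θ S' → S.domain ≤ S'.domain) ∧
    ∀ U : S.domain, ∀ ε > 0, ∃ F, IsLip1 Θ F ∧
      ∃ X : S.domain, X.1 =ᵐ[ρ] F ∧ S.graphNorm (U - X) < ε

end Identification

/-! ### Hamza's conditions -/

/-- The singular set of `a : ℝ → [0, ∞]`: the points no neighbourhood of which has `1 / a`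
Lebesgue integrable (with `1 / 0 = ∞`). -/
def singularSet (a : ℝ → ℝ≥0∞) : Set ℝ :=
  {x | ∀ ε > 0, ∫⁻ y in Ioo (x - ε) (x + ε), (a y)⁻¹ = ∞}

/-- Hamza's conditions for the form `F ↦ ∫ (F')² dν` on the line: `ν` is absolutely continuous
with respect to the Lebesgue measure, and its density vanishes a.e. on its singular set. -/
def HamzaConditions (ν : Measure ℝ) : Prop :=
  ν ≪ volume ∧ ∀ᵐ x, x ∈ singularSet (ν.rnDeriv volume) → ν.rnDeriv volume x = 0

end FisherError

end

open FisherError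

/-! Both parts rest on one construction. Write `J⁻¹ = w² A` with `A` bounded and uniformly elliptic,
so that `F' J⁻¹ (F')ᵗ` is the quadratic form of `A` evaluated at the weighted gradient `w F'`. If `F
↦ w F'` is closable from `L²(ρ)` to `(L²(ρ))^d`, the closure of its graph is the graph of a
single-valued operator. Its domain carries the error structure: completeness is closedness of the
graph, and the functional calculus is the chain rule, which survives `L²` limits because the
functions involved are `C¹` and Lipschitz. Any other structure that identifies `J` is complete for
the same norm on `Lip¹(Θ)`, hence contains these limits; this gives minimality, while density holds
by construction (`IsWeightedGradient.hypothesisE`). Conversely, completeness of any structure that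
identifies `J` forces closability (`Identifies.isClosable`).

In (a), `w = 1` and `A = J⁻¹`. The Fisher information depends on the laws only
(`RegularModel.fisher_eq`), so `J` extends to a continuous positive definite field on the compact
closure of the box, and its inverse is elliptic. The gradient is closable because, tested against `g
/ q` with `g` smooth and compactly supported in the box, it can be integrated by parts for Lebesgue
measure.

In (b), `w = J^{-1/2}` and `A = 1`, and closability becomes that of `∫ (F')² dν` in `L²(ρ)` on the
line. Hamza's conditions suffice: where `1/a` is locally integrable, Cauchy-Schwarz turns `L²(ν)`
convergence of derivatives into local `L¹` convergence, so the limit derivative is that of the limit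
function, and elsewhere `a = 0`.

They are necessary because the closed derivative would otherwise be multivalued. The indicator of a
Lebesgue null set has zero primitive, hence must vanish `ν`-a.e. Near a singular point `y` there are
bumps of mass one and vanishing energy, so the Heaviside function at `y` has derivative `0`.
Averaging over a bounded set `K` of singular points where `a ≠ 0` gives `x ↦ |K ∩ (-∞, x)|` the
derivative `0`; it is also a primitive of the indicator of `K`, so `ν(K) = 0` and `K` is Lebesgue
null. -/

noncomputable section

namespace FisherError

/-! ### Error structures built from closed derivations -/

section ClosedDerivation

variable {W : Type*} [MeasurableSpace W] {m : Measure W} {d : ℕ}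

/-- The pairs (function, vector field) of square integrable objects. -/
abbrev GradSpace (m : Measure W) (d : ℕ) := Lp ℝ 2 m × (Fin d → Lp ℝ 2 m)

/-- Stability of a subspace of `GradSpace m d` under the chain rule for `C¹` Lipschitz functions. -/
def ChainClosed (G : Submodule ℝ (GradSpace m d)) : Prop :=
  ∀ (n : ℕ) (U : Fin n → GradSpace m d), (∀ i, U i ∈ G) → ∀ F : (Fin n → ℝ) → ℝ,
    ContDiff ℝ 1 F → (∃ K : ℝ≥0, LipschitzWith K F) →
    ∃ X ∈ G, (X.1 =ᵐ[m] fun w => F fun i => (U i).1 w) ∧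
      ∀ k, X.2 k =ᵐ[m] fun w =>
        ∑ i, fderiv ℝ F (fun j => (U j).1 w) (Pi.single i 1) * (U i).2 k w

/-- Measurable fields of symmetric matrices that are bounded and uniformly elliptic a.e. -/
structure UniformlyElliptic (m : Measure W) (A : W → Matrix (Fin d) (Fin d) ℝ) : Prop where
  aestronglyMeasurable : ∀ i j, AEStronglyMeasurable (fun w => A w i j) m
  symm : ∀ᵐ w ∂m, (A w).IsSymm
  bound : ∃ C, 0 ≤ C ∧ ∀ᵐ w ∂m, ∀ v : Fin d → ℝ, |v ⬝ᵥ (A w *ᵥ v)| ≤ C * ∑ i, v i ^ 2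
  entry_bound : ∃ C, ∀ᵐ w ∂m, ∀ i j, ‖A w i j‖ ≤ C
  elliptic : ∃ c > 0, ∀ᵐ w ∂m, ∀ v : Fin d → ℝ, c * ∑ i, v i ^ 2 ≤ v ⬝ᵥ (A w *ᵥ v)

variable {A : W → Matrix (Fin d) (Fin d) ℝ}

theorem UniformlyElliptic.integrable (hA : UniformlyElliptic m A) (V V' : Fin d → Lp ℝ 2 m) :
    MemLp (fun w => (fun k => V k w) ⬝ᵥ (A w *ᵥ fun l => V' l w)) 1 m := by
  rw [memLp_one_iff_integrable]
  simp only [dotProduct, Matrix.mulVec, Finset.mul_sum]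
  refine integrable_finsetSum _ fun i _ => integrable_finsetSum _ fun j _ => ?_
  obtain ⟨C, hC⟩ := hA.entry_bound
  have h1 : Integrable (fun w => V i w * V' j w) m :=
    (Lp.memLp (V i)).integrable_mul (Lp.memLp (V' j))
  refine (h1.bdd_mul (hA.aestronglyMeasurable i j)
    (hC.mono fun w hw => hw i j)).congr (ae_of_all _ fun w => ?_)
  simp only []
  ring

/-- The bilinear map `(V, V') ↦ V · A V'` from `L² × L²` to `L¹`. -/
def UniformlyElliptic.form (hA : UniformlyElliptic m A) :
    (Fin d → Lp ℝ 2 m) →ₗ[ℝ] (Fin d → Lp ℝ 2 m) →ₗ[ℝ] Lp ℝ 1 m :=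
  LinearMap.mk₂ ℝ (fun V V' => (hA.integrable V V').toLp _)
    (fun V V₁ V' => by
      rw [← MemLp.toLp_add]
      refine (MemLp.toLp_eq_toLp_iff _ _).2 ?_
      filter_upwards [ae_all_iff.2 fun k => Lp.coeFn_add (V k) (V₁ k)] with w hw
      simp only [Pi.add_apply] at hw ⊢
      simp only [hw, ← add_dotProduct]
      rfl)
    (fun c V V' => by
      rw [← MemLp.toLp_const_smul]
      refine (MemLp.toLp_eq_toLp_iff _ _).2 ?_
      filter_upwards [ae_all_iff.2 fun k => Lp.coeFn_smul c (V k)] with w hw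
      simp only [Pi.smul_apply] at hw ⊢
      simp only [hw, ← smul_dotProduct]
      rfl)
    (fun V V' V₁ => by
      rw [← MemLp.toLp_add]
      refine (MemLp.toLp_eq_toLp_iff _ _).2 ?_
      filter_upwards [ae_all_iff.2 fun k => Lp.coeFn_add (V' k) (V₁ k)] with w hw
      simp only [Pi.add_apply] at hw ⊢
      simp only [hw, ← dotProduct_add, ← Matrix.mulVec_add]
      rfl)
    (fun c V V' => by
      rw [← MemLp.toLp_const_smul]
      refine (MemLp.toLp_eq_toLp_iff _ _).2 ?_
      filter_upwards [ae_all_iff.2 fun k => Lp.coeFn_smul c (V' k)] with w hw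
      simp only [Pi.smul_apply] at hw ⊢
      simp only [hw, ← dotProduct_smul, ← Matrix.mulVec_smul]
      rfl)

theorem UniformlyElliptic.coeFn_form (hA : UniformlyElliptic m A) (V V' : Fin d → Lp ℝ 2 m) :
    hA.form V V' =ᵐ[m] fun w => (fun k => V k w) ⬝ᵥ (A w *ᵥ fun l => V' l w) :=
  MemLp.coeFn_toLp (hA.integrable V V')

theorem UniformlyElliptic.form_symm (hA : UniformlyElliptic m A) (V V' : Fin d → Lp ℝ 2 m) :
    hA.form V V' = hA.form V' V := by
  refine Lp.ext ?_
  filter_upwards [hA.coeFn_form V V', hA.coeFn_form V' V, hA.symm] with w h1 h2 h3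
  rw [h1, h2, Matrix.dotProduct_mulVec, ← Matrix.mulVec_transpose, h3.eq, dotProduct_comm]

theorem UniformlyElliptic.form_nonneg (hA : UniformlyElliptic m A) (V : Fin d → Lp ℝ 2 m) :
    0 ≤ hA.form V V := by
  rw [← Lp.coeFn_nonneg]
  obtain ⟨c, hc, h⟩ := hA.elliptic
  filter_upwards [hA.coeFn_form V V, h] with w h1 h2
  rw [h1]
  refine le_trans ?_ (h2 _)
  positivity

theorem norm_sq_eq_integral (u : Lp ℝ 2 m) : ‖u‖ ^ 2 = ∫ w, u w ^ 2 ∂m := by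
  rw [← real_inner_self_eq_norm_sq, L2.inner_def]
  refine integral_congr_ae (ae_of_all _ fun w => ?_)
  simp [pow_two]

theorem integrable_sq_coeFn (u : Lp ℝ 2 m) : Integrable (fun w => u w ^ 2) m :=
  (Lp.memLp u).integrable_sq

theorem norm_pi_sq_le {E : Type*} [NormedAddCommGroup E] (V : Fin d → E) :
    ‖V‖ ^ 2 ≤ ∑ k, ‖V k‖ ^ 2 := by
  have h : ‖V‖ ≤ Real.sqrt (∑ k, ‖V k‖ ^ 2) := by
    refine (pi_norm_le_iff_of_nonneg (Real.sqrt_nonneg _)).2 fun k => Real.le_sqrt_of_sq_le ?_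
    exact Finset.single_le_sum (f := fun k => ‖V k‖ ^ 2) (fun _ _ => by positivity)
      (Finset.mem_univ k)
  calc ‖V‖ ^ 2 ≤ Real.sqrt (∑ k, ‖V k‖ ^ 2) ^ 2 := by gcongr
    _ = _ := Real.sq_sqrt (by positivity)

theorem sum_norm_sq_le {E : Type*} [NormedAddCommGroup E] (V : Fin d → E) :
    ∑ k, ‖V k‖ ^ 2 ≤ d * ‖V‖ ^ 2 := by
  calc ∑ k, ‖V k‖ ^ 2 ≤ ∑ _k : Fin d, ‖V‖ ^ 2 := by
        gcongr with k; exact norm_le_pi_norm V k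
    _ = _ := by simp

/-- Together with `exists_le_integral`, this makes the energy equivalent to the squared norm of the
field, so the graph norm is equivalent to the norm of `GradSpace m d`. The factor `d` pays for the
sup norm on `Fin d → Lp ℝ 2 m`. -/
theorem UniformlyElliptic.exists_integral_le (hA : UniformlyElliptic m A) :
    ∃ C, 0 ≤ C ∧ ∀ V : Fin d → Lp ℝ 2 m, ∫ w, hA.form V V w ∂m ≤ C * ‖V‖ ^ 2 := by
  obtain ⟨C, hC, h⟩ := hA.bound
  refine ⟨C * d, by positivity, fun V => ?_⟩
  calc ∫ w, hA.form V V w ∂m ≤ ∫ w, C * ∑ k, V k w ^ 2 ∂m := by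
        refine integral_mono_ae (L1.integrable_coeFn _)
          ((integrable_finsetSum _ fun k _ => integrable_sq_coeFn (V k)).const_mul C) ?_
        filter_upwards [hA.coeFn_form V V, h] with w h1 h2
        rw [h1]
        exact (le_abs_self _).trans (h2 _)
    _ = C * ∑ k, ‖V k‖ ^ 2 := by
        rw [integral_const_mul, integral_finsetSum _ fun k _ => integrable_sq_coeFn (V k)]
        simp only [norm_sq_eq_integral]
    _ ≤ C * (d * ‖V‖ ^ 2) := by gcongr; exact sum_norm_sq_le V
    _ = _ := by ring

theorem UniformlyElliptic.exists_le_integral (hA : UniformlyElliptic m A) :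
    ∃ c > 0, ∀ V : Fin d → Lp ℝ 2 m, c * ‖V‖ ^ 2 ≤ ∫ w, hA.form V V w ∂m := by
  obtain ⟨c, hc, h⟩ := hA.elliptic
  refine ⟨c, hc, fun V => ?_⟩
  calc c * ‖V‖ ^ 2 ≤ c * ∑ k, ‖V k‖ ^ 2 := by gcongr; exact norm_pi_sq_le V
    _ = ∫ w, c * ∑ k, V k w ^ 2 ∂m := by
        rw [integral_const_mul, integral_finsetSum _ fun k _ => integrable_sq_coeFn (V k)]
        simp only [norm_sq_eq_integral]
    _ ≤ _ := by
        refine integral_mono_ae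
          ((integrable_finsetSum _ fun k _ => integrable_sq_coeFn (V k)).const_mul c)
          (L1.integrable_coeFn _) ?_
        filter_upwards [hA.coeFn_form V V, h] with w h1 h2
        rw [h1]
        exact h2 _

theorem ErrorStructure.integral_nonneg [IsProbabilityMeasure m] (S : ErrorStructure m) (U : S.domain) :
    0 ≤ ∫ w, S.Γ U U w ∂m :=
  integral_nonneg_of_ae ((Lp.coeFn_nonneg _).2 (S.nonneg U))

variable {G : Submodule ℝ (GradSpace m d)}

/-- The vector field attached to a function in the domain of a single-valued graph. -/
def derivationOf (G : Submodule ℝ (GradSpace m d)) (hG : ∀ x ∈ G, x.1 = 0 → x.2 = 0) :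
    (G.map (LinearMap.fst ℝ _ _)) →ₗ[ℝ] (Fin d → Lp ℝ 2 m) where
  toFun U := (G.mem_map.1 U.2).choose.2
  map_add' U V := by
    have hU := (G.mem_map.1 U.2).choose_spec
    have hV := (G.mem_map.1 V.2).choose_spec
    have hUV := (G.mem_map.1 (U + V).2).choose_spec
    have := hG _ (G.sub_mem hUV.1 (G.add_mem hU.1 hV.1)) (by
      have h1 := hU.2; have h2 := hV.2; have h3 := hUV.2
      simp only [LinearMap.fst_apply] at h1 h2 h3
      simp [h1, h2, h3])
    exact sub_eq_zero.1 this
  map_smul' c U := by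
    have hU := (G.mem_map.1 U.2).choose_spec
    have hV := (G.mem_map.1 (c • U).2).choose_spec
    have := hG _ (G.sub_mem hV.1 (G.smul_mem c hU.1)) (by
      have h1 := hU.2; have h2 := hV.2
      simp only [LinearMap.fst_apply] at h1 h2
      simp [h1, h2])
    exact sub_eq_zero.1 this

theorem derivationOf_mem (hG : ∀ x ∈ G, x.1 = 0 → x.2 = 0)
    (U : G.map (LinearMap.fst ℝ _ _)) : ((U : Lp ℝ 2 m), derivationOf G hG U) ∈ G := by
  have hU := (G.mem_map.1 U.2).choose_spec
  have : ((U : Lp ℝ 2 m), derivationOf G hG U) = (G.mem_map.1 U.2).choose :=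
    Prod.ext hU.2.symm rfl
  rw [this]
  exact hU.1

theorem derivationOf_eq (hG : ∀ x ∈ G, x.1 = 0 → x.2 = 0)
    (U : G.map (LinearMap.fst ℝ _ _)) {V : Fin d → Lp ℝ 2 m} (h : ((U : Lp ℝ 2 m), V) ∈ G) :
    derivationOf G hG U = V :=
  sub_eq_zero.1 (hG _ (G.sub_mem (derivationOf_mem hG U) h) (by simp))

/-- Passes from the graph norm to the product norm: `a` is the `L²` norm of the function, `b` that
of its field and `y` the energy, with `b² ≤ y / κ = (2 / κ) (y / 2)`. -/
theorem max_le_sqrt_graph {y κ a b : ℝ} (ha : 0 ≤ a) (hκ : 0 < κ) (hb : 0 ≤ b)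
    (hy : κ * b ^ 2 ≤ y) : max a b ≤ (1 + Real.sqrt (2 / κ)) * Real.sqrt (a ^ 2 + 1 / 2 * y) := by
  have hy0 : 0 ≤ y := le_trans (by positivity) hy
  have h1 : a ≤ Real.sqrt (a ^ 2 + 1 / 2 * y) :=
    Real.le_sqrt_of_sq_le (by nlinarith)
  have h2 : b ≤ Real.sqrt (2 / κ) * Real.sqrt (a ^ 2 + 1 / 2 * y) := by
    rw [← Real.sqrt_mul (by positivity)]
    refine Real.le_sqrt_of_sq_le ?_
    have : b ^ 2 ≤ y / κ := by rw [le_div_iff₀ hκ]; linarith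
    calc b ^ 2 ≤ y / κ := this
      _ = 2 / κ * (1 / 2 * y) := by field_simp
      _ ≤ _ := by gcongr; nlinarith [sq_nonneg a]
  have h3 := Real.sqrt_nonneg (a ^ 2 + 1 / 2 * y)
  have h4 := Real.sqrt_nonneg (2 / κ)
  refine max_le ?_ ?_ <;> nlinarith

/-- A closed, single-valued, densely defined graph that satisfies the chain rule, together with an
elliptic matrix field, defines an error structure. -/
def errorStructureOfGraph [IsProbabilityMeasure m] (hA : UniformlyElliptic m A) (hcl : IsClosed (G : Set (GradSpace m d)))
    (hG : ∀ x ∈ G, x.1 = 0 → x.2 = 0) (hchain : ChainClosed G)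
    (hdense : Dense ((G.map (LinearMap.fst ℝ _ _) : Submodule ℝ (Lp ℝ 2 m)) : Set (Lp ℝ 2 m)))
    (hone : ((Lp.const 2 m (1 : ℝ), 0) : GradSpace m d) ∈ G) : ErrorStructure m where
  domain := G.map (LinearMap.fst ℝ _ _)
  dense_domain := hdense
  Γ := (hA.form.compl₁₂ (derivationOf G hG) (derivationOf G hG))
  symm U V := hA.form_symm _ _
  nonneg U := hA.form_nonneg _
  one_mem := ⟨_, hone, rfl⟩
  functional_calculus n p U V F H hF hFL hH hHL := by
    obtain ⟨X, hX, hX1, hX2⟩ := hchain n (fun i => (((U i : Lp ℝ 2 m)), derivationOf G hG (U i)))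
      (fun i => derivationOf_mem hG (U i)) F hF hFL
    obtain ⟨Y, hY, hY1, hY2⟩ := hchain p (fun i => (((V i : Lp ℝ 2 m)), derivationOf G hG (V i)))
      (fun i => derivationOf_mem hG (V i)) H hH hHL
    refine ⟨⟨X.1, X, hX, rfl⟩, ⟨Y.1, Y, hY, rfl⟩, hX1, hY1, ?_⟩
    -- `derivationOf` chooses a field; single-valuedness identifies it with the one given by the
    -- chain rule.
    have eX := derivationOf_eq hG ⟨X.1, X, hX, rfl⟩ hX
    have eY := derivationOf_eq hG ⟨Y.1, Y, hY, rfl⟩ hY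
    simp only [LinearMap.compl₁₂_apply]
    rw [eX, eY]
    have hall : ∀ᵐ w ∂m, ∀ i j, hA.form (derivationOf G hG (U i)) (derivationOf G hG (V j)) w =
        (fun k => derivationOf G hG (U i) k w) ⬝ᵥ
          (A w *ᵥ fun l => derivationOf G hG (V j) l w) :=
      ae_all_iff.2 fun i => ae_all_iff.2 fun j => hA.coeFn_form _ _
    filter_upwards [hA.coeFn_form X.2 Y.2, hall, ae_all_iff.2 hX2, ae_all_iff.2 hY2]
      with w h1 h2 h3 h4
    rw [h1]
    simp only [h2, h3, h4]
    have e1 : (fun k => ∑ i, fderiv ℝ F (fun j => (U j : Lp ℝ 2 m) w) (Pi.single i 1) *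
          derivationOf G hG (U i) k w) =
        ∑ i, fderiv ℝ F (fun j => (U j : Lp ℝ 2 m) w) (Pi.single i 1) •
          fun k => derivationOf G hG (U i) k w := by
      ext k; simp
    have e2 : (fun k => ∑ i, fderiv ℝ H (fun j => (V j : Lp ℝ 2 m) w) (Pi.single i 1) *
          derivationOf G hG (V i) k w) =
        ∑ i, fderiv ℝ H (fun j => (V j : Lp ℝ 2 m) w) (Pi.single i 1) •
          fun k => derivationOf G hG (V i) k w := by
      ext k; simp
    rw [e1, e2, sum_dotProduct]
    refine Finset.sum_congr rfl fun i _ => ?_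
    rw [Matrix.mulVec_sum, dotProduct_sum]
    refine Finset.sum_congr rfl fun j _ => ?_
    rw [Matrix.mulVec_smul, smul_dotProduct, dotProduct_smul, smul_eq_mul, smul_eq_mul]
    ring
  complete U hU := by
    obtain ⟨c, hc, hlow⟩ := hA.exists_le_integral
    obtain ⟨C, hC, hup⟩ := hA.exists_integral_le
    simp only [LinearMap.compl₁₂_apply] at hU ⊢
    set D := derivationOf G hG with hD
    let g : ℕ → GradSpace m d := fun k => ((U k : Lp ℝ 2 m), D (U k))
    -- Ellipticity from below: Cauchy for the graph norm implies Cauchy in `GradSpace m d`.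
    have hg : CauchySeq g := by
      rw [Metric.cauchySeq_iff]
      intro ε hε
      have hκ : 0 < 1 + Real.sqrt (2 / c) := by positivity
      obtain ⟨N, hN⟩ := hU (ε / (1 + Real.sqrt (2 / c))) (by positivity)
      refine ⟨N, fun k hk l hl => ?_⟩
      have h1 := hN k hk l hl
      have h2 := max_le_sqrt_graph (norm_nonneg (U k - U l)) hc
        (norm_nonneg (D (U k - U l))) (hlow _)
      rw [lt_div_iff₀ hκ, mul_comm] at h1
      refine lt_of_le_of_lt ?_ h1
      refine le_trans (le_of_eq ?_) h2
      rw [dist_eq_norm, Prod.norm_def]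
      simp only [g, Prod.fst_sub, Prod.snd_sub, map_sub]
      rfl
    obtain ⟨x, hx⟩ := cauchySeq_tendsto_of_complete hg
    have hxG : x ∈ G := hcl.mem_of_tendsto hx
      (Eventually.of_forall fun k => derivationOf_mem hG (U k))
    refine ⟨⟨x.1, x, hxG, rfl⟩, ?_⟩
    have eD : D ⟨x.1, x, hxG, rfl⟩ = x.2 := derivationOf_eq hG _ hxG
    have hnorm : Tendsto (fun k => ‖g k - x‖) atTop (𝓝 0) :=
      tendsto_iff_norm_sub_tendsto_zero.1 hx
    have hlim : Tendsto (fun k => Real.sqrt ((1 + C) * ‖g k - x‖ ^ 2)) atTop (𝓝 0) := by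
      have h3 : Tendsto (fun k => (1 + C) * ‖g k - x‖ ^ 2) atTop (𝓝 0) := by
        simpa using (hnorm.pow 2).const_mul (1 + C)
      have h4 := (Real.continuous_sqrt.tendsto 0).comp h3
      rwa [Real.sqrt_zero] at h4
    -- The upper bound on `A` turns convergence in `GradSpace m d` back into convergence for the
    -- graph norm.
    refine squeeze_zero (fun _ => Real.sqrt_nonneg _) (fun k => Real.sqrt_le_sqrt ?_) hlim
    have h4 : ‖(U k : Lp ℝ 2 m) - x.1‖ ≤ ‖g k - x‖ := norm_fst_le (g k - x)
    have h5 : ‖D (U k) - x.2‖ ≤ ‖g k - x‖ := norm_snd_le (g k - x)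
    have h6 := hup (D (U k) - x.2)
    rw [map_sub, eD]
    have h7 : ‖U k - ⟨x.1, x, hxG, rfl⟩‖ = ‖(U k : Lp ℝ 2 m) - x.1‖ := rfl
    rw [h7]
    have h8 : ‖(U k : Lp ℝ 2 m) - x.1‖ ^ 2 ≤ ‖g k - x‖ ^ 2 := by gcongr
    have h9 : C * ‖D (U k) - x.2‖ ^ 2 ≤ C * ‖g k - x‖ ^ 2 := by gcongr
    have h10 : 0 ≤ C * ‖g k - x‖ ^ 2 := by positivity
    linarith

end ClosedDerivation

/-! ### Stability of the chain rule under closure -/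

section ChainRule

variable {W : Type*} [MeasurableSpace W] {m : Measure W} {d : ℕ}

theorem tendsto_Lp_of_memLp {u : ℕ → Lp ℝ 2 m} {v : Lp ℝ 2 m} :
    Tendsto u atTop (𝓝 v) ↔ Tendsto (fun n => eLpNorm (fun w => u n w - v w) 2 m) atTop (𝓝 0) :=
  Lp.tendsto_Lp_iff_tendsto_eLpNorm' u v

theorem tendsto_toLp_iff {f : ℕ → W → ℝ} (hf : ∀ n, MemLp (f n) 2 m) {v : Lp ℝ 2 m} :
    Tendsto (fun n => (hf n).toLp (f n)) atTop (𝓝 v) ↔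
      Tendsto (fun n => eLpNorm (fun w => f n w - v w) 2 m) atTop (𝓝 0) := by
  rw [tendsto_Lp_of_memLp]
  refine iff_of_eq (congrArg (fun t => Tendsto t atTop (𝓝 0)) (funext fun n => ?_))
  refine eLpNorm_congr_ae ?_
  filter_upwards [(hf n).coeFn_toLp] with w hw
  rw [hw]

/-- A sequence converging in `L²` for finitely many indices has a common subsequence converging
almost everywhere. -/
theorem exists_subseq_tendsto_ae {n : ℕ} (u : ℕ → Fin n → Lp ℝ 2 m) (v : Fin n → Lp ℝ 2 m)
    (h : Tendsto u atTop (𝓝 v)) :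
    ∃ s : ℕ → ℕ, StrictMono s ∧
      ∀ᵐ w ∂m, Tendsto (fun k => fun i => u (s k) i w) atTop (𝓝 fun i => v i w) := by
  suffices H : ∀ t : Finset (Fin n), ∃ s : ℕ → ℕ, StrictMono s ∧
      ∀ i ∈ t, ∀ᵐ w ∂m, Tendsto (fun k => u (s k) i w) atTop (𝓝 (v i w)) by
    obtain ⟨s, hs, hs'⟩ := H Finset.univ
    refine ⟨s, hs, ?_⟩
    filter_upwards [ae_all_iff.2 fun i => hs' i (Finset.mem_univ i)] with w hw
    exact tendsto_pi_nhds.2 hw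
  intro t
  induction t using Finset.induction_on with
  | empty => exact ⟨id, strictMono_id, by simp⟩
  | insert i t _ ih =>
    obtain ⟨s, hs, hs'⟩ := ih
    have h1 : Tendsto (fun k => u (s k) i) atTop (𝓝 (v i)) :=
      ((tendsto_pi_nhds.1 h i).comp hs.tendsto_atTop)
    obtain ⟨r, hr, hr'⟩ := (tendstoInMeasure_of_tendsto_Lp h1).exists_seq_tendsto_ae
    refine ⟨s ∘ r, hs.comp hr, fun j hj => ?_⟩
    rcases Finset.mem_insert.1 hj with rfl | hj
    · exact hr'
    · filter_upwards [hs' j hj] with w hw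
      exact hw.comp hr.tendsto_atTop

/-- `L²` convergence of products `b_k u_k` with `b_k` uniformly bounded and converging a.e. -/
theorem tendsto_eLpNorm_mul_sub {b : ℕ → W → ℝ} {b' : W → ℝ} {C : ℝ}
    (hbm : ∀ k, AEStronglyMeasurable (b k) m) (hbm' : AEStronglyMeasurable b' m)
    (hb : ∀ k w, ‖b k w‖ ≤ C) (hb' : ∀ᵐ w ∂m, Tendsto (fun k => b k w) atTop (𝓝 (b' w)))
    {u : ℕ → Lp ℝ 2 m} {v : Lp ℝ 2 m} (hu : Tendsto u atTop (𝓝 v)) :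
    Tendsto (fun k => eLpNorm (fun w => b k w * u k w - b' w * v w) 2 m) atTop (𝓝 0) := by
  have hv := Lp.memLp v
  -- The difference is `b_k (u_k - v) + (b_k - b') v`. The second term is dominated by `2C |v|` and
  -- tends to zero a.e.; the first is at most `C ‖u_k - v‖`.
  have h1 : Tendsto (fun k => eLpNorm (fun w => (b k w - b' w) * v w) 2 m) atTop (𝓝 0) := by
    have hlim : Tendsto (fun k => ∫⁻ w, ‖(b k w - b' w) * v w‖ₑ ^ (2 : ℝ) ∂m) atTop
        (𝓝 (∫⁻ _, 0 ∂m)) := by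
      refine tendsto_lintegral_of_dominated_convergence'
        (fun w => ‖(2 * C) * v w‖ₑ ^ (2 : ℝ)) (fun k => ?_) (fun k => ?_) ?_ ?_
      · exact ((((hbm k).sub hbm').mul hv.1).enorm).pow_const _
      · filter_upwards [hb'] with w hw
        have hle : ‖b' w‖ ≤ C := le_of_tendsto hw.norm (Eventually.of_forall fun k => hb k w)
        gcongr ?_ ^ _
        rw [enorm_le_iff_norm_le, norm_mul, norm_mul]
        gcongr
        calc ‖b k w - b' w‖ ≤ ‖b k w‖ + ‖b' w‖ := norm_sub_le _ _
          _ ≤ C + C := add_le_add (hb k w) hle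
          _ = 2 * C := by ring
          _ ≤ ‖2 * C‖ := le_abs_self _
      · have := (hv.const_mul (2 * C))
        exact (lintegral_rpow_enorm_lt_top_of_eLpNorm_lt_top (p := 2) (by simp) (by simp)
          this.eLpNorm_lt_top).ne
      · filter_upwards [hb'] with w hw
        have h2 : Tendsto (fun k => (b k w - b' w) * v w) atTop (𝓝 0) := by
          have := (hw.sub_const (b' w)).mul_const (v w)
          simpa using this
        have h3 := (ENNReal.continuous_rpow_const (y := 2)).tendsto (0 : ℝ≥0∞)
        have h4 := (continuous_enorm.tendsto (0 : ℝ)).comp h2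
        rw [enorm_zero] at h4
        have h5 := h3.comp h4
        rw [ENNReal.zero_rpow_of_pos (by norm_num)] at h5
        exact h5
    rw [lintegral_zero] at hlim
    have h6 := ((ENNReal.continuous_rpow_const (y := 1 / 2)).tendsto (0 : ℝ≥0∞)).comp hlim
    rw [ENNReal.zero_rpow_of_pos (by norm_num)] at h6
    refine h6.congr fun k => ?_
    rw [eLpNorm_eq_lintegral_rpow_enorm_toReal (by simp) (by simp)]
    simp
  have h2 : Tendsto (fun k => ENNReal.ofReal C * eLpNorm (fun w => u k w - v w) 2 m) atTop
      (𝓝 0) := by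
    have := ENNReal.Tendsto.const_mul (tendsto_Lp_of_memLp.1 hu)
      (Or.inr (ENNReal.ofReal_ne_top (r := C)))
    simpa using this
  have h3 := h2.add h1
  rw [add_zero] at h3
  refine tendsto_of_tendsto_of_tendsto_of_le_of_le tendsto_const_nhds h3 (fun _ => zero_le)
    fun k => ?_
  have e : (fun w => b k w * u k w - b' w * v w) =
      (fun w => b k w * (u k w - v w)) + fun w => (b k w - b' w) * v w := by
    ext w; simp only [Pi.add_apply]; ring
  have m1 : AEStronglyMeasurable (fun w => u k w - v w) m := (Lp.memLp (u k)).1.sub hv.1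
  rw [e]
  refine (eLpNorm_add_le ((hbm k).mul m1) (((hbm k).sub hbm').mul hv.1) (by norm_num)).trans ?_
  refine add_le_add ?_ le_rfl
  refine eLpNorm_le_mul_eLpNorm_of_ae_le_mul (ae_of_all _ fun w => ?_) 2
  rw [Pi.mul_apply, norm_mul]
  gcongr
  exact hb k w

theorem norm_fderiv_single_le_of_lipschitz {n : ℕ} {F : (Fin n → ℝ) → ℝ} {K : ℝ≥0}
    (hK : LipschitzWith K F) (x : Fin n → ℝ) (i : Fin n) :
    ‖fderiv ℝ F x (Pi.single i 1)‖ ≤ K := by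
  refine ((fderiv ℝ F x).le_opNorm _).trans ?_
  have h1 := norm_fderiv_le_of_lipschitz ℝ hK (x₀ := x)
  have h2 : ‖(Pi.single i 1 : Fin n → ℝ)‖ ≤ 1 := by
    rw [Pi.norm_single]; simp
  calc _ ≤ (K : ℝ) * 1 := by gcongr
    _ = K := mul_one _

theorem norm_sub_le_sum_of_lipschitz {n : ℕ} {F : (Fin n → ℝ) → ℝ} {K : ℝ≥0}
    (hK : LipschitzWith K F) (x y : Fin n → ℝ) : ‖F x - F y‖ ≤ K * ∑ i, ‖x i - y i‖ := by
  refine (hK.norm_sub_le x y).trans ?_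
  gcongr
  refine (pi_norm_le_iff_of_nonneg (by positivity)).2 fun i => ?_
  exact Finset.single_le_sum (f := fun i => ‖x i - y i‖) (fun _ _ => by positivity)
    (Finset.mem_univ i)

theorem aestronglyMeasurable_pi_coeFn {n : ℕ} (v : Fin n → Lp ℝ 2 m) :
    AEStronglyMeasurable (fun w => fun i => v i w) m :=
  (aemeasurable_pi_iff.2 fun i => (Lp.memLp (v i)).1.aemeasurable).aestronglyMeasurable

theorem memLp_comp_of_lipschitz [IsFiniteMeasure m] {n : ℕ} {F : (Fin n → ℝ) → ℝ} {K : ℝ≥0}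
    (hK : LipschitzWith K F) (v : Fin n → Lp ℝ 2 m) :
    MemLp (fun w => F fun i => v i w) 2 m := by
  have h0 : MemLp (fun w => ∑ i, ‖v i w‖) 2 m :=
    memLp_finsetSum _ (f := fun i w => ‖v i w‖) fun i _ => (Lp.memLp (v i)).norm
  have h1 : MemLp (fun w => ‖F 0‖ + K * ∑ i, ‖v i w‖) 2 m :=
    (memLp_const ‖F 0‖).add (h0.const_mul (K : ℝ))
  refine h1.of_le (hK.continuous.comp_aestronglyMeasurable (aestronglyMeasurable_pi_coeFn v))
    (ae_of_all _ fun w => ?_)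
  have h2 := norm_sub_le_sum_of_lipschitz hK (fun i => v i w) 0
  have h3 : ‖F fun i => v i w‖ ≤ ‖F 0‖ + ‖(F fun i => v i w) - F 0‖ := by
    have := norm_add_le (F 0) ((F fun i => v i w) - F 0)
    simpa using this
  simp only [Pi.zero_apply, sub_zero] at h2
  exact (h3.trans (by gcongr)).trans (le_abs_self _)

theorem memLp_fderiv_comp_of_lipschitz {n : ℕ} {F : (Fin n → ℝ) → ℝ} {K : ℝ≥0}
    (hF : ContDiff ℝ 1 F) (hK : LipschitzWith K F) (v u : Fin n → Lp ℝ 2 m) :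
    MemLp (fun w => ∑ i, fderiv ℝ F (fun j => v j w) (Pi.single i 1) * u i w) 2 m := by
  refine memLp_finsetSum Finset.univ (f := fun i w =>
    fderiv ℝ F (fun j => v j w) (Pi.single i 1) * u i w) fun i _ => ?_
  have hdF : Continuous fun x => fderiv ℝ F x (Pi.single i 1) :=
    (hF.continuous_fderiv (by norm_num)).clm_apply continuous_const
  refine ((Lp.memLp (u i)).const_mul (K : ℝ)).of_le
    ((hdF.comp_aestronglyMeasurable (aestronglyMeasurable_pi_coeFn v)).mul
      (Lp.memLp (u i)).1) (ae_of_all _ fun w => ?_)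
  rw [norm_mul, norm_mul]
  gcongr
  exact (norm_fderiv_single_le_of_lipschitz hK _ i).trans (le_abs_self _)

/-- For approximants in `G`, the composed functions converge in `L²` because `F` is Lipschitz. Their
fields are sums of bounded factors `∂ᵢF(u)` times `L²`-convergent ones; along an a.e. convergent
subsequence the factors converge by continuity of `∂ᵢF`, and `tendsto_eLpNorm_mul_sub` applies. -/
theorem ChainClosed.topologicalClosure [IsFiniteMeasure m] {G : Submodule ℝ (GradSpace m d)}
    (hG : ChainClosed G) : ChainClosed G.topologicalClosure := by
  intro n U hU F hF ⟨K, hK⟩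
  have hseq : ∀ i, ∃ u : ℕ → GradSpace m d, (∀ k, u k ∈ G) ∧ Tendsto u atTop (𝓝 (U i)) :=
    fun i => mem_closure_iff_seq_limit.1 (by
      have := hU i
      rwa [← SetLike.mem_coe, Submodule.topologicalClosure_coe] at this)
  choose u hu hlim using hseq
  obtain ⟨s, hs, hae⟩ := exists_subseq_tendsto_ae (fun k i => (u i k).1) (fun i => (U i).1)
    (tendsto_pi_nhds.2 fun i => (continuous_fst.tendsto _).comp (hlim i))
  choose X hXG hX1 hX2 using fun k => hG n (fun i => u i (s k)) (fun i => hu i (s k)) F hF ⟨K, hK⟩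
  have hFc := hF.continuous
  have hdF : ∀ i, Continuous fun x => fderiv ℝ F x (Pi.single i 1) := fun i =>
    (hF.continuous_fderiv (by norm_num)).clm_apply continuous_const
  have hvm := aestronglyMeasurable_pi_coeFn (m := m) (n := n)
  have hsub : ∀ i, Tendsto (fun k => u i (s k)) atTop (𝓝 (U i)) := fun i =>
    (hlim i).comp hs.tendsto_atTop
  have hY1 : MemLp (fun w => F fun i => (U i).1 w) 2 m := memLp_comp_of_lipschitz hK _
  have hY2 : ∀ k, MemLp (fun w => ∑ i, fderiv ℝ F (fun j => (U j).1 w) (Pi.single i 1) *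
      (U i).2 k w) 2 m := fun k => memLp_fderiv_comp_of_lipschitz hF hK _ fun i => (U i).2 k
  refine ⟨(hY1.toLp _, fun k => (hY2 k).toLp _), ?_, hY1.coeFn_toLp, fun k => (hY2 k).coeFn_toLp⟩
  rw [← SetLike.mem_coe, Submodule.topologicalClosure_coe]
  refine mem_closure_of_tendsto (f := X) (b := atTop) ?_ (Eventually.of_forall hXG)
  refine Prod.tendsto_iff _ _ |>.2 ⟨?_, tendsto_pi_nhds.2 fun k => ?_⟩
  · rw [tendsto_Lp_of_memLp]
    have hz : Tendsto (fun k => ∑ i, ENNReal.ofReal K *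
        eLpNorm (fun w => (u i (s k)).1 w - (U i).1 w) 2 m) atTop (𝓝 0) := by
      have : Tendsto (fun k => ∑ i, ENNReal.ofReal K *
        eLpNorm (fun w => (u i (s k)).1 w - (U i).1 w) 2 m) atTop
          (𝓝 (∑ _i : Fin n, ENNReal.ofReal K * 0)) :=
        tendsto_finsetSum _ fun i _ => ENNReal.Tendsto.const_mul
          (tendsto_Lp_of_memLp.1 ((continuous_fst.tendsto _).comp (hsub i)))
          (Or.inr ENNReal.ofReal_ne_top)
      simpa using this
    refine tendsto_of_tendsto_of_tendsto_of_le_of_le tendsto_const_nhds hz (fun _ => zero_le)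
      fun k => ?_
    have hm : ∀ i, AEStronglyMeasurable (fun w => ‖(u i (s k)).1 w - (U i).1 w‖) m :=
      fun i => ((Lp.memLp _).1.sub (Lp.memLp _).1).norm
    have hbound : eLpNorm (fun w => (X k).1 w - hY1.toLp _ w) 2 m ≤
        ENNReal.ofReal K * eLpNorm (∑ i, fun w => ‖(u i (s k)).1 w - (U i).1 w‖) 2 m := by
      refine eLpNorm_le_mul_eLpNorm_of_ae_le_mul ?_ 2
      filter_upwards [hX1 k, hY1.coeFn_toLp] with w h1 h2
      rw [h1, h2]
      refine (norm_sub_le_sum_of_lipschitz hK _ _).trans ?_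
      rw [Finset.sum_apply]
      gcongr
      exact le_abs_self _
    refine hbound.trans ?_
    rw [← Finset.mul_sum]
    gcongr
    refine (eLpNorm_sum_le (fun i _ => hm i) (by norm_num)).trans ?_
    simp only [eLpNorm_norm]
    rfl
  · rw [tendsto_Lp_of_memLp]
    have hterm : ∀ i, Tendsto (fun l => eLpNorm (fun w =>
        fderiv ℝ F (fun j => (u j (s l)).1 w) (Pi.single i 1) * (u i (s l)).2 k w -
        fderiv ℝ F (fun j => (U j).1 w) (Pi.single i 1) * (U i).2 k w) 2 m) atTop (𝓝 0) := by
      intro i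
      refine tendsto_eLpNorm_mul_sub (C := K)
        (fun l => (hdF i).comp_aestronglyMeasurable (hvm fun j => (u j (s l)).1))
        ((hdF i).comp_aestronglyMeasurable (hvm fun j => (U j).1))
        (fun l w => norm_fderiv_single_le_of_lipschitz hK _ i) ?_
        (((continuous_apply k).tendsto _).comp ((continuous_snd.tendsto _).comp (hsub i)))
      filter_upwards [hae] with w hw
      exact ((hdF i).tendsto _).comp hw
    have hz := tendsto_finsetSum Finset.univ fun i _ => hterm i
    rw [Finset.sum_const_zero] at hz
    refine tendsto_of_tendsto_of_tendsto_of_le_of_le tendsto_const_nhds hz (fun _ => zero_le)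
      fun l => ?_
    refine le_trans (le_of_eq (eLpNorm_congr_ae ?_)) (eLpNorm_sum_le (fun i _ => ?_) (by norm_num))
    · filter_upwards [hX2 l k, (hY2 k).coeFn_toLp] with w h1 h2
      rw [h1, h2, ← Finset.sum_sub_distrib, Finset.sum_apply]
    · exact (((hdF i).comp_aestronglyMeasurable (hvm fun j => (u j (s l)).1)).mul
        (Lp.memLp _).1).sub (((hdF i).comp_aestronglyMeasurable (hvm fun j => (U j).1)).mul
        (Lp.memLp _).1)

end ChainRule

/-! ### Completeness of an error structure as closedness of its form -/

section Limits

variable {W : Type*} [MeasurableSpace W] {m : Measure W} [IsProbabilityMeasure m]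

/-- The quadratic form of an error structure is closed. -/
theorem ErrorStructure.exists_limit (S : ErrorStructure m) (X : ℕ → S.domain) (u : Lp ℝ 2 m)
    (hu : Tendsto (fun n => (X n : Lp ℝ 2 m)) atTop (𝓝 u))
    (hΓ : Tendsto (fun k : ℕ × ℕ => ∫ w, S.Γ (X k.1 - X k.2) (X k.1 - X k.2) w ∂m) atTop (𝓝 0)) :
    ∃ L : S.domain, (L : Lp ℝ 2 m) = u ∧
      Tendsto (fun n => ∫ w, S.Γ (X n - L) (X n - L) w ∂m) atTop (𝓝 0) := by
  have hc : Tendsto (fun k : ℕ × ℕ => ‖X k.1 - X k.2‖) atTop (𝓝 0) := by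
    have h1 : Tendsto (fun k : ℕ × ℕ => (X k.1 : Lp ℝ 2 m) - X k.2) atTop (𝓝 (u - u)) := by
      rw [← prod_atTop_atTop_eq]
      exact (hu.comp tendsto_fst).sub (hu.comp tendsto_snd)
    rw [sub_self] at h1
    have h2 := h1.norm
    rwa [norm_zero] at h2
  have hs : Tendsto (fun k : ℕ × ℕ => Real.sqrt (‖X k.1 - X k.2‖ ^ 2 +
      1 / 2 * ∫ w, S.Γ (X k.1 - X k.2) (X k.1 - X k.2) w ∂m)) atTop (𝓝 0) := by
    have h1 := (Real.continuous_sqrt.tendsto _).comp ((hc.pow 2).add (hΓ.const_mul (1 / 2)))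
    rw [show (0 : ℝ) ^ 2 + 1 / 2 * 0 = 0 by norm_num, Real.sqrt_zero] at h1
    exact h1
  obtain ⟨L, hL⟩ := S.complete X fun ε hε => by
    obtain ⟨N, hN⟩ := eventually_atTop_prod_self'.1 (hs.eventually (gt_mem_nhds hε))
    exact ⟨N, fun k hk l hl => hN k hk l hl⟩
  have hsq : Tendsto (fun n => ‖X n - L‖ ^ 2 + 1 / 2 * ∫ w, S.Γ (X n - L) (X n - L) w ∂m)
      atTop (𝓝 0) := by
    have h1 := hL.pow 2
    rw [zero_pow two_ne_zero] at h1
    refine h1.congr fun n => Real.sq_sqrt ?_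
    have := S.integral_nonneg (X n - L)
    positivity
  refine ⟨L, ?_, ?_⟩
  · have h1 : Tendsto (fun n => ‖X n - L‖ ^ 2) atTop (𝓝 0) :=
      squeeze_zero (fun _ => by positivity)
        (fun n => by have := S.integral_nonneg (X n - L); linarith) hsq
    have h2 := (Real.continuous_sqrt.tendsto _).comp h1
    have h3 : Tendsto (fun n => ‖(X n : Lp ℝ 2 m) - L‖) atTop (𝓝 0) := by
      rw [Real.sqrt_zero] at h2
      refine h2.congr fun n => ?_
      simp only [Function.comp_apply, Real.sqrt_sq (norm_nonneg _)]
      rfl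
    exact tendsto_nhds_unique (tendsto_iff_norm_sub_tendsto_zero.2 h3) hu
  · have h1 := hsq.const_mul 2
    rw [mul_zero] at h1
    refine squeeze_zero (fun n => S.integral_nonneg _) (fun n => ?_) h1
    have : 0 ≤ ‖X n - L‖ ^ 2 := by positivity
    linarith

/-- The limit supplied by completeness has `L²` class `0`, hence is `0` in the domain: a closed form
is closable. -/
theorem ErrorStructure.tendsto_integral_of_coe_tendsto_zero (S : ErrorStructure m)
    (X : ℕ → S.domain) (hu : Tendsto (fun n => (X n : Lp ℝ 2 m)) atTop (𝓝 0))
    (hΓ : Tendsto (fun k : ℕ × ℕ => ∫ w, S.Γ (X k.1 - X k.2) (X k.1 - X k.2) w ∂m) atTop (𝓝 0)) :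
    Tendsto (fun n => ∫ w, S.Γ (X n) (X n) w ∂m) atTop (𝓝 0) := by
  obtain ⟨L, hL, h⟩ := S.exists_limit X 0 hu hΓ
  have : L = 0 := Subtype.ext hL
  simpa [this] using h

end Limits

/-! ### Calculus of `C¹` Lipschitz functions on an open set -/

section LipFunctions

variable {d : ℕ} {Θ : Set (EuclideanSpace ℝ (Fin d))} {ρ : Measure (EuclideanSpace ℝ (Fin d))}
  {F H : EuclideanSpace ℝ (Fin d) → ℝ}

theorem IsLip1.differentiableAt (hF : IsLip1 Θ F) (hΘ : IsOpen Θ) {θ} (hθ : θ ∈ Θ) :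
    DifferentiableAt ℝ F θ :=
  (hF.1.differentiableOn (by norm_num)).differentiableAt (hΘ.mem_nhds hθ)

theorem IsLip1.const (c : ℝ) : IsLip1 Θ fun _ => c :=
  ⟨contDiffOn_const, 0, LipschitzWith.lipschitzOnWith (LipschitzWith.const c)⟩

theorem IsLip1.add (hF : IsLip1 Θ F) (hH : IsLip1 Θ H) : IsLip1 Θ (F + H) := by
  obtain ⟨hF, K, hK⟩ := hF
  obtain ⟨hH, L, hL⟩ := hH
  exact ⟨hF.add hH, K + L, hK.add hL⟩

theorem IsLip1.const_smul (hF : IsLip1 Θ F) (c : ℝ) : IsLip1 Θ (c • F) := by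
  obtain ⟨hF, K, hK⟩ := hF
  refine ⟨hF.const_smul c, ‖c‖₊ * K, LipschitzOnWith.of_dist_le_mul fun x hx y hy => ?_⟩
  have := hK.dist_le_mul x hx y hy
  simp only [Pi.smul_apply, dist_smul₀, NNReal.coe_mul, coe_nnnorm, mul_assoc]
  gcongr

theorem IsLip1.sub (hF : IsLip1 Θ F) (hH : IsLip1 Θ H) : IsLip1 Θ (F - H) := by
  have := hF.add (hH.const_smul (-1))
  rwa [neg_one_smul, ← sub_eq_add_neg] at this

theorem IsLip1.of_hasCompactSupport (hF : ContDiff ℝ 1 F) (hc : HasCompactSupport F) :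
    IsLip1 Θ F := by
  obtain ⟨K, hK⟩ := hF.lipschitzWith_of_hasCompactSupport hc (by norm_num)
  exact ⟨hF.contDiffOn, K, hK.lipschitzOnWith⟩

theorem IsLip1.comp {n : ℕ} {F : Fin n → EuclideanSpace ℝ (Fin d) → ℝ}
    (hF : ∀ i, IsLip1 Θ (F i)) {Φ : (Fin n → ℝ) → ℝ} (hΦ : ContDiff ℝ 1 Φ)
    (hL : ∃ K : ℝ≥0, LipschitzWith K Φ) : IsLip1 Θ fun θ => Φ fun i => F i θ := by
  obtain ⟨K, hK⟩ := hL
  choose h1 L hL using hF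
  refine ⟨hΦ.comp_contDiffOn (contDiffOn_pi.2 h1), K * ∑ i, L i,
    hK.comp_lipschitzOnWith (LipschitzOnWith.of_dist_le_mul fun x hx y hy => ?_)⟩
  refine (dist_pi_le_iff (by positivity)).2 fun i => ((hL i).dist_le_mul x hx y hy).trans ?_
  gcongr
  exact Finset.single_le_sum (fun _ _ => zero_le) (Finset.mem_univ i)

theorem grad_add (hΘ : IsOpen Θ) (hF : IsLip1 Θ F) (hH : IsLip1 Θ H) {θ} (hθ : θ ∈ Θ)
    (i : Fin d) : grad (F + H) θ i = grad F θ i + grad H θ i := by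
  simp [grad, fderiv_add (hF.differentiableAt hΘ hθ) (hH.differentiableAt hΘ hθ)]

theorem grad_const_smul (c : ℝ) (hΘ : IsOpen Θ) (hF : IsLip1 Θ F) {θ} (hθ : θ ∈ Θ)
    (i : Fin d) : grad (c • F) θ i = c * grad F θ i := by
  simp [grad, fderiv_const_smul (hF.differentiableAt hΘ hθ) c]

theorem grad_const (c : ℝ) (θ : EuclideanSpace ℝ (Fin d)) (i : Fin d) :
    grad (fun _ => c) θ i = 0 := by
  simp [grad]

theorem grad_comp {n : ℕ} {F : Fin n → EuclideanSpace ℝ (Fin d) → ℝ} (hΘ : IsOpen Θ)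
    (hF : ∀ i, IsLip1 Θ (F i)) {Φ : (Fin n → ℝ) → ℝ} (hΦ : ContDiff ℝ 1 Φ) {θ} (hθ : θ ∈ Θ)
    (k : Fin d) : grad (fun θ => Φ fun i => F i θ) θ k =
      ∑ i, fderiv ℝ Φ (fun j => F j θ) (Pi.single i 1) * grad (F i) θ k := by
  have h1 : HasFDerivAt (fun θ => fun i => F i θ)
      (ContinuousLinearMap.pi fun i => fderiv ℝ (F i) θ) θ :=
    hasFDerivAt_pi.2 fun i => ((hF i).differentiableAt hΘ hθ).hasFDerivAt
  have h2 : HasFDerivAt Φ (fderiv ℝ Φ fun i => F i θ) (fun i => F i θ) :=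
    ((hΦ.differentiable (by norm_num)) _).hasFDerivAt
  have h3 := (h2.comp θ h1).fderiv
  simp only [grad]
  have h4 : (Φ ∘ fun θ i => F i θ) = fun θ => Φ fun i => F i θ := rfl
  rw [h4] at h3
  rw [h3, ContinuousLinearMap.comp_apply]
  have h5 := LinearMap.pi_apply_eq_sum_univ
    (fderiv ℝ Φ fun i => F i θ : (Fin n → ℝ) →ₗ[ℝ] ℝ)
    ((ContinuousLinearMap.pi fun i => fderiv ℝ (F i) θ) (EuclideanSpace.single k 1))
  rw [ContinuousLinearMap.coe_coe] at h5
  rw [h5]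
  refine Finset.sum_congr rfl fun i _ => ?_
  have h6 : (fun j => if i = j then (1 : ℝ) else 0) = Pi.single i 1 := by
    ext j; simp [Pi.single_apply, eq_comm]
  rw [smul_eq_mul, mul_comm, ContinuousLinearMap.pi_apply, h6]

theorem IsLip1.exists_grad_bound (hF : IsLip1 Θ F) (hΘ : IsOpen Θ) :
    ∃ K : ℝ, ∀ θ ∈ Θ, ∀ i, ‖grad F θ i‖ ≤ K := by
  obtain ⟨-, K, hK⟩ := hF
  refine ⟨K, fun θ hθ i => ?_⟩
  refine ((fderiv ℝ F θ).le_opNorm _).trans ?_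
  have h1 := norm_fderiv_le_of_lipschitzOn ℝ (hΘ.mem_nhds hθ) hK
  simpa using h1

theorem IsLip1.continuousOn_grad (hF : IsLip1 Θ F) (hΘ : IsOpen Θ) (i : Fin d) :
    ContinuousOn (fun θ => grad F θ i) Θ :=
  (hF.1.continuousOn_fderiv_of_isOpen hΘ (by norm_num)).clm_apply continuousOn_const

theorem aestronglyMeasurable_of_continuousOn {f : EuclideanSpace ℝ (Fin d) → ℝ}
    (hf : ContinuousOn f Θ) (hΘ : IsOpen Θ) (hρ : ∀ᵐ θ ∂ρ, θ ∈ Θ) : AEStronglyMeasurable f ρ := by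
  have := hf.aestronglyMeasurable (μ := ρ) hΘ.measurableSet
  rwa [Measure.restrict_eq_self_of_ae_mem hρ] at this

/-- A Lipschitz function grows at most linearly away from an anchor point of `Θ`, so a second moment
of `ρ` suffices even when `Θ` is unbounded. -/
theorem IsLip1.memLp [IsProbabilityMeasure ρ] (hF : IsLip1 Θ F) (hΘ : IsOpen Θ)
    (hρ : ∀ᵐ θ ∂ρ, θ ∈ Θ) (h2 : MemLp (fun θ : EuclideanSpace ℝ (Fin d) => θ) 2 ρ) :
    MemLp F 2 ρ := by
  obtain ⟨θs, hθs⟩ := hρ.exists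
  obtain ⟨K, hK⟩ := hF.2
  have h1 : MemLp (fun θ => ‖F θs‖ + K * (‖θ‖ + ‖θs‖)) 2 ρ :=
    (memLp_const ‖F θs‖).add ((h2.norm.add (memLp_const ‖θs‖)).const_mul (K : ℝ))
  refine h1.of_le (aestronglyMeasurable_of_continuousOn hF.1.continuousOn hΘ hρ) ?_
  filter_upwards [hρ] with θ hθ
  have h3 := hK.dist_le_mul θ hθ θs hθs
  rw [dist_eq_norm, dist_eq_norm] at h3
  calc ‖F θ‖ = ‖F θs + (F θ - F θs)‖ := by congr 1; ring
    _ ≤ ‖F θs‖ + K * ‖θ - θs‖ := (norm_add_le _ _).trans (by gcongr)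
    _ ≤ ‖F θs‖ + K * (‖θ‖ + ‖θs‖) := by gcongr; exact norm_sub_le _ _
    _ ≤ _ := le_abs_self _

theorem IsLip1.memLp_grad (hF : IsLip1 Θ F) (hΘ : IsOpen Θ) (hρ : ∀ᵐ θ ∂ρ, θ ∈ Θ)
    {w : EuclideanSpace ℝ (Fin d) → ℝ} (hw : MemLp w 2 ρ) (i : Fin d) :
    MemLp (fun θ => w θ * grad F θ i) 2 ρ := by
  obtain ⟨K, hK⟩ := hF.exists_grad_bound hΘ
  refine (hw.const_mul K).of_le
    (hw.1.mul (aestronglyMeasurable_of_continuousOn (hF.continuousOn_grad hΘ i) hΘ hρ)) ?_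
  filter_upwards [hρ] with θ hθ
  rw [norm_mul, norm_mul, mul_comm]
  gcongr
  exact (hK θ hθ i).trans (le_abs_self _)

end LipFunctions

/-! ### The error structure of a closable weighted gradient -/

section WeightedGradient

variable {d : ℕ} {Θ : Set (EuclideanSpace ℝ (Fin d))} {ρ : Measure (EuclideanSpace ℝ (Fin d))}
  {J : EuclideanSpace ℝ (Fin d) → Matrix (Fin d) (Fin d) ℝ} {w : EuclideanSpace ℝ (Fin d) → ℝ}
  {A : EuclideanSpace ℝ (Fin d) → Matrix (Fin d) (Fin d) ℝ}

/-- The situation in which `F ↦ F' J⁻¹ (F')ᵗ` is the quadratic form of the closable weighted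
gradient `F ↦ w F'` and of the elliptic field `A = w⁻² J⁻¹`. -/
structure IsWeightedGradient (Θ : Set (EuclideanSpace ℝ (Fin d)))
    (ρ : Measure (EuclideanSpace ℝ (Fin d)))
    (J : EuclideanSpace ℝ (Fin d) → Matrix (Fin d) (Fin d) ℝ)
    (w : EuclideanSpace ℝ (Fin d) → ℝ)
    (A : EuclideanSpace ℝ (Fin d) → Matrix (Fin d) (Fin d) ℝ) : Prop where
  isOpen : IsOpen Θ
  ae_mem : ∀ᵐ θ ∂ρ, θ ∈ Θ
  memLp_id : MemLp (fun θ : EuclideanSpace ℝ (Fin d) => θ) 2 ρ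
  memLp_weight : MemLp w 2 ρ
  elliptic : UniformlyElliptic ρ A
  inv_eq : ∀ᵐ θ ∂ρ, (J θ)⁻¹ = w θ ^ 2 • A θ
  closable : ∀ F : ℕ → EuclideanSpace ℝ (Fin d) → ℝ, (∀ n, IsLip1 Θ (F n)) →
    Tendsto (fun n => eLpNorm (F n) 2 ρ) atTop (𝓝 0) → ∀ v : Fin d → Lp ℝ 2 ρ,
    (∀ i, Tendsto (fun n => eLpNorm (fun θ => w θ * grad (F n) θ i - v i θ) 2 ρ) atTop (𝓝 0)) →
    v = 0

/-- The graph of the weighted gradient `F ↦ w F'` on `Lip¹(Θ)`. -/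
def IsWeightedGradient.graph (h : IsWeightedGradient Θ ρ J w A) :
    Submodule ℝ (GradSpace ρ d) where
  carrier := {x | ∃ F, IsLip1 Θ F ∧ x.1 =ᵐ[ρ] F ∧ ∀ i, x.2 i =ᵐ[ρ] fun θ => w θ * grad F θ i}
  add_mem' := by
    rintro x y ⟨F, hF, hx, hx'⟩ ⟨H, hH, hy, hy'⟩
    refine ⟨F + H, hF.add hH, (Lp.coeFn_add _ _).trans (hx.add hy), fun i => ?_⟩
    filter_upwards [Lp.coeFn_add (x.2 i) (y.2 i), hx' i, hy' i, h.ae_mem] with θ h1 h2 h3 h4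
    rw [Prod.snd_add, Pi.add_apply, h1, Pi.add_apply, h2, h3, grad_add h.isOpen hF hH h4]
    ring
  zero_mem' := by
    refine ⟨fun _ => 0, IsLip1.const 0, Lp.coeFn_zero _ _ _, fun i => ?_⟩
    filter_upwards [Lp.coeFn_zero ℝ 2 ρ] with θ h1
    rw [grad_const, mul_zero]
    exact h1
  smul_mem' := by
    rintro c x ⟨F, hF, hx, hx'⟩
    refine ⟨c • F, hF.const_smul c, (Lp.coeFn_smul _ _).trans (hx.const_smul c), fun i => ?_⟩
    filter_upwards [Lp.coeFn_smul c (x.2 i), hx' i, h.ae_mem] with θ h1 h2 h3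
    rw [Prod.smul_snd, Pi.smul_apply, h1, Pi.smul_apply, h2, grad_const_smul c h.isOpen hF h3,
      smul_eq_mul]
    ring

theorem IsWeightedGradient.memLp [IsProbabilityMeasure ρ] (h : IsWeightedGradient Θ ρ J w A)
    {F : EuclideanSpace ℝ (Fin d) → ℝ} (hF : IsLip1 Θ F) : MemLp F 2 ρ :=
  hF.memLp h.isOpen h.ae_mem h.memLp_id

theorem IsWeightedGradient.memLp_grad (h : IsWeightedGradient Θ ρ J w A)
    {F : EuclideanSpace ℝ (Fin d) → ℝ} (hF : IsLip1 Θ F) (i : Fin d) :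
    MemLp (fun θ => w θ * grad F θ i) 2 ρ :=
  hF.memLp_grad h.isOpen h.ae_mem h.memLp_weight i

theorem IsWeightedGradient.mem_graph [IsProbabilityMeasure ρ] (h : IsWeightedGradient Θ ρ J w A)
    {F : EuclideanSpace ℝ (Fin d) → ℝ} (hF : IsLip1 Θ F) :
    ((h.memLp hF).toLp F, fun i => (h.memLp_grad hF i).toLp _) ∈ h.graph :=
  ⟨F, hF, (h.memLp hF).coeFn_toLp, fun i => (h.memLp_grad hF i).coeFn_toLp⟩

theorem IsWeightedGradient.chainClosed [IsProbabilityMeasure ρ] (h : IsWeightedGradient Θ ρ J w A) :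
    ChainClosed h.graph := by
  intro n U hU Φ hΦ hL
  choose F hF hF1 hF2 using hU
  have hc := IsLip1.comp hF hΦ hL
  refine ⟨_, h.mem_graph hc, ?_, fun k => ?_⟩
  · filter_upwards [(h.memLp hc).coeFn_toLp, ae_all_iff.2 hF1] with θ h1 h2
    rw [h1]
    simp only [h2]
  · filter_upwards [(h.memLp_grad hc k).coeFn_toLp, ae_all_iff.2 hF1,
      ae_all_iff.2 fun i => hF2 i k, h.ae_mem] with θ h1 h2 h3 h4
    rw [h1, grad_comp h.isOpen hF hΦ h4, Finset.mul_sum]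
    simp only [h2, h3]
    exact Finset.sum_congr rfl fun i _ => by ring

theorem IsWeightedGradient.mem_closure (h : IsWeightedGradient Θ ρ J w A) {x : GradSpace ρ d} :
    x ∈ h.graph.topologicalClosure ↔
      ∃ u : ℕ → GradSpace ρ d, (∀ k, u k ∈ h.graph) ∧ Tendsto u atTop (𝓝 x) := by
  rw [← SetLike.mem_coe, Submodule.topologicalClosure_coe]
  exact mem_closure_iff_seq_limit

theorem IsWeightedGradient.single_valued [IsProbabilityMeasure ρ] (h : IsWeightedGradient Θ ρ J w A) :
    ∀ x ∈ h.graph.topologicalClosure, x.1 = 0 → x.2 = 0 := by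
  intro x hx hx0
  obtain ⟨u, hu, hlim⟩ := h.mem_closure.1 hx
  choose F hF hF1 hF2 using hu
  refine h.closable F hF ?_ x.2 fun i => ?_
  · have h1 := tendsto_Lp_of_memLp.1 ((continuous_fst.tendsto _).comp hlim)
    refine h1.congr fun n => eLpNorm_congr_ae ?_
    rw [hx0]
    filter_upwards [hF1 n, Lp.coeFn_zero ℝ 2 ρ] with θ h2 h3
    rw [Function.comp_apply, h2, h3]
    simp
  · have h1 := tendsto_Lp_of_memLp.1
      (((continuous_apply i).tendsto _).comp ((continuous_snd.tendsto _).comp hlim))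
    refine h1.congr fun n => eLpNorm_congr_ae ?_
    filter_upwards [hF2 n i] with θ h2
    rw [Function.comp_apply, Function.comp_apply, h2]

/-- Smooth compactly supported functions are dense in `L²(ρ)` and are Lipschitz. -/
theorem IsWeightedGradient.dense [IsProbabilityMeasure ρ] (h : IsWeightedGradient Θ ρ J w A) :
    Dense ((h.graph.topologicalClosure.map (LinearMap.fst ℝ _ _) : Submodule ℝ (Lp ℝ 2 ρ)) :
      Set (Lp ℝ 2 ρ)) := by
  refine (Lp.dense_hasCompactSupport_contDiff (E := EuclideanSpace ℝ (Fin d)) (F := ℝ) (μ := ρ)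
    (p := 2) (by simp)).mono ?_
  rintro f ⟨g, hfg, hgc, hg⟩
  have hL : IsLip1 Θ g := IsLip1.of_hasCompactSupport (hg.of_le (by simp)) hgc
  refine ⟨_, h.graph.le_topologicalClosure (h.mem_graph hL), ?_⟩
  exact Lp.ext ((h.memLp hL).coeFn_toLp.trans hfg.symm)

theorem IsWeightedGradient.one_mem [IsProbabilityMeasure ρ] (h : IsWeightedGradient Θ ρ J w A) :
    ((Lp.const 2 ρ (1 : ℝ), 0) : GradSpace ρ d) ∈ h.graph.topologicalClosure := by
  refine h.graph.le_topologicalClosure ⟨fun _ => 1, IsLip1.const 1, Lp.coeFn_const 2 ρ 1,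
    fun i => ?_⟩
  filter_upwards [Lp.coeFn_zero ℝ 2 ρ] with θ h1
  rw [grad_const, mul_zero]
  exact h1

/-- The error structure whose domain is the completion of `Lip¹(Θ)`. -/
def IsWeightedGradient.errorStructure [IsProbabilityMeasure ρ] (h : IsWeightedGradient Θ ρ J w A) : ErrorStructure ρ :=
  errorStructureOfGraph h.elliptic h.graph.isClosed_topologicalClosure h.single_valued
    h.chainClosed.topologicalClosure h.dense h.one_mem

theorem IsWeightedGradient.Γ_eq [IsProbabilityMeasure ρ] (h : IsWeightedGradient Θ ρ J w A) {x : GradSpace ρ d}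
    (hx : x ∈ h.graph.topologicalClosure) {X : h.errorStructure.domain}
    (hX : (X : Lp ℝ 2 ρ) = x.1) : h.errorStructure.Γ X X = h.elliptic.form x.2 x.2 := by
  have e : derivationOf _ h.single_valued X = x.2 :=
    derivationOf_eq h.single_valued X (by rw [hX]; exact hx)
  have h1 : h.errorStructure.Γ X X = h.elliptic.form (derivationOf _ h.single_valued X)
    (derivationOf _ h.single_valued X) := rfl
  rw [h1, e]

/-- The two factors `w` carried by the fields restore `w² A = J⁻¹`. -/
theorem IsWeightedGradient.form_eq_gammaForm (h : IsWeightedGradient Θ ρ J w A)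
    {F : EuclideanSpace ℝ (Fin d) → ℝ} {v : Fin d → Lp ℝ 2 ρ}
    (hv : ∀ i, v i =ᵐ[ρ] fun θ => w θ * grad F θ i) :
    h.elliptic.form v v =ᵐ[ρ] gammaForm J F := by
  filter_upwards [h.elliptic.coeFn_form v v, ae_all_iff.2 hv, h.inv_eq] with θ h1 h2 h3
  have e : (fun k => v k θ) = w θ • grad F θ := by ext k; simp [h2]
  rw [h1, gammaForm, h3, e, Matrix.mulVec_smul, smul_dotProduct, dotProduct_smul,
    Matrix.smul_mulVec, dotProduct_smul]
  simp only [smul_eq_mul]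
  ring

theorem IsWeightedGradient.identifies [IsProbabilityMeasure ρ] (h : IsWeightedGradient Θ ρ J w A) :
    Identifies J Θ h.errorStructure := by
  intro F hF
  have hm := h.graph.le_topologicalClosure (h.mem_graph hF)
  refine ⟨⟨_, _, hm, rfl⟩, (h.memLp hF).coeFn_toLp, ?_⟩
  rw [h.Γ_eq hm rfl]
  exact h.form_eq_gammaForm fun i => (h.memLp_grad hF i).coeFn_toLp

/-- In any error structure that identifies `J`, the value of `Γ` on a difference of two elements
representing functions of `Lip¹(Θ)`. -/
theorem Identifies.Γ_sub [IsProbabilityMeasure ρ] {S : ErrorStructure ρ} (hS : Identifies J Θ S)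
    {F H : EuclideanSpace ℝ (Fin d) → ℝ} (hF : IsLip1 Θ F) (hH : IsLip1 Θ H) {X Y : S.domain}
    (hX : X.1 =ᵐ[ρ] F) (hY : Y.1 =ᵐ[ρ] H) :
    S.Γ (X - Y) (X - Y) =ᵐ[ρ] gammaForm J (F - H) := by
  obtain ⟨Z, hZ, hZ'⟩ := hS _ (hF.sub hH)
  have : X - Y = Z := Subtype.ext (Lp.ext (((Lp.coeFn_sub _ _).trans (hX.sub hY)).trans hZ.symm))
  rwa [this]

/-- An element of the closure is an `L²` limit of `Lip¹` functions whose fields are Cauchy. On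
`Lip¹(Θ)` the energy of `S` is prescribed by `J`, so the sequence is Cauchy in `S` too, and
completeness puts its limit in the domain of `S`. -/
theorem IsWeightedGradient.minimal [IsProbabilityMeasure ρ] (h : IsWeightedGradient Θ ρ J w A) {S : ErrorStructure ρ}
    (hS : Identifies J Θ S) : h.errorStructure.domain ≤ S.domain := by
  rintro _ ⟨x, hx, rfl⟩
  obtain ⟨u, hu, hlim⟩ := h.mem_closure.1 hx
  obtain ⟨C, -, hC⟩ := h.elliptic.exists_integral_le
  have hu' := hu
  choose F hF hF1 hF2 using hu'
  choose X hX hX' using fun k => hS (F k) (hF k)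
  have hXu : ∀ k, (X k : Lp ℝ 2 ρ) = (u k).1 := fun k => Lp.ext ((hX k).trans (hF1 k).symm)
  obtain ⟨L, hL, -⟩ := S.exists_limit X x.1
    (by simp only [hXu]; exact (continuous_fst.tendsto _).comp hlim) (by
      have h0 : Tendsto (fun k : ℕ × ℕ => (u k.1).2 - (u k.2).2) atTop (𝓝 (x.2 - x.2)) := by
        have h2 := (continuous_snd.tendsto _).comp hlim
        rw [← prod_atTop_atTop_eq]
        exact (h2.comp tendsto_fst).sub (h2.comp tendsto_snd)
      rw [sub_self] at h0
      have h1 := (h0.norm.pow 2).const_mul C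
      rw [norm_zero, zero_pow two_ne_zero, mul_zero] at h1
      refine squeeze_zero (fun k => S.integral_nonneg _) (fun k => ?_) h1
      -- On the difference of two `Lip¹` functions both energies equal the integral of `gammaForm`,
      -- and the one built from `A` is at most `C` times the squared norm of the difference of the
      -- fields.
      refine le_trans (le_of_eq (integral_congr_ae ?_)) (hC _)
      obtain ⟨H, hH, hH1, hH2⟩ := h.graph.sub_mem (hu k.1) (hu k.2)
      obtain ⟨Z, hZ, hZ'⟩ := hS H hH
      have e : X k.1 - X k.2 = Z := by
        refine Subtype.ext (Lp.ext (EventuallyEq.trans ?_ hZ.symm))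
        rw [Submodule.coe_sub, hXu, hXu]
        exact hH1
      rw [e]
      exact hZ'.trans (h.form_eq_gammaForm hH2).symm)
  rw [LinearMap.fst_apply, ← hL]
  exact L.2

theorem IsWeightedGradient.hypothesisE [IsProbabilityMeasure ρ] (h : IsWeightedGradient Θ ρ J w A) :
    HypothesisE J Θ ρ := by
  refine ⟨h.errorStructure, h.identifies, fun S hS => h.minimal hS, fun U ε hε => ?_⟩
  obtain ⟨C, hC0, hC⟩ := h.elliptic.exists_integral_le
  have hU := derivationOf_mem h.single_valued U
  obtain ⟨u, hu, hlim⟩ := h.mem_closure.1 hU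
  set x : GradSpace ρ d := ((U : Lp ℝ 2 ρ), derivationOf _ h.single_valued U) with hx
  have hlim' : Tendsto (fun k => Real.sqrt ((1 + C) * ‖x - u k‖ ^ 2)) atTop (𝓝 0) := by
    have h1 := tendsto_iff_norm_sub_tendsto_zero.1 hlim
    simp only [norm_sub_rev _ x] at h1
    have h3 := (h1.pow 2).const_mul (1 + C)
    rw [zero_pow two_ne_zero, mul_zero] at h3
    have h4 := (Real.continuous_sqrt.tendsto 0).comp h3
    rwa [Real.sqrt_zero] at h4
  obtain ⟨k, hk⟩ := (hlim'.eventually (gt_mem_nhds hε)).exists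
  obtain ⟨F, hF, hF1, hF2⟩ := hu k
  have hm := h.graph.le_topologicalClosure (hu k)
  let X : h.errorStructure.domain := ⟨(u k).1, u k, hm, rfl⟩
  refine ⟨F, hF, X, hF1, lt_of_le_of_lt (Real.sqrt_le_sqrt ?_) hk⟩
  have h4 : ‖U - X‖ ≤ ‖x - u k‖ := norm_fst_le (x - u k)
  have h5 : ‖x.2 - (u k).2‖ ≤ ‖x - u k‖ := norm_snd_le (x - u k)
  have h6 := hC (x.2 - (u k).2)
  have h7 : h.errorStructure.Γ (U - X) (U - X) =
      h.elliptic.form (x.2 - (u k).2) (x.2 - (u k).2) :=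
    h.Γ_eq (x := x - u k) (Submodule.sub_mem _ hU hm) rfl
  rw [h7]
  have h8 : ‖U - X‖ ^ 2 ≤ ‖x - u k‖ ^ 2 := by gcongr
  have h9 : C * ‖x.2 - (u k).2‖ ^ 2 ≤ C * ‖x - u k‖ ^ 2 := by gcongr
  have h10 : 0 ≤ C * ‖x - u k‖ ^ 2 := by positivity
  linarith

/-- The form of an error structure that identifies `J` is closable on `Lip¹(Θ)`. -/
theorem Identifies.isClosable [IsProbabilityMeasure ρ] {S : ErrorStructure ρ} (hS : Identifies J Θ S) :
    IsClosable J Θ ρ := by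
  intro F hF h0 hΓ
  choose X hX hX' using fun n => hS (F n) (hF n)
  -- Closability is phrased with `∫⁻` and completeness with `∫`; positivity of `Γ` reconciles the
  -- two.
  have key : ∀ (Y : S.domain), ENNReal.ofReal (∫ θ, S.Γ Y Y θ ∂ρ) = ∫⁻ θ, ‖S.Γ Y Y θ‖ₑ ∂ρ := by
    intro Y
    have h1 : 0 ≤ᵐ[ρ] S.Γ Y Y := (Lp.coeFn_nonneg _).2 (S.nonneg Y)
    rw [ofReal_integral_eq_lintegral_ofReal (L1.integrable_coeFn _) h1]
    refine lintegral_congr_ae ?_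
    filter_upwards [h1] with θ h2
    rw [Real.enorm_eq_ofReal h2]
  have key' : ∀ (Y : S.domain), ∫ θ, S.Γ Y Y θ ∂ρ = (∫⁻ θ, ‖S.Γ Y Y θ‖ₑ ∂ρ).toReal := by
    intro Y
    rw [← key, ENNReal.toReal_ofReal (S.integral_nonneg Y)]
  have h1 : Tendsto (fun n => (X n : Lp ℝ 2 ρ)) atTop (𝓝 0) := by
    rw [tendsto_Lp_of_memLp]
    have h2 := ((ENNReal.continuous_rpow_const (y := 1 / 2)).tendsto (0 : ℝ≥0∞)).comp h0
    rw [ENNReal.zero_rpow_of_pos (by norm_num)] at h2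
    refine h2.congr fun n => ?_
    rw [eLpNorm_eq_lintegral_rpow_enorm_toReal (by simp) (by simp)]
    simp only [Function.comp_apply, ENNReal.toReal_ofNat, ENNReal.rpow_ofNat]
    congr 1
    refine lintegral_congr_ae ?_
    filter_upwards [hX n, Lp.coeFn_zero ℝ 2 ρ] with θ h3 h4
    rw [h3, h4]
    simp
  have h2 := S.tendsto_integral_of_coe_tendsto_zero X h1 (by
    have h3 := (ENNReal.tendsto_toReal ENNReal.zero_ne_top).comp hΓ
    rw [ENNReal.toReal_zero] at h3
    refine h3.congr fun k => ?_
    rw [key']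
    simp only [Function.comp_apply]
    congr 1
    refine lintegral_congr_ae ?_
    filter_upwards [hS.Γ_sub (hF k.1) (hF k.2) (hX k.1) (hX k.2)] with θ h4
    rw [h4])
  have h3 := (ENNReal.continuous_ofReal.tendsto _).comp h2
  rw [ENNReal.ofReal_zero] at h3
  refine h3.congr fun n => ?_
  rw [Function.comp_apply, key]
  refine lintegral_congr_ae ?_
  filter_upwards [hX' n] with θ h4
  rw [h4]

end WeightedGradient

/-! ### Hamza's conditions imply closability on the line -/

section HamzaSufficient

/-- Closability of `F ↦ ∫ (F')² dν` in `L²(ρ)` on the `C¹` Lipschitz functions of the line. -/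
def LineClosable (ρ ν : Measure ℝ) : Prop :=
  ∀ F : ℕ → ℝ → ℝ, (∀ n, ContDiff ℝ 1 (F n) ∧ ∃ K : ℝ≥0, LipschitzWith K (F n)) →
    Tendsto (fun n => eLpNorm (F n) 2 ρ) atTop (𝓝 0) → ∀ g : ℝ → ℝ, Measurable g → MemLp g 2 ν →
    Tendsto (fun n => eLpNorm (fun x => deriv (F n) x - g x) 2 ν) atTop (𝓝 0) → g =ᵐ[ν] 0

theorem eLpNorm_two_eq {α : Type*} [MeasurableSpace α] (f : α → ℝ) (μ : Measure α) :
    eLpNorm f 2 μ = (∫⁻ x, ‖f x‖ₑ ^ 2 ∂μ) ^ (1 / 2 : ℝ) := by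
  rw [eLpNorm_eq_lintegral_rpow_enorm_toReal (by simp) (by simp)]
  simp

variable {a : ℝ → ℝ≥0∞}

theorem ae_ne_zero_of_lintegral_inv (ha : Measurable a) {I : Set ℝ}
    (hI : ∫⁻ y in I, (a y)⁻¹ ≠ ∞) : ∀ᵐ x ∂volume.restrict I, a x ≠ 0 := by
  filter_upwards [ae_lt_top ha.inv hI] with x hx h0
  simp [h0] at hx

/-- Cauchy-Schwarz for `|f| = (|f| a^{1/2}) a^{-1/2}`, a factorization valid a.e. on `I` because `a`
is finite and, `1/a` being integrable there, nonzero. -/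
theorem lintegral_enorm_le_of_inv (ha : Measurable a) (hfin : ∀ᵐ x, a x < ∞) {I : Set ℝ}
    (hI : ∫⁻ y in I, (a y)⁻¹ ≠ ∞) {f : ℝ → ℝ} (hf : Measurable f) :
    ∫⁻ x in I, ‖f x‖ₑ ≤
      eLpNorm f 2 (volume.withDensity a) * (∫⁻ y in I, (a y)⁻¹) ^ (1 / 2 : ℝ) := by
  have h0 := ae_ne_zero_of_lintegral_inv ha hI
  have hsq : ∀ t : ℝ≥0∞, (t ^ (1 / 2 : ℝ)) ^ (2 : ℝ) = t := fun t => by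
    rw [← ENNReal.rpow_mul]; norm_num
  calc ∫⁻ x in I, ‖f x‖ₑ
      = ∫⁻ x in I, ((fun x => ‖f x‖ₑ * a x ^ (1 / 2 : ℝ)) * fun x => (a x)⁻¹ ^ (1 / 2 : ℝ)) x := by
        refine lintegral_congr_ae ?_
        filter_upwards [h0, ae_restrict_of_ae hfin] with x h1 h2
        rw [Pi.mul_apply, mul_assoc, ← ENNReal.mul_rpow_of_nonneg _ _ (by norm_num),
          ENNReal.mul_inv_cancel h1 h2.ne, ENNReal.one_rpow, mul_one]
    _ ≤ (∫⁻ x in I, (‖f x‖ₑ * a x ^ (1 / 2 : ℝ)) ^ (2 : ℝ)) ^ (1 / 2 : ℝ) *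
          (∫⁻ x in I, ((a x)⁻¹ ^ (1 / 2 : ℝ)) ^ (2 : ℝ)) ^ (1 / 2 : ℝ) :=
        ENNReal.lintegral_mul_le_Lp_mul_Lq _ Real.HolderConjugate.two_two
          (by fun_prop) (by fun_prop)
    _ ≤ _ := by
        simp only [hsq]
        gcongr
        rw [eLpNorm_two_eq, lintegral_withDensity_eq_lintegral_mul _ ha (by fun_prop)]
        refine ENNReal.rpow_le_rpow (z := 1 / 2) ?_ (by norm_num)
        refine (setLIntegral_le_lintegral _ _).trans (lintegral_mono fun x => ?_)
        rw [ENNReal.mul_rpow_of_nonneg _ _ (by norm_num), hsq, Pi.mul_apply, mul_comm]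
        norm_num

variable {ρ ν : Measure ℝ}

/-- The derivatives converge to `g` in `L¹(p, q)`, so `F n v - F n u` tends to the integral of `g`
from `u` to `v`. A subsequence of `F` tends to `0` a.e., so the primitive of `g` vanishes a.e., then
everywhere by continuity, and Lebesgue differentiation gives `g = 0`. -/
theorem ae_eq_zero_on_Ioo (ha : Measurable a) (hfin : ∀ᵐ x, a x < ∞)
    (hνρ : volume.withDensity a ≪ ρ) {p q : ℝ} (hI : ∫⁻ y in Ioo p q, (a y)⁻¹ ≠ ∞)
    {F : ℕ → ℝ → ℝ} (hF : ∀ n, ContDiff ℝ 1 (F n))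
    (hF0 : Tendsto (fun n => eLpNorm (F n) 2 ρ) atTop (𝓝 0)) {g : ℝ → ℝ} (hg : Measurable g)
    (hg2 : MemLp g 2 (volume.withDensity a))
    (hFg : Tendsto (fun n => eLpNorm (fun x => deriv (F n) x - g x) 2 (volume.withDensity a))
      atTop (𝓝 0)) : ∀ᵐ x ∂volume.restrict (Ioo p q), g x = 0 := by
  rcases le_or_gt q p with hpq | hpq
  · simp [Ioo_eq_empty_of_le hpq]
  have hroot : (∫⁻ y in Ioo p q, (a y)⁻¹) ^ (1 / 2 : ℝ) ≠ ∞ :=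
    ENNReal.rpow_ne_top_of_nonneg (by norm_num) hI
  have hdc : ∀ n, Continuous (deriv (F n)) := fun n => (hF n).continuous_deriv (by norm_num)
  have hgI : Integrable g (volume.restrict (Ioo p q)) := by
    refine ⟨hg.aestronglyMeasurable, ?_⟩
    exact (lintegral_enorm_le_of_inv ha hfin hI hg).trans_lt
      (ENNReal.mul_lt_top hg2.eLpNorm_lt_top hroot.lt_top)
  have hdI : ∀ n, Integrable (deriv (F n)) (volume.restrict (Ioo p q)) := fun n =>
    ((hdc n).integrableOn_Icc).mono_set Ioo_subset_Icc_self
  have hL1 : Tendsto (fun n => ∫⁻ x in Ioo p q, ‖deriv (F n) x - g x‖ₑ) atTop (𝓝 0) := by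
    have h1 := ENNReal.Tendsto.mul_const hFg (Or.inr hroot)
    rw [zero_mul] at h1
    exact tendsto_of_tendsto_of_tendsto_of_le_of_le tendsto_const_nhds h1 (fun _ => zero_le)
      fun n => lintegral_enorm_le_of_inv ha hfin hI ((hdc n).measurable.sub hg)
  have hset : ∀ u ∈ Ioo p q, ∀ v ∈ Ioo p q,
      Tendsto (fun n => ∫ x in Ioc u v, deriv (F n) x) atTop (𝓝 (∫ x in Ioc u v, g x)) := by
    intro u hu v hv
    have h1 := tendsto_setIntegral_of_L1 g hgI.1 (Eventually.of_forall hdI) hL1 (Ioc u v)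
    have h2 : Ioc u v ∩ Ioo p q = Ioc u v :=
      inter_eq_left.2 fun x hx => ⟨hu.1.trans hx.1, hx.2.trans_lt hv.2⟩
    simpa only [Measure.restrict_restrict measurableSet_Ioc, h2] using h1
  have hint : ∀ u ∈ Ioo p q, ∀ v ∈ Ioo p q,
      Tendsto (fun n => F n v - F n u) atTop (𝓝 (∫ x in u..v, g x)) := by
    intro u hu v hv
    -- An interval integral is the difference of the integrals over `Ioc u v` and `Ioc v u`, which
    -- covers both orders of `u` and `v`.
    have h1 := (hset u hu v hv).sub (hset v hv u hu)
    refine h1.congr fun n => ?_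
    rw [← intervalIntegral.integral_deriv_eq_sub (f := F n)
      (fun x _ => (hF n).differentiable (by norm_num) x) ((hdc n).intervalIntegrable _ _)]
    rfl
  obtain ⟨s, hs, hs'⟩ := (tendstoInMeasure_of_tendsto_eLpNorm (p := 2) (μ := ρ) (g := 0)
    (by norm_num) (fun n => (hF n).continuous.aestronglyMeasurable)
    aestronglyMeasurable_const (by simpa using hF0)).exists_seq_tendsto_ae
  -- A `ρ`-null set is `ν`-null, hence Lebesgue null within `(p, q)`, where `a ≠ 0` a.e.
  have hae : ∀ᵐ x ∂volume.restrict (Ioo p q), Tendsto (fun k => F (s k) x) atTop (𝓝 0) := by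
    have h1 := (ae_withDensity_iff ha).1 (hνρ.ae_le hs')
    filter_upwards [ae_restrict_of_ae h1, ae_ne_zero_of_lintegral_inv ha hI] with x h2 h3
    exact h2 h3
  have hne : NeZero (volume.restrict (Ioo p q)) := ⟨by
    rw [Ne, Measure.restrict_eq_zero, Real.volume_Ioo]
    simpa using hpq⟩
  obtain ⟨u, hu, huI⟩ := (hae.and (ae_restrict_mem measurableSet_Ioo)).exists
  have hprim : ∀ᵐ v ∂volume.restrict (Ioo p q), ∫ x in u..v, g x = 0 := by
    filter_upwards [hae, ae_restrict_mem measurableSet_Ioo] with v hv hvI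
    have h1 := (hint u huI v hvI).comp hs.tendsto_atTop
    have h2 := hv.sub hu
    rw [sub_zero] at h2
    exact tendsto_nhds_unique h1 h2
  have hgi : IntervalIntegrable g volume p q :=
    (intervalIntegrable_iff_integrableOn_Ioo_of_le hpq.le).2 hgI
  have hcont : ContinuousOn (fun v => ∫ x in u..v, g x) (Ioo p q) :=
    (intervalIntegral.continuousOn_primitive_interval' hgi
      (Icc_subset_uIcc (Ioo_subset_Icc_self huI))).mono
      (Ioo_subset_Icc_self.trans Icc_subset_uIcc)
  have hzero : EqOn (fun v => ∫ x in u..v, g x) 0 (Ioo p q) :=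
    Measure.eqOn_open_of_ae_eq hprim isOpen_Ioo hcont continuousOn_const
  filter_upwards [ae_restrict_of_ae hgi.ae_hasDerivAt_integral,
    ae_restrict_mem measurableSet_Ioo] with x hx hxI
  have h1 := hx (Icc_subset_uIcc (Ioo_subset_Icc_self hxI)) u
    (Icc_subset_uIcc (Ioo_subset_Icc_self huI))
  have h2 : (fun v => ∫ x in u..v, g x) =ᶠ[𝓝 x] fun _ => (0 : ℝ) := by
    filter_upwards [isOpen_Ioo.mem_nhds hxI] with v hv
    exact hzero hv
  exact h1.unique ((hasDerivAt_const x (0 : ℝ)).congr_of_eventuallyEq h2)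

/-- Every point off the singular set has an interval on which `1/a` is integrable, so `g` vanishes
a.e. there; on the singular set `a = 0` a.e., which `ν` does not see. -/
theorem HamzaConditions.lineClosable [IsFiniteMeasure ν] (hνρ : ν ≪ ρ) (h : HamzaConditions ν) :
    LineClosable ρ ν := by
  intro F hF hF0 g hg hg2 hFg
  obtain ⟨hac, hS⟩ := h
  have hν : volume.withDensity (ν.rnDeriv volume) = ν := Measure.withDensity_rnDeriv_eq _ _ hac
  have ha := Measure.measurable_rnDeriv ν volume
  have hfin := Measure.rnDeriv_lt_top ν volume
  set a := ν.rnDeriv volume with ha_def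
  clear_value a
  subst hν
  rw [EventuallyEq, ae_withDensity_iff ha]
  -- Local nullity is enough, the line being second countable.
  have hnull : volume ({x | x ∉ singularSet a} ∩ {x | g x ≠ 0}) = 0 := by
    refine measure_null_of_locally_null _ fun x hx => ?_
    have hx1 : ¬ ∀ ε > 0, ∫⁻ y in Ioo (x - ε) (x + ε), (a y)⁻¹ = ∞ := hx.1
    push Not at hx1
    obtain ⟨ε, hε, hI⟩ := hx1
    refine ⟨Ioo (x - ε) (x + ε) ∩ {x | g x ≠ 0}, ?_, ?_⟩
    · refine mem_of_superset (inter_mem_nhdsWithin _ (Ioo_mem_nhds (by linarith : x - ε < x)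
        (by linarith : x < x + ε))) fun y hy => ⟨hy.2, hy.1.2⟩
    · have h1 := ae_eq_zero_on_Ioo ha hfin hνρ hI (fun n => (hF n).1) hF0 hg hg2 hFg
      rw [ae_restrict_iff' measurableSet_Ioo, ae_iff] at h1
      refine measure_mono_null (fun y hy => ?_) h1
      simpa [and_assoc] using hy
  have hn : ∀ᵐ x, x ∉ ({x | x ∉ singularSet a} ∩ {x | g x ≠ 0}) :=
    measure_eq_zero_iff_ae_notMem.1 hnull
  filter_upwards [hS, hn] with x h1 h2 h3
  by_contra h4
  exact h2 ⟨fun h5 => h3 (h1 h5), h4⟩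

end HamzaSufficient

/-! ### Closability implies Hamza's conditions -/

section HamzaNecessary

variable {ρ ν : Measure ℝ}

/-- The closure in `L²(ρ) × L²(ν)` of the graph of the derivative on `C¹` Lipschitz functions. -/
def lineGraph (ρ ν : Measure ℝ) : Submodule ℝ (Lp ℝ 2 ρ × Lp ℝ 2 ν) :=
  Submodule.topologicalClosure
  { carrier := {x | ∃ F : ℝ → ℝ, ContDiff ℝ 1 F ∧ (∃ K : ℝ≥0, LipschitzWith K F) ∧
      x.1 =ᵐ[ρ] F ∧ x.2 =ᵐ[ν] deriv F}
    add_mem' := by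
      rintro x y ⟨F, hF, ⟨K, hK⟩, hx, hx'⟩ ⟨H, hH, ⟨L, hL⟩, hy, hy'⟩
      refine ⟨F + H, hF.add hH, ⟨K + L, hK.add hL⟩, (Lp.coeFn_add _ _).trans (hx.add hy), ?_⟩
      filter_upwards [Lp.coeFn_add x.2 y.2, hx', hy'] with t h1 h2 h3
      rw [Prod.snd_add, h1, Pi.add_apply, h2, h3, deriv_add
        (hF.differentiable (by norm_num) t) (hH.differentiable (by norm_num) t)]
    zero_mem' := by
      refine ⟨fun _ => 0, contDiff_const, ⟨0, LipschitzWith.const 0⟩, Lp.coeFn_zero _ _ _, ?_⟩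
      filter_upwards [Lp.coeFn_zero ℝ 2 ν] with t h1
      rw [deriv_const]
      exact h1
    smul_mem' := by
      rintro c x ⟨F, hF, ⟨K, hK⟩, hx, hx'⟩
      refine ⟨c • F, hF.const_smul c, ⟨‖c‖₊ * K, ?_⟩,
        (Lp.coeFn_smul _ _).trans (hx.const_smul c), ?_⟩
      · refine LipschitzWith.of_dist_le_mul fun u v => ?_
        have := hK.dist_le_mul u v
        simp only [Pi.smul_apply, dist_smul₀, NNReal.coe_mul, coe_nnnorm, mul_assoc]
        gcongr
      · filter_upwards [Lp.coeFn_smul c x.2, hx'] with t h1 h2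
        rw [Prod.smul_snd, h1, Pi.smul_apply, h2, deriv_const_smul c
          (hF.differentiable (by norm_num) t)] }

theorem LineClosable.eq_zero (h : LineClosable ρ ν) {g : Lp ℝ 2 ν}
    (hg : ((0 : Lp ℝ 2 ρ), g) ∈ lineGraph ρ ν) : g = 0 := by
  rw [lineGraph, ← SetLike.mem_coe, Submodule.topologicalClosure_coe] at hg
  obtain ⟨u, hu, hlim⟩ := mem_closure_iff_seq_limit.1 hg
  choose F hF hL hF1 hF2 using hu
  refine (Lp.eq_zero_iff_ae_eq_zero).2 (h F (fun n => ⟨hF n, hL n⟩) ?_ g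
    (Lp.stronglyMeasurable g).measurable (Lp.memLp g) ?_)
  · refine (tendsto_Lp_of_memLp.1 ((continuous_fst.tendsto _).comp hlim)).congr fun n =>
      eLpNorm_congr_ae ?_
    filter_upwards [hF1 n, Lp.coeFn_zero ℝ 2 ρ] with t h1 h2
    rw [h2, Function.comp_apply, h1]
    simp
  · refine (tendsto_Lp_of_memLp.1 ((continuous_snd.tendsto _).comp hlim)).congr fun n =>
      eLpNorm_congr_ae ?_
    filter_upwards [hF2 n] with t h1
    rw [Function.comp_apply, h1]

/-- The pair of functions `(u, g)` belongs to the closed graph of the derivative. -/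
def InLineGraph (ρ ν : Measure ℝ) (u g : ℝ → ℝ) : Prop :=
  ∃ (hu : MemLp u 2 ρ) (hg : MemLp g 2 ν), (hu.toLp u, hg.toLp g) ∈ lineGraph ρ ν

theorem InLineGraph.of_tendsto {u g : ℝ → ℝ} (hu : MemLp u 2 ρ) (hg : MemLp g 2 ν)
    {U G : ℕ → ℝ → ℝ} (h : ∀ n, InLineGraph ρ ν (U n) (G n))
    (hU : Tendsto (fun n => eLpNorm (fun x => U n x - u x) 2 ρ) atTop (𝓝 0))
    (hG : Tendsto (fun n => eLpNorm (fun x => G n x - g x) 2 ν) atTop (𝓝 0)) :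
    InLineGraph ρ ν u g := by
  choose h1 h2 h3 using h
  refine ⟨hu, hg, ?_⟩
  refine IsClosed.mem_of_tendsto (f := fun n => ((h1 n).toLp (U n), (h2 n).toLp (G n)))
    (b := atTop) (Submodule.isClosed_topologicalClosure _) ?_ (Eventually.of_forall h3)
  refine (Prod.tendsto_iff _ _).2 ⟨(tendsto_toLp_iff h1).2 ?_, (tendsto_toLp_iff h2).2 ?_⟩
  · refine hU.congr fun n => eLpNorm_congr_ae ?_
    filter_upwards [hu.coeFn_toLp] with t ht
    simp only [ht]
  · refine hG.congr fun n => eLpNorm_congr_ae ?_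
    filter_upwards [hg.coeFn_toLp] with t ht
    simp only [ht]

/-- By linearity `(0, g)` lies in the closed graph. Both of Hamza's conditions are obtained from
this, by exhibiting a function with the derivatives `g` and `0`. -/
theorem InLineGraph.ae_eq_zero (h : LineClosable ρ ν) {u g : ℝ → ℝ}
    (hug : InLineGraph ρ ν u g) (hu0 : InLineGraph ρ ν u fun _ => 0) : g =ᵐ[ν] 0 := by
  obtain ⟨h1, h2, h3⟩ := hug
  obtain ⟨h4, h5, h6⟩ := hu0
  have h7 := Submodule.sub_mem _ h3 h6
  have h8 : h2.toLp g = 0 := by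
    refine h.eq_zero ?_
    have e : h5.toLp (fun _ => 0) = 0 := MemLp.toLp_zero h5
    rw [e] at h7
    simpa using h7
  have h9 := h2.coeFn_toLp
  rw [h8] at h9
  exact h9.symm.trans (Lp.coeFn_zero _ _ _)

variable [IsProbabilityMeasure ρ]

/-- Integrals of Heaviside functions over a bounded set of singular points stay in the kernel of
the closed derivative. -/
theorem inLineGraph_integral_heaviside {K : Set ℝ} (hKm : MeasurableSet K)
    (hK : volume K ≠ ∞) (hH : ∀ y ∈ K, InLineGraph ρ ν ((Ioi y).indicator fun _ => 1) fun _ => 0) :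
    InLineGraph ρ ν (fun x => ∫ y in K, (Ioi y).indicator (fun _ => (1 : ℝ)) x) fun _ => 0 := by
  have : IsFiniteMeasure (volume.restrict K) := ⟨by simpa using hK.lt_top⟩
  have hjm : Measurable (Function.uncurry fun (x y : ℝ) =>
      (Ioi y).indicator (fun _ => (1 : ℝ)) x) := by
    have : (Function.uncurry fun (x y : ℝ) => (Ioi y).indicator (fun _ => (1 : ℝ)) x) =
        {p : ℝ × ℝ | p.2 < p.1}.indicator fun _ => 1 := by
      ext ⟨x, y⟩
      simp [indicator_apply]
    rw [this]
    exact measurable_const.indicator (measurableSet_lt measurable_snd measurable_fst)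
  have hle : ∀ x y : ℝ, ‖(Ioi y).indicator (fun _ => (1 : ℝ)) x‖ ≤ 1 := fun x y => by
    by_cases h : x ∈ Ioi y
    · simp [indicator_of_mem h]
    · simp [indicator_of_notMem h]
  have hu : MemLp (fun x => ∫ y in K, (Ioi y).indicator (fun _ => (1 : ℝ)) x) 2 ρ := by
    refine MemLp.of_bound (hjm.stronglyMeasurable.integral_prod_right).aestronglyMeasurable
      (∫ y in K, (1 : ℝ)) (ae_of_all _ fun x => ?_)
    exact norm_integral_le_of_norm_le (integrable_const _) (ae_of_all _ fun y => hle x y)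
  have h0 : MemLp (fun _ : ℝ => (0 : ℝ)) 2 ν := MemLp.zero
  have e0 : h0.toLp (fun _ => 0) = 0 := MemLp.toLp_zero h0
  let 𝒦 : Submodule ℝ (Lp ℝ 2 ρ) := (lineGraph ρ ν).comap (LinearMap.inl ℝ _ _)
  have hcl : IsClosed (𝒦 : Set (Lp ℝ 2 ρ)) :=
    (Submodule.isClosed_topologicalClosure _).preimage
      (by fun_prop : Continuous fun u : Lp ℝ 2 ρ => (u, (0 : Lp ℝ 2 ν)))
  have : CompleteSpace 𝒦 := hcl.completeSpace_coe
  refine ⟨hu, h0, ?_⟩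
  rw [e0]
  change hu.toLp _ ∈ 𝒦
  -- The kernel `𝒦` is a closed subspace of a Hilbert space, so it suffices to test against `ξ ⊥ 𝒦`.
  -- By Fubini the pairing with the average is the average of the pairings with Heaviside functions,
  -- all zero. No `L²`-valued integral is needed.
  rw [← Submodule.orthogonal_orthogonal 𝒦, Submodule.mem_orthogonal]
  intro ξ hξ
  rw [Submodule.mem_orthogonal'] at hξ
  have hinner : ∀ {f : ℝ → ℝ} (hf : MemLp f 2 ρ), inner ℝ ξ (hf.toLp f) = ∫ x, f x * ξ x ∂ρ := by
    intro f hf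
    rw [L2.inner_def]
    refine integral_congr_ae ?_
    filter_upwards [hf.coeFn_toLp] with x hx
    rw [hx]; simp
  rw [hinner]
  have hξi : Integrable ξ ρ := (Lp.memLp ξ).integrable (by norm_num)
  have hswap := integral_integral_swap (μ := ρ) (ν := volume.restrict K)
    (f := fun x y => (Ioi y).indicator (fun _ => (1 : ℝ)) x * ξ x) (by
      have h1 : Integrable (fun p : ℝ × ℝ => ξ p.1) (ρ.prod (volume.restrict K)) :=
        hξi.comp_fst _
      exact h1.bdd_mul (c := 1) hjm.aestronglyMeasurable (ae_of_all _ fun p => hle p.1 p.2))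
  calc ∫ x, (∫ y in K, (Ioi y).indicator (fun _ => (1 : ℝ)) x) * ξ x ∂ρ
      = ∫ x, (∫ y in K, (Ioi y).indicator (fun _ => (1 : ℝ)) x * ξ x) ∂ρ := by
        simp only [integral_mul_const]
    _ = ∫ y in K, ∫ x, (Ioi y).indicator (fun _ => (1 : ℝ)) x * ξ x ∂ρ := hswap
    _ = ∫ y in K, 0 := by
        refine setIntegral_congr_fun hKm fun y hy => ?_
        obtain ⟨h1, h2, h3⟩ := hH y hy
        have h4 : h1.toLp _ ∈ 𝒦 := by
          rw [e0] at h3; exact h3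
        simp only [← hinner h1]
        exact hξ _ h4
    _ = 0 := by simp

variable [IsFiniteMeasure ν]

theorem isLocallyFiniteMeasure_add_volume (ν : Measure ℝ) [IsFiniteMeasure ν] :
    IsLocallyFiniteMeasure (ν + volume) := by
  refine ⟨fun x => ?_⟩
  obtain ⟨s, hs, h⟩ := (volume : Measure ℝ).finiteAt_nhds x
  refine ⟨s, hs, ?_⟩
  rw [Measure.add_apply]
  exact ENNReal.add_lt_top.2 ⟨measure_lt_top _ _, h⟩

theorem memLp_of_lipschitz_real (hρ2 : MemLp (fun x : ℝ => x) 2 ρ) {F : ℝ → ℝ} {K : ℝ≥0}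
    (hF : LipschitzWith K F) : MemLp F 2 ρ := by
  have h1 : MemLp (fun x => ‖F 0‖ + K * ‖x‖) 2 ρ :=
    (memLp_const ‖F 0‖).add (hρ2.norm.const_mul (K : ℝ))
  refine h1.of_le hF.continuous.aestronglyMeasurable (ae_of_all _ fun x => ?_)
  have h2 := hF.norm_sub_le x 0
  rw [sub_zero] at h2
  calc ‖F x‖ = ‖F 0 + (F x - F 0)‖ := by congr 1; ring
    _ ≤ ‖F 0‖ + K * ‖x‖ := (norm_add_le _ _).trans (by gcongr)
    _ ≤ _ := le_abs_self _

theorem inLineGraph_of_contDiff (hρ2 : MemLp (fun x : ℝ => x) 2 ρ) {F : ℝ → ℝ}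
    (hF : ContDiff ℝ 1 F) {K : ℝ≥0} (hK : LipschitzWith K F) : InLineGraph ρ ν F (deriv F) := by
  have h2 : MemLp (deriv F) 2 ν :=
    MemLp.of_bound (hF.continuous_deriv (by norm_num)).aestronglyMeasurable K
      (ae_of_all _ fun x => norm_deriv_le_of_lipschitz hK)
  have h1 := memLp_of_lipschitz_real hρ2 hK
  exact ⟨h1, h2, Submodule.le_topologicalClosure _
    ⟨F, hF, ⟨K, hK⟩, h1.coeFn_toLp, h2.coeFn_toLp⟩⟩

/-- Hölder on the interval between `b` and `x`. The square-root growth, in `L²(ρ)` by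
`memLp_sqrt_abs`, makes the primitive continuous from `L²(dx)` to `L²(ρ)`. -/
theorem enorm_intervalIntegral_le_sqrt {f : ℝ → ℝ} (hf : AEStronglyMeasurable f volume)
    (b x : ℝ) : ‖∫ t in b..x, f t‖ₑ ≤
      eLpNorm f 2 volume * ‖Real.sqrt |x - b|‖ₑ := by
  have h1 : ‖∫ t in b..x, f t‖ₑ = ‖∫ t in Set.uIoc b x, f t‖ₑ := by
    rw [← enorm_norm, intervalIntegral.norm_intervalIntegral_eq, enorm_norm]
  rw [h1]
  refine (enorm_integral_le_lintegral_enorm _).trans ?_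
  rw [← eLpNorm_one_eq_lintegral_enorm]
  refine (eLpNorm_le_eLpNorm_mul_rpow_measure_univ (q := 2) (by norm_num) hf.restrict).trans ?_
  gcongr
  · exact Measure.restrict_le_self
  · rw [Measure.restrict_apply_univ, Set.uIoc, Real.volume_Ioc, max_sub_min_eq_abs,
      Real.sqrt_eq_rpow, Real.enorm_eq_ofReal (by positivity),
      ← ENNReal.ofReal_rpow_of_nonneg (abs_nonneg _) (by norm_num)]
    norm_num

theorem memLp_sqrt_abs (hρ2 : MemLp (fun x : ℝ => x) 2 ρ) (b : ℝ) :
    MemLp (fun x => Real.sqrt |x - b|) 2 ρ := by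
  have h1 : MemLp (fun x => 1 + ‖x - b‖) 2 ρ :=
    (memLp_const (1 : ℝ)).add (hρ2.sub (memLp_const b)).norm
  refine h1.of_le (by fun_prop) (ae_of_all _ fun x => ?_)
  rw [Real.norm_of_nonneg (Real.sqrt_nonneg _)]
  refine le_trans ?_ (le_abs_self _)
  rw [Real.sqrt_le_left (by positivity), Real.norm_eq_abs]
  nlinarith [abs_nonneg (x - b)]

/-- Primitives of square integrable functions belong to the closed graph. -/
theorem inLineGraph_primitive (hρ2 : MemLp (fun x : ℝ => x) 2 ρ) {g : ℝ → ℝ}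
    (hg : MemLp g 2 (ν + volume)) (b : ℝ) :
    InLineGraph ρ ν (fun x => ∫ t in b..x, g t) g := by
  have hgν : MemLp g 2 ν := hg.mono_measure (Measure.le_add_right le_rfl)
  have hgv : MemLp g 2 volume := hg.mono_measure (Measure.le_add_left le_rfl)
  have hloc : ∀ {f : ℝ → ℝ}, MemLp f 2 volume → ∀ x y, IntervalIntegrable f volume x y :=
    fun hf x y => ((hf.locallyIntegrable (by norm_num)).integrableOn_isCompact
      isCompact_uIcc).intervalIntegrable
  have hs := memLp_sqrt_abs hρ2 b
  have hle : ∀ f : ℝ → ℝ, AEStronglyMeasurable f volume →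
      eLpNorm (fun x => ∫ t in b..x, f t) 2 ρ ≤
        eLpNorm f 2 volume * eLpNorm (fun x => Real.sqrt |x - b|) 2 ρ := by
    intro f hf
    rw [eLpNorm_two_eq, eLpNorm_two_eq (fun x => Real.sqrt |x - b|)]
    calc (∫⁻ x, ‖∫ t in b..x, f t‖ₑ ^ 2 ∂ρ) ^ (1 / 2 : ℝ)
        ≤ (∫⁻ x, eLpNorm f 2 volume ^ 2 * ‖Real.sqrt |x - b|‖ₑ ^ 2 ∂ρ) ^ (1 / 2 : ℝ) := by
          gcongr with x
          rw [← mul_pow]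
          gcongr
          exact enorm_intervalIntegral_le_sqrt hf b x
      _ = _ := by
          rw [lintegral_const_mul _ (by fun_prop), ENNReal.mul_rpow_of_nonneg _ _ (by norm_num),
            ← ENNReal.rpow_natCast, ← ENNReal.rpow_mul]
          norm_num
  have hprim : MemLp (fun x => ∫ t in b..x, g t) 2 ρ := by
    refine ⟨(intervalIntegral.continuous_primitive (hloc hgv) b).aestronglyMeasurable, ?_⟩
    exact (hle g hgv.1).trans_lt (ENNReal.mul_lt_top hgv.eLpNorm_lt_top hs.eLpNorm_lt_top)
  have := isLocallyFiniteMeasure_add_volume ν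
  -- Approximation in `L²(ν + volume)` controls two things at once: the Lebesgue part makes the
  -- primitives converge in `L²(ρ)`, the `ν` part makes the derivatives converge in `L²(ν)`.
  choose c hcs hc hcc hcm using fun n : ℕ =>
    hg.exists_hasCompactSupport_eLpNorm_sub_le (by norm_num)
      (ε := ((n : ℝ≥0∞) + 1)⁻¹) (by simp)
  have hε : Tendsto (fun n : ℕ => ((n : ℝ≥0∞) + 1)⁻¹) atTop (𝓝 0) := by
    have := (tendsto_add_atTop_iff_nat 1).2 ENNReal.tendsto_inv_nat_nhds_zero
    simpa using this
  have hcd : ∀ n x, HasDerivAt (fun x => ∫ t in b..x, c n t) (c n x) x := fun n x =>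
    intervalIntegral.integral_hasDerivAt_right ((hcc n).intervalIntegrable _ _)
      ((hcc n).stronglyMeasurableAtFilter _ _) (hcc n).continuousAt
  have hder : ∀ n, deriv (fun x => ∫ t in b..x, c n t) = c n := fun n =>
    funext fun x => (hcd n x).deriv
  refine InLineGraph.of_tendsto hprim hgν
    (U := fun n x => ∫ t in b..x, c n t) (G := c) (fun n => ?_) ?_ ?_
  -- A primitive of a continuous compactly supported function is `C¹` with bounded derivative, hence
  -- Lipschitz.
  · obtain ⟨C, hC⟩ := (hcs n).exists_bound_of_continuous (hcc n)
    have h1 : LipschitzWith C.toNNReal (fun x => ∫ t in b..x, c n t) := by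
      refine lipschitzWith_of_nnnorm_deriv_le (fun x => (hcd n x).differentiableAt) fun x => ?_
      rw [hder, ← NNReal.coe_le_coe, coe_nnnorm]
      exact (hC x).trans (Real.le_coe_toNNReal C)
    have h2 : ContDiff ℝ 1 (fun x => ∫ t in b..x, c n t) := by
      rw [contDiff_one_iff_deriv, hder]
      exact ⟨fun x => (hcd n x).differentiableAt, hcc n⟩
    have h3 := inLineGraph_of_contDiff (ν := ν) hρ2 h2 h1
    rwa [hder] at h3
  · have h1 := ENNReal.Tendsto.mul_const hε (Or.inr hs.eLpNorm_ne_top)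
    rw [zero_mul] at h1
    refine tendsto_of_tendsto_of_tendsto_of_le_of_le tendsto_const_nhds h1 (fun _ => zero_le)
      fun n => ?_
    have hcv : MemLp (c n) 2 volume := (hcm n).mono_measure (Measure.le_add_left le_rfl)
    have e : (fun x => (∫ t in b..x, c n t) - ∫ t in b..x, g t) =
        fun x => ∫ t in b..x, (c n - g) t := by
      ext x
      rw [← intervalIntegral.integral_sub (hloc hcv b x) (hloc hgv b x)]
      rfl
    simp only [e]
    refine (hle _ (hcv.1.sub hgv.1)).trans ?_
    gcongr
    refine le_trans ?_ (hc n)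
    rw [eLpNorm_sub_comm]
    exact eLpNorm_mono_measure _ (Measure.le_add_left le_rfl)
  · refine tendsto_of_tendsto_of_tendsto_of_le_of_le tendsto_const_nhds hε (fun _ => zero_le)
      fun n => ?_
    refine le_trans ?_ (hc n)
    have e : (fun x => c n x - g x) = c n - g := rfl
    rw [e, eLpNorm_sub_comm]
    exact eLpNorm_mono_measure _ (Measure.le_add_right le_rfl)

/-- The indicator of a Lebesgue null set `N` has zero primitive, so it is a derivative of `0` in the
closed graph and must vanish `ν`-a.e. -/
theorem LineClosable.absolutelyContinuous (h : LineClosable ρ ν)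
    (hρ2 : MemLp (fun x : ℝ => x) 2 ρ) : ν ≪ volume := by
  refine Measure.AbsolutelyContinuous.mk fun N hN hN0 => ?_
  have hg : MemLp (N.indicator fun _ => (1 : ℝ)) 2 (ν + volume) :=
    memLp_indicator_const 2 hN 1 (Or.inr (by simp [hN0]))
  have h1 := inLineGraph_primitive hρ2 hg 0
  have h2 : (fun x => ∫ t in (0 : ℝ)..x, N.indicator (fun _ => (1 : ℝ)) t) = fun _ => 0 := by
    ext x
    refine intervalIntegral.integral_zero_ae ?_
    filter_upwards [measure_eq_zero_iff_ae_notMem.1 hN0] with t ht _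
    simp [ht]
  rw [h2] at h1
  have h3 : InLineGraph ρ ν (fun _ => 0) fun _ => 0 := by
    have := inLineGraph_of_contDiff (ν := ν) hρ2 (contDiff_const (c := (0 : ℝ)))
      (LipschitzWith.const 0)
    simpa using this
  have h4 := h1.ae_eq_zero h h3
  refine measure_eq_zero_iff_ae_notMem.2 ?_
  filter_upwards [h4] with t ht htN
  simp [htN] at ht

/-- An interval around `x` on which `1/a` is integrable contains one of half the radius around each
nearby `y`. This serves for measurability of the set. -/
theorem isClosed_singularSet (a : ℝ → ℝ≥0∞) : IsClosed (singularSet a) := by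
  rw [← isOpen_compl_iff, Metric.isOpen_iff]
  intro x hx
  have hx1 : ¬ ∀ ε > 0, ∫⁻ y in Ioo (x - ε) (x + ε), (a y)⁻¹ = ∞ := hx
  push Not at hx1
  obtain ⟨ε, hε, h⟩ := hx1
  refine ⟨ε / 2, half_pos hε, fun y hy hyS => h ?_⟩
  rw [Real.ball_eq_Ioo] at hy
  refine top_le_iff.1 ((hyS (ε / 2) (half_pos hε)).symm.le.trans ?_)
  exact lintegral_mono_set (Ioo_subset_Ioo (by linarith [hy.1]) (by linarith [hy.2]))

/-- Near a point of the singular set of `a` there are bumps of mass one and of arbitrarily small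
energy `∫ h² a`. -/
theorem exists_bump_of_mem_singularSet {a : ℝ → ℝ≥0∞} (ha : Measurable a) {y : ℝ}
    (hy : y ∈ singularSet a) {ε : ℝ} (hε : 0 < ε) (N : ℕ) :
    ∃ h : ℝ → ℝ, Measurable h ∧ (∃ C, ∀ x, ‖h x‖ ≤ C) ∧ (∀ x, 0 ≤ h x) ∧
      (∀ x ∉ Ioo (y - ε) (y + ε), h x = 0) ∧ ∫ x, h x = 1 ∧
      ∫⁻ x, ‖h x‖ₑ ^ 2 ∂(volume.withDensity a) ≤ (N : ℝ≥0∞)⁻¹ := by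
  set I := Ioo (y - ε) (y + ε) with hI
  -- The truncations `min (1/a) M` have integrals over `I` increasing to infinity, so some `M` gives
  -- a finite integral `c > N`. The bump is this truncation divided by `c`.
  have hsup : ⨆ M : ℕ, ∫⁻ x in I, min (a x)⁻¹ (M : ℝ≥0∞) = ∞ := by
    rw [← lintegral_iSup (f := fun (M : ℕ) x => min (a x)⁻¹ (M : ℝ≥0∞)) (fun M => ha.inv.min measurable_const)
      (fun M M' hM x => min_le_min le_rfl (by exact_mod_cast hM)), ← hy ε hε]
    refine lintegral_congr fun x => ?_
    rw [← inf_iSup_eq, ENNReal.iSup_natCast, inf_top_eq]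
  obtain ⟨M, hM⟩ := lt_iSup_iff.1 (hsup.symm ▸ ENNReal.natCast_lt_top N)
  set m : ℝ → ℝ≥0∞ := fun x => min (a x)⁻¹ (M : ℝ≥0∞) with hm
  have hmm : Measurable m := ha.inv.min measurable_const
  have hmM : ∀ x, m x ≤ M := fun x => min_le_right _ _
  have hmt : ∀ x, m x ≠ ∞ := fun x => ((hmM x).trans_lt (ENNReal.natCast_lt_top M)).ne
  set c := ∫⁻ x in I, m x with hc
  have hct : c ≠ ∞ := by
    refine ((setLIntegral_mono measurable_const fun x _ => hmM x).trans_lt ?_).ne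
    rw [setLIntegral_const, Real.volume_Ioo]
    exact ENNReal.mul_lt_top (ENNReal.natCast_lt_top M) ENNReal.ofReal_lt_top
  have hNc : (N : ℝ≥0∞) ≤ c := hM.le
  have hc0 : c ≠ 0 := fun h0 => by
    rw [h0] at hM; exact absurd hM not_lt_zero
  set k : ℝ → ℝ≥0∞ := I.indicator fun x => m x * c⁻¹ with hk
  have hkm : Measurable k := (hmm.mul_const _).indicator measurableSet_Ioo
  have hkt : ∀ x, k x ≤ M * c⁻¹ := fun x => by
    refine (indicator_le_self _ _ x).trans ?_
    gcongr
    exact hmM x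
  have hMt : (M : ℝ≥0∞) * c⁻¹ ≠ ∞ :=
    ENNReal.mul_ne_top (ENNReal.natCast_ne_top M) (ENNReal.inv_ne_top.2 hc0)
  have hke : ∀ x, k x ≠ ∞ := fun x => ((hkt x).trans_lt hMt.lt_top).ne
  refine ⟨fun x => (k x).toReal, hkm.ennreal_toReal, ⟨(M * c⁻¹).toReal, fun x => ?_⟩,
    fun x => ENNReal.toReal_nonneg, fun x hx => ?_, ?_, ?_⟩
  · rw [Real.norm_of_nonneg ENNReal.toReal_nonneg]
    exact ENNReal.toReal_mono hMt (hkt x)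
  · simp only [hk, indicator_of_notMem hx, ENNReal.toReal_zero]
  · rw [integral_toReal hkm.aemeasurable (ae_of_all _ fun x => (hke x).lt_top),
      lintegral_indicator measurableSet_Ioo, lintegral_mul_const _ hmm, ← hc,
      ENNReal.mul_inv_cancel hc0 hct, ENNReal.toReal_one]
  · have h1 : ∀ x, ‖(k x).toReal‖ₑ = k x := fun x => by
      rw [Real.enorm_eq_ofReal ENNReal.toReal_nonneg, ENNReal.ofReal_toReal (hke x)]
    simp only [h1]
    rw [lintegral_withDensity_eq_lintegral_mul _ ha (hkm.pow_const 2)]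
    calc ∫⁻ x, (a * fun x => k x ^ 2) x
        ≤ ∫⁻ x, I.indicator (fun x => m x * (c⁻¹ * c⁻¹)) x := by
          refine lintegral_mono fun x => ?_
          by_cases hx : x ∈ I
          · simp only [hk, Pi.mul_apply, indicator_of_mem hx]
            -- Since `a m ≤ 1`, including where `a` is `0` or `∞`, the energy is at most `c⁻² ∫ m =
            -- 1/c ≤ 1/N`.
            have h2 : a x * m x ≤ 1 :=
              (mul_le_mul_right (min_le_left _ _) _).trans (ENNReal.mul_inv_le_one _)
            calc a x * (m x * c⁻¹) ^ 2 = (a x * m x) * (m x * (c⁻¹ * c⁻¹)) := by ring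
              _ ≤ 1 * (m x * (c⁻¹ * c⁻¹)) := by gcongr
              _ = _ := one_mul _
          · simp [hk, indicator_of_notMem hx]
      _ = c⁻¹ := by
          rw [lintegral_indicator measurableSet_Ioo, lintegral_mul_const _ hmm, ← hc,
            ← mul_assoc, ENNReal.mul_inv_cancel hc0 hct, one_mul]
      _ ≤ _ := ENNReal.inv_le_inv.2 hNc

theorem memLp_of_bound_of_support {μ : Measure ℝ} [IsLocallyFiniteMeasure μ] {h : ℝ → ℝ}
    (hm : Measurable h) {C : ℝ} (hC : ∀ x, ‖h x‖ ≤ C) {p q : ℝ}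
    (hs : ∀ x ∉ Ioo p q, h x = 0) : MemLp h 2 μ := by
  have h1 : MemLp ((Ioo p q).indicator fun _ => C) 2 μ :=
    memLp_indicator_const 2 measurableSet_Ioo C (Or.inr measure_Ioo_lt_top.ne)
  refine h1.of_le hm.aestronglyMeasurable (ae_of_all _ fun x => ?_)
  by_cases hx : x ∈ Ioo p q
  · rw [indicator_of_mem hx]
    exact (hC x).trans (le_abs_self _)
  · rw [hs x hx]; simp

/-- The Heaviside function at a singular point belongs to the kernel of the closed derivative. -/
theorem inLineGraph_heaviside {a : ℝ → ℝ≥0∞} (ha : Measurable a) (hν : volume.withDensity a = ν)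
    (hρ2 : MemLp (fun x : ℝ => x) 2 ρ) (hρv : ρ ≪ volume) {y : ℝ} (hy : y ∈ singularSet a) :
    InLineGraph ρ ν ((Ioi y).indicator fun _ => 1) fun _ => 0 := by
  have hε : ∀ n : ℕ, (0 : ℝ) < 1 / ((n : ℝ) + 1) := fun n => by positivity
  choose h hm hC h0 hs h1 hsm using fun n : ℕ =>
    exists_bump_of_mem_singularSet ha hy (hε n) (n + 1)
  choose C hC using hC
  -- A non-integrable function would have Bochner integral `0`, not `1`.
  have hint : ∀ n, Integrable (h n) := fun n => by
    by_contra hn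
    have := h1 n
    rw [integral_undef hn] at this
    exact zero_ne_one this
  have hε1 : ∀ n : ℕ, 1 / ((n : ℝ) + 1) ≤ 1 := fun n => by
    rw [div_le_one (by positivity)]; linarith [n.cast_nonneg (α := ℝ)]
  have := isLocallyFiniteMeasure_add_volume ν
  -- The radii `1/(n+1)` are at most `1`, so the base point `y - 1` is to the left of every bump.
  have hU : ∀ n, InLineGraph ρ ν (fun x => ∫ t in (y - 1)..x, h n t) (h n) := fun n =>
    inLineGraph_primitive hρ2 (memLp_of_bound_of_support (hm n) (hC n) (hs n)) _
  have hbound : ∀ n x, ‖∫ t in (y - 1)..x, h n t‖ ≤ 1 := fun n x => by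
    rw [intervalIntegral.norm_intervalIntegral_eq, ← h1 n, Real.norm_of_nonneg
      (integral_nonneg (h0 n))]
    exact setIntegral_le_integral (hint n) (ae_of_all _ (h0 n))
  have hone : Tendsto (fun _ : ℕ => Lp.const 2 ρ (1 : ℝ)) atTop (𝓝 (Lp.const 2 ρ (1 : ℝ))) :=
    tendsto_const_nhds
  have hinv : Tendsto (fun n : ℕ => 1 / ((n : ℝ) + 1)) atTop (𝓝 0) :=
    tendsto_one_div_add_atTop_nhds_zero_nat
  have hae : ∀ᵐ x ∂ρ, Tendsto (fun n => ∫ t in (y - 1)..x, h n t) atTop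
      (𝓝 ((Ioi y).indicator (fun _ => (1 : ℝ)) x)) := by
    -- At `y` itself the primitives need not converge, but `ρ` has no atom.
    have hne : ∀ᵐ x ∂ρ, x ≠ y := hρv.ae_le (compl_mem_ae_iff.2 (measure_singleton y))
    filter_upwards [hne] with x hx
    refine tendsto_const_nhds.congr' ?_
    rcases lt_or_gt_of_ne hx with hxy | hxy
    · filter_upwards [hinv.eventually (gt_mem_nhds (sub_pos.2 hxy))] with n hn
      rw [indicator_of_notMem (by simpa using hxy.le)]
      symm
      refine intervalIntegral.integral_zero_ae (ae_of_all _ fun t ht => hs n t fun ht' => ?_)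
      have h2 := hε1 n
      rcases mem_uIoc.1 ht with h3 | h3
      · linarith [ht'.1]
      · linarith [ht'.1]
    · filter_upwards [hinv.eventually (gt_mem_nhds (sub_pos.2 hxy))] with n hn
      rw [indicator_of_mem (mem_Ioi.2 hxy), intervalIntegral.integral_of_le (by linarith)]
      refine (h1 n).symm.trans (Eq.symm ?_)
      refine setIntegral_eq_integral_of_forall_compl_eq_zero fun t ht => hs n t fun ht' => ht ?_
      exact ⟨by linarith [hε1 n, ht'.1], by linarith [ht'.2]⟩
  have hUm : ∀ n, AEStronglyMeasurable (fun x => ∫ t in (y - 1)..x, h n t) ρ := fun n =>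
    (intervalIntegral.continuous_primitive (fun _ _ => (hint n).intervalIntegrable)
      _).aestronglyMeasurable
  have hi : Measurable ((Ioi y).indicator fun _ => (1 : ℝ)) :=
    measurable_const.indicator measurableSet_Ioi
  refine InLineGraph.of_tendsto (memLp_indicator_const 2 measurableSet_Ioi 1
    (Or.inr (measure_ne_top _ _))) MemLp.zero hU ?_ ?_
  -- Bounded a.e. convergence in `L²(ρ)`, read off from the product lemma with the constant sequence
  -- `1` as `L²` factor.
  · refine (tendsto_eLpNorm_mul_sub hUm hi.aestronglyMeasurable hbound hae hone).congr fun n =>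
      eLpNorm_congr_ae ?_
    filter_upwards [Lp.coeFn_const 2 ρ (1 : ℝ)] with x hx
    rw [hx, Function.const_apply, mul_one, mul_one]
  · have h2 : Tendsto (fun n : ℕ => (((n + 1 : ℕ) : ℝ≥0∞)⁻¹) ^ (1 / 2 : ℝ)) atTop (𝓝 0) := by
      have h3 := ((ENNReal.continuous_rpow_const (y := 1 / 2)).tendsto (0 : ℝ≥0∞)).comp
        ((tendsto_add_atTop_iff_nat 1).2 ENNReal.tendsto_inv_nat_nhds_zero)
      rwa [ENNReal.zero_rpow_of_pos (by norm_num)] at h3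
    refine tendsto_of_tendsto_of_tendsto_of_le_of_le tendsto_const_nhds h2 (fun _ => zero_le)
      fun n => ?_
    simp only [sub_zero, eLpNorm_two_eq, ← hν]
    exact ENNReal.rpow_le_rpow (hsm n) (by norm_num)

/-- A bounded piece `K` of the singular set where `a ≠ 0` yields one function with two derivatives:
its cumulative length has derivative the indicator of `K` as a primitive, and `0` as an average of
Heaviside functions. -/
theorem LineClosable.hamzaConditions (h : LineClosable ρ ν)
    (hρ2 : MemLp (fun x : ℝ => x) 2 ρ) (hρν : ρ ≪ ν) : HamzaConditions ν := by
  have hac := h.absolutelyContinuous hρ2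
  refine ⟨hac, ?_⟩
  have hν : volume.withDensity (ν.rnDeriv volume) = ν := Measure.withDensity_rnDeriv_eq _ _ hac
  have ha := Measure.measurable_rnDeriv ν volume
  set a := ν.rnDeriv volume with ha_def
  clear_value a
  have hset : ∀ R : ℕ, volume (singularSet a ∩ {x | a x ≠ 0} ∩ Ioo (-(R : ℝ)) R) = 0 := by
    intro R
    set K := singularSet a ∩ {x | a x ≠ 0} ∩ Ioo (-(R : ℝ)) R with hK
    have hKm : MeasurableSet K := ((isClosed_singularSet a).measurableSet.inter
      (ha (measurableSet_singleton 0).compl)).inter measurableSet_Ioo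
    have hKt : volume K ≠ ∞ :=
      ((measure_mono inter_subset_right).trans_lt measure_Ioo_lt_top).ne
    have h1 := inLineGraph_integral_heaviside (ρ := ρ) (ν := ν) hKm hKt fun y hy =>
      inLineGraph_heaviside ha hν hρ2 (hρν.trans hac) hy.1.1
    have hg : MemLp (K.indicator fun _ => (1 : ℝ)) 2 (ν + volume) :=
      memLp_indicator_const 2 hKm 1 (Or.inr (by
        rw [Measure.add_apply]; exact ENNReal.add_ne_top.2 ⟨measure_ne_top _ _, hKt⟩))
    have h2 := inLineGraph_primitive hρ2 hg (-R)
    -- Both sides are the Lebesgue measure of `K ∩ (-∞, x)`, since `K` lies to the right of `-R`.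
    have e : (fun x => ∫ t in (-(R : ℝ))..x, K.indicator (fun _ => (1 : ℝ)) t) =
        fun x => ∫ y in K, (Ioi y).indicator (fun _ => (1 : ℝ)) x := by
      ext x
      have e1 : ∀ y, (Ioi y).indicator (fun _ => (1 : ℝ)) x =
          (Iio x).indicator (fun _ => (1 : ℝ)) y := fun y => by simp [indicator_apply]
      simp only [e1]
      rw [setIntegral_indicator measurableSet_Iio, ← integral_indicator (hKm.inter
        measurableSet_Iio)]
      rcases le_or_gt (-(R : ℝ)) x with hx | hx
      · rw [intervalIntegral.integral_of_le hx, integral_Ioc_eq_integral_Ioo,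
          ← integral_indicator measurableSet_Ioo]
        congr 1
        ext t
        by_cases ht : t ∈ K
        · by_cases hxt : t < x <;> simp [ht, ht.2.1, hxt]
        · simp [indicator_apply, ht]
      · rw [intervalIntegral.integral_zero_ae, eq_comm]
        · have : K ∩ Iio x = ∅ := by
            ext t
            simp only [mem_inter_iff, mem_Iio, mem_empty_iff_false, iff_false, not_and, not_lt]
            intro ht
            exact (hx.trans ht.2.1).le
          simp [this]
        · refine ae_of_all _ fun t ht => indicator_of_notMem (fun htK => ?_) _
          rcases mem_uIoc.1 ht with h3 | h3
          · linarith
          · linarith [htK.2.1]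
    rw [e] at h2
    have h3 := h2.ae_eq_zero h h1
    -- Nullity for `ν` passes to Lebesgue measure because `a ≠ 0` on `K`.
    have h4 : ∀ᵐ x ∂(volume.withDensity a), x ∉ K := by
      rw [hν]
      filter_upwards [h3] with t ht htK
      simp [htK] at ht
    rw [measure_eq_zero_iff_ae_notMem]
    filter_upwards [(ae_withDensity_iff ha).1 h4] with x hx hxK
    exact hx hxK.1.2 hxK
  have hall : ∀ᵐ x, ∀ R : ℕ, x ∉ singularSet a ∩ {x | a x ≠ 0} ∩ Ioo (-(R : ℝ)) R :=
    ae_all_iff.2 fun R => measure_eq_zero_iff_ae_notMem.1 (hset R)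
  filter_upwards [hall] with x hx hxS
  by_contra hx0
  obtain ⟨R, hR⟩ := exists_nat_gt |x|
  exact hx R ⟨⟨hxS, hx0⟩, abs_lt.1 hR⟩

end HamzaNecessary

/-! ### Fisher information: positivity, continuity, dependence on the laws only -/

section Fisher

variable {E : Type*} [MeasurableSpace E] {d : ℕ} {Θ Θ' : Set (EuclideanSpace ℝ (Fin d))}

theorem RegularModel.memLp_φ_apply (M : RegularModel E Θ) {θ} (hθ : θ ∈ Θ) (i : Fin d) :
    MemLp (fun x => M.φ x θ i) 2 M.μ :=
  (EuclideanSpace.proj (𝕜 := ℝ) i : EuclideanSpace ℝ (Fin d) →L[ℝ] ℝ).comp_memLp' (M.memLp_φ θ hθ)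

theorem RegularModel.fisher_apply (M : RegularModel E Θ) (θ) (i j : Fin d) :
    M.fisher θ i j = 4 * ∫ x, M.φ x θ i * M.φ x θ j ∂M.μ := rfl

theorem RegularModel.isSymm_fisher (M : RegularModel E Θ) (θ) : (M.fisher θ).IsSymm := by
  ext i j
  simp only [Matrix.transpose_apply, M.fisher_apply, mul_comm]

/-- The quadratic form at `v` is `4 ∫ (v · φ)² dμ`. -/
theorem RegularModel.posSemidef_fisher (M : RegularModel E Θ) {θ} (hθ : θ ∈ Θ) :
    (M.fisher θ).PosSemidef := by
  refine Matrix.PosSemidef.of_dotProduct_mulVec_nonneg ?_ fun v => ?_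
  · rw [Matrix.IsHermitian, Matrix.conjTranspose_eq_transpose_of_trivial]
    exact M.isSymm_fisher θ
  · have hi : ∀ i j, Integrable (fun x => v i * (M.φ x θ i * M.φ x θ j * v j)) M.μ := fun i j =>
      ((((M.memLp_φ_apply hθ i).integrable_mul (M.memLp_φ_apply hθ j)).mul_const _).const_mul _)
    have e : star v ⬝ᵥ (M.fisher θ *ᵥ v) = 4 * ∫ x, (∑ i, v i * M.φ x θ i) ^ 2 ∂M.μ := by
      have e1 : ∀ x, (∑ i, v i * M.φ x θ i) ^ 2 =
          ∑ i, ∑ j, v i * (M.φ x θ i * M.φ x θ j * v j) := fun x => by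
        rw [pow_two, Finset.sum_mul_sum]
        exact Finset.sum_congr rfl fun i _ => Finset.sum_congr rfl fun j _ => by ring
      simp only [e1]
      rw [integral_finsetSum _ fun i _ => integrable_finsetSum _ fun j _ => hi i j, Finset.mul_sum]
      simp only [dotProduct, Matrix.mulVec, M.fisher_apply, star_trivial]
      refine Finset.sum_congr rfl fun i _ => ?_
      rw [integral_finsetSum _ fun j _ => hi i j, Finset.mul_sum, Finset.mul_sum]
      refine Finset.sum_congr rfl fun j _ => ?_
      rw [integral_const_mul, integral_mul_const]
      ring
    rw [e]
    positivity

/-- The entries are four times the inner products of the curves `θ ↦ φ_k(·, θ)`, which are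
continuous into `L²(μ)`. -/
theorem RegularModel.continuousOn_fisher (M : RegularModel E Θ) (i j : Fin d) :
    ContinuousOn (fun θ => M.fisher θ i j) Θ := by
  have hU : ∀ k, Continuous fun θ : Θ => (M.memLp_φ_apply θ.2 k).toLp _ := by
    intro k
    rw [continuous_iff_continuousAt]
    intro θ
    rw [ContinuousAt, tendsto_iff_norm_sub_tendsto_zero]
    have h1 : Tendsto (fun η : Θ => ∫ x, ‖M.φ x η - M.φ x θ‖ ^ 2 ∂M.μ) (𝓝 θ) (𝓝 0) := by
      have := M.continuous_φ θ θ.2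
      rw [nhdsWithin_eq_map_subtype_coe θ.2] at this
      exact this
    have h2 := (Real.continuous_sqrt.tendsto 0).comp h1
    rw [Real.sqrt_zero] at h2
    refine squeeze_zero (fun _ => norm_nonneg _) (fun η => Real.le_sqrt_of_sq_le ?_) h2
    rw [← MemLp.toLp_sub, norm_sq_eq_integral]
    have hd : MemLp (fun x => M.φ x η - M.φ x θ) 2 M.μ :=
      (M.memLp_φ η η.2).sub (M.memLp_φ θ θ.2)
    refine integral_mono_ae (integrable_sq_coeFn _) hd.norm.integrable_sq ?_
    filter_upwards [((M.memLp_φ_apply η.2 k).sub (M.memLp_φ_apply θ.2 k)).coeFn_toLp] with x hx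
    rw [hx, ← sq_abs]
    simp only [Pi.sub_apply]
    have h3 := PiLp.norm_apply_le (M.φ x η - M.φ x θ) k
    rw [Real.norm_eq_abs] at h3
    gcongr
    simpa using h3
  rw [continuousOn_iff_continuous_domRestrict]
  have h4 : Θ.domRestrict (fun θ => M.fisher θ i j) = fun θ : Θ =>
      4 * inner ℝ ((M.memLp_φ_apply θ.2 i).toLp _) ((M.memLp_φ_apply θ.2 j).toLp _) := by
    ext θ
    rw [domRestrict_apply, M.fisher_apply, L2.inner_def]
    congr 1
    refine integral_congr_ae ?_
    filter_upwards [(M.memLp_φ_apply θ.2 i).coeFn_toLp, (M.memLp_φ_apply θ.2 j).coeFn_toLp]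
      with x h1 h2
    rw [h1, h2]
    simp [mul_comm]
  rw [h4]
  exact continuous_const.mul ((hU i).inner (hU j))

theorem RegularModel.memLp_sqrt (M : RegularModel E Θ) {θ} (hθ : θ ∈ Θ) :
    MemLp (fun x => Real.sqrt (M.f x θ)) 2 M.μ := by
  have hm := M.measurable_f θ hθ
  rw [memLp_two_iff_integrable_sq hm.sqrt.aestronglyMeasurable]
  have h1 : Integrable (fun x => M.f x θ) M.μ := by
    refine ⟨hm.aestronglyMeasurable, ?_⟩
    have h2 := (M.isProbabilityMeasure θ hθ).measure_univ
    rw [M.P_eq θ hθ, withDensity_apply _ MeasurableSet.univ, Measure.restrict_univ] at h2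
    have h3 : ∫⁻ x, ‖M.f x θ‖ₑ ∂M.μ = 1 := by
      rw [← h2]
      refine lintegral_congr_ae ?_
      filter_upwards [M.f_pos θ hθ] with x hx
      rw [Real.enorm_eq_ofReal hx.le]
    exact lt_of_eq_of_lt h3 ENNReal.one_lt_top
  refine h1.congr ?_
  filter_upwards [M.f_pos θ hθ] with x hx
  rw [Real.sq_sqrt hx.le]

theorem RegularModel.absolutelyContinuous (M : RegularModel E Θ) {θ} (hθ : θ ∈ Θ) :
    M.μ ≪ M.P θ := by
  rw [M.P_eq θ hθ]
  refine withDensity_absolutelyContinuous' (M.measurable_f θ hθ).ennreal_ofReal ?_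
  filter_upwards [M.f_pos θ hθ] with x hx
  simpa using hx

theorem RegularModel.P_absolutelyContinuous (M : RegularModel E Θ) {θ} (hθ : θ ∈ Θ) :
    M.P θ ≪ M.μ := by
  rw [M.P_eq θ hθ]
  exact withDensity_absolutelyContinuous _ _

/-- A quadratic form that is `o(‖h‖²)` vanishes. -/
theorem eq_zero_of_isLittleO_sq {V : Type*} [NormedAddCommGroup V] [NormedSpace ℝ V] {Q : V → ℝ}
    (hQ : ∀ (t : ℝ) v, Q (t • v) = t ^ 2 * Q v) (h : Q =o[𝓝 0] fun v => ‖v‖ ^ 2) (v : V) :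
    Q v = 0 := by
  have h1 : Tendsto (fun t : ℝ => t • v) (𝓝[≠] 0) (𝓝 0) := by
    have : Tendsto (fun t : ℝ => t • v) (𝓝 0) (𝓝 ((0 : ℝ) • v)) :=
      (continuous_id.smul continuous_const).tendsto 0
    rw [zero_smul] at this
    exact this.mono_left nhdsWithin_le_nhds
  -- Along the line `t v`, a nonzero `Q v` would give `t² = o(t²)` as `t → 0`, `t ≠ 0`.
  have h2 : (fun t : ℝ => t ^ 2 * Q v) =o[𝓝[≠] 0] fun t : ℝ => t ^ 2 := by
    have h3 := h.comp_tendsto h1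
    refine (h3.congr_left fun t => hQ t v).trans_isBigO ?_
    refine Asymptotics.IsBigO.of_bound (‖v‖ ^ 2) (Eventually.of_forall fun t => ?_)
    simp only [Function.comp_apply, norm_smul, Real.norm_eq_abs, mul_pow, sq_abs, abs_mul,
      abs_pow, abs_norm]
    rw [mul_comm]
  by_contra hne
  have h4 : (fun t : ℝ => Q v * t ^ 2) =o[𝓝[≠] 0] fun t : ℝ => t ^ 2 := by
    simpa only [mul_comm] using h2
  rw [Asymptotics.isLittleO_const_mul_left_iff hne] at h4
  have h5 : ∀ᶠ t : ℝ in 𝓝[≠] 0, t ^ 2 ≠ 0 := by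
    filter_upwards [self_mem_nhdsWithin] with t ht
    exact pow_ne_zero 2 ht
  exact Asymptotics.isLittleO_irrefl h5.frequently h4

/-- The Fisher information depends on the laws only. -/
theorem RegularModel.fisher_eq (M : RegularModel E Θ) (M' : RegularModel E Θ') (hΘ : Θ ⊆ Θ')
    (hP : ∀ θ ∈ Θ, M'.P θ = M.P θ) {θ} (hθ : θ ∈ Θ) : M'.fisher θ = M.fisher θ := by
  have := M.sigmaFinite
  have := M'.sigmaFinite
  -- The positive densities make both dominating measures equivalent to the common law `P θ`, so
  -- with `s² = dμ'/dμ` the root densities satisfy `√f = s √f'`.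
  have hac : M'.μ ≪ M.μ :=
    ((M'.absolutelyContinuous (hΘ hθ)).trans (hP θ hθ).absolutelyContinuous).trans
      (M.P_absolutelyContinuous hθ)
  have hac' : M.μ ≪ M'.μ :=
    ((M.absolutelyContinuous hθ).trans (hP θ hθ).symm.absolutelyContinuous).trans
      (M'.P_absolutelyContinuous (hΘ hθ))
  have hgm := Measure.measurable_rnDeriv M'.μ M.μ
  have hgt := Measure.rnDeriv_lt_top M'.μ M.μ
  have hμ' : M.μ.withDensity (M'.μ.rnDeriv M.μ) = M'.μ := Measure.withDensity_rnDeriv_eq _ _ hac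
  set g := M'.μ.rnDeriv M.μ with hg
  set s : E → ℝ := fun x => Real.sqrt (g x).toReal with hs
  have hsm : Measurable s := hgm.ennreal_toReal.sqrt
  have hss : ∀ x, s x * s x = (g x).toReal := fun x => Real.mul_self_sqrt ENNReal.toReal_nonneg
  have hint : ∀ F : E → ℝ, ∫ x, F x ∂M'.μ = ∫ x, (g x).toReal * F x ∂M.μ := fun F => by
    rw [← hμ', integral_withDensity_eq_integral_toReal_smul hgm hgt]
    rfl
  have hsqrt : ∀ η ∈ Θ, ∀ᵐ x ∂M.μ, Real.sqrt (M.f x η) = s x * Real.sqrt (M'.f x η) := by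
    intro η hη
    have hm' : AEMeasurable (fun x => ENNReal.ofReal (M'.f x η)) M.μ :=
      ((M'.measurable_f η (hΘ hη)).mono_ac hac').ennreal_ofReal
    have h1 : M.μ.withDensity (g * fun x => ENNReal.ofReal (M'.f x η)) =
        M.μ.withDensity fun x => ENNReal.ofReal (M.f x η) := by
      rw [withDensity_mul₀ hgm.aemeasurable hm', hμ', ← M'.P_eq η (hΘ hη), hP η hη, M.P_eq η hη]
    have h2 := (withDensity_eq_iff_of_sigmaFinite (hgm.aemeasurable.mul hm')
      (M.measurable_f η hη).ennreal_ofReal).1 h1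
    filter_upwards [h2, hgt, M.f_pos η hη, hac'.ae_le (M'.f_pos η (hΘ hη))] with x h3 h4 h5 h6
    have h7 := congrArg ENNReal.toReal h3
    rw [Pi.mul_apply, ENNReal.toReal_mul, ENNReal.toReal_ofReal h6.le,
      ENNReal.toReal_ofReal h5.le] at h7
    rw [← h7, Real.sqrt_mul ENNReal.toReal_nonneg]
  have hφ' : ∀ i, MemLp (fun x => s x * M'.φ x θ i) 2 M.μ := by
    intro i
    have h1 := M'.memLp_φ_apply (hΘ hθ) i
    have hm : AEStronglyMeasurable (fun x => M'.φ x θ i) M.μ := h1.1.mono_ac hac'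
    refine (memLp_two_iff_integrable_sq (f := fun x => s x * M'.φ x θ i)
      (hsm.aestronglyMeasurable.mul hm)).2 ?_
    have h2 := h1.integrable_sq
    rw [← hμ', integrable_withDensity_iff_integrable_smul' hgm hgt] at h2
    refine h2.congr (ae_of_all _ fun x => ?_)
    simp only [smul_eq_mul, mul_pow, pow_two (s x), hss]
  have hinner : ∀ (x : E) (h : EuclideanSpace ℝ (Fin d)), inner ℝ (M'.φ x θ) h * s x =
      ∑ i, s x * M'.φ x θ i * h i := fun x h => by
    rw [PiLp.inner_apply, Finset.sum_mul]
    refine Finset.sum_congr rfl fun i _ => ?_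
    simp only [RCLike.inner_apply, conj_trivial]
    ring
  have hLφ : ∀ h, MemLp (fun x => inner ℝ (M.φ x θ) h) 2 M.μ := fun h =>
    (M.memLp_φ θ hθ).inner_const h
  have hLφ' : ∀ h : EuclideanSpace ℝ (Fin d), MemLp (fun x => inner ℝ (M'.φ x θ) h * s x) 2 M.μ := by
    intro h
    simp only [hinner]
    exact memLp_finsetSum _ (f := fun i x => s x * M'.φ x θ i * h i) fun i _ =>
      (hφ' i).mul_const (h i)
  -- `Q h` is the squared `L²(μ)` distance between the two candidate differentials of `√f` in the
  -- direction `h`, namely those given by `φ` and by `s φ'`. Both approximate the same increment up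
  -- to `o(‖h‖)`, so `Q = o(‖h‖²)`; being quadratic, `Q` vanishes.
  set Q : EuclideanSpace ℝ (Fin d) → ℝ := fun h =>
    ∫ x, (inner ℝ (M.φ x θ) h - inner ℝ (M'.φ x θ) h * s x) ^ 2 ∂M.μ with hQ
  have hQsmul : ∀ (t : ℝ) h, Q (t • h) = t ^ 2 * Q h := fun t h => by
    simp only [hQ, inner_smul_right]
    rw [← integral_const_mul]
    congr 1
    ext x
    ring
  have hQle : ∀ᶠ h in 𝓝 (0 : EuclideanSpace ℝ (Fin d)), ‖Q h‖ ≤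
      ‖2 * (∫ x, (Real.sqrt (M.f x (θ + h)) - Real.sqrt (M.f x θ) - inner ℝ (M.φ x θ) h) ^ 2 ∂M.μ)
      + 2 * ∫ x, (Real.sqrt (M'.f x (θ + h)) - Real.sqrt (M'.f x θ) -
        inner ℝ (M'.φ x θ) h) ^ 2 ∂M'.μ‖ := by
    have h0 : Tendsto (fun h : EuclideanSpace ℝ (Fin d) => θ + h) (𝓝 0) (𝓝 θ) :=
      Continuous.tendsto' (by fun_prop) 0 θ (add_zero θ)
    filter_upwards [h0.eventually (M.isOpen.mem_nhds hθ)] with h hh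
    have hΔ : MemLp (fun x => Real.sqrt (M.f x (θ + h)) - Real.sqrt (M.f x θ)) 2 M.μ :=
      (M.memLp_sqrt hh).sub (M.memLp_sqrt hθ)
    have i1 : Integrable (fun x => (Real.sqrt (M.f x (θ + h)) - Real.sqrt (M.f x θ) -
        inner ℝ (M.φ x θ) h) ^ 2) M.μ := (hΔ.sub (hLφ h)).integrable_sq
    have i2 : Integrable (fun x => (Real.sqrt (M.f x (θ + h)) - Real.sqrt (M.f x θ) -
        inner ℝ (M'.φ x θ) h * s x) ^ 2) M.μ := (hΔ.sub (hLφ' h)).integrable_sq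
    have e : ∫ x, (Real.sqrt (M'.f x (θ + h)) - Real.sqrt (M'.f x θ) -
        inner ℝ (M'.φ x θ) h) ^ 2 ∂M'.μ = ∫ x, (Real.sqrt (M.f x (θ + h)) - Real.sqrt (M.f x θ) -
          inner ℝ (M'.φ x θ) h * s x) ^ 2 ∂M.μ := by
      rw [hint]
      refine integral_congr_ae ?_
      filter_upwards [hsqrt _ hh, hsqrt θ hθ] with x h1 h2
      rw [h1, h2, ← hss]
      ring
    rw [e]
    refine le_trans (le_of_eq (Real.norm_of_nonneg (integral_nonneg fun x => sq_nonneg _)))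
      (le_trans ?_ (le_abs_self _))
    rw [← integral_const_mul, ← integral_const_mul, ← integral_add (i1.const_mul 2)
      (i2.const_mul 2)]
    refine integral_mono_ae ((hLφ h).sub (hLφ' h)).integrable_sq
      ((i1.const_mul 2).add (i2.const_mul 2)) (ae_of_all _ fun x => ?_)
    beta_reduce
    -- With increment `Δ`, `2(Δ - A)² + 2(Δ - B)² - (A - B)² = (2Δ - A - B)²`.
    nlinarith [sq_nonneg (2 * (Real.sqrt (M.f x (θ + h)) - Real.sqrt (M.f x θ)) -
      inner ℝ (M.φ x θ) h - inner ℝ (M'.φ x θ) h * s x)]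
  have hQo : Q =o[𝓝 0] fun h => ‖h‖ ^ 2 :=
    (Asymptotics.IsBigO.of_bound 1 (hQle.mono fun h hh => by rw [one_mul]; exact hh)).trans_isLittleO
      (((M.differentiable θ hθ).const_mul_left 2).add
        ((M'.differentiable θ (hΘ hθ)).const_mul_left 2))
  have hφeq : ∀ i, ∀ᵐ x ∂M.μ, M.φ x θ i = M'.φ x θ i * s x := by
    intro i
    have h1 := eq_zero_of_isLittleO_sq hQsmul hQo (EuclideanSpace.single i 1)
    have h2 := (integral_eq_zero_iff_of_nonneg (fun x => sq_nonneg _)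
      ((hLφ _).sub (hLφ' _)).integrable_sq).1 h1
    filter_upwards [h2] with x hx
    have hx' := pow_eq_zero_iff two_ne_zero |>.1 hx
    simp only [Pi.sub_apply, EuclideanSpace.inner_single_right, conj_trivial, one_mul] at hx'
    linarith
  ext i j
  rw [M.fisher_apply, M'.fisher_apply, hint]
  congr 1
  refine integral_congr_ae ?_
  filter_upwards [hφeq i, hφeq j] with x h1 h2
  rw [h1, h2, ← hss]
  ring

end Fisher

/-! ### Ellipticity of the inverse of a positive definite field on a compact set -/

section Elliptic

variable {d : ℕ}

theorem isCompact_setOf_sum_sq_eq_one : IsCompact {v : Fin d → ℝ | ∑ i, v i ^ 2 = 1} := by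
  refine Metric.isCompact_of_isClosed_isBounded (isClosed_eq (by fun_prop) continuous_const)
    ((Metric.isBounded_closedBall (x := (0 : Fin d → ℝ)) (r := 1)).subset fun v hv => ?_)
  rw [mem_closedBall_zero_iff]
  refine (pi_norm_le_iff_of_nonneg zero_le_one).2 fun i => ?_
  rw [Real.norm_eq_abs, ← sq_le_one_iff_abs_le_one]
  have hv' : ∑ i, v i ^ 2 = 1 := hv
  rw [← hv']
  exact Finset.single_le_sum (f := fun i => v i ^ 2) (fun _ _ => sq_nonneg _) (Finset.mem_univ i)

/-- The inverse of a continuous field of positive definite matrices on a compact set is bounded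
and uniformly elliptic. -/
theorem uniformlyElliptic_inv {ρ : Measure (EuclideanSpace ℝ (Fin d))}
    {K Θ : Set (EuclideanSpace ℝ (Fin d))} (hK : IsCompact K) (hΘ : IsOpen Θ) (hΘK : Θ ⊆ K)
    (hρ : ∀ᵐ θ ∂ρ, θ ∈ Θ) {J : EuclideanSpace ℝ (Fin d) → Matrix (Fin d) (Fin d) ℝ}
    (hJ : ∀ i j, ContinuousOn (fun θ => J θ i j) K) (hpos : ∀ θ ∈ K, (J θ).PosDef) :
    UniformlyElliptic ρ fun θ => (J θ)⁻¹ := by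
  have hJc : ContinuousOn J K := continuousOn_pi.2 fun i => continuousOn_pi.2 fun j => hJ i j
  have hinv : ContinuousOn (fun θ => (J θ)⁻¹) K := by
    intro θ hθ
    refine ContinuousAt.comp_continuousWithinAt ?_ (hJc θ hθ)
    refine continuousAt_matrix_inv _ ?_
    simp only [Ring.inverse_eq_inv']
    exact continuousAt_inv₀ (hpos θ hθ).det_pos.ne'
  have hentry : ∀ i j, ContinuousOn (fun θ => (J θ)⁻¹ i j) K := fun i j =>
    continuousOn_pi.1 (continuousOn_pi.1 hinv i) j
  -- The form is continuous on the compact product of `K` with the unit sphere; the bounds found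
  -- there extend to all vectors by homogeneity (`hscale`).
  have hq : ContinuousOn (fun p : EuclideanSpace ℝ (Fin d) × (Fin d → ℝ) =>
      p.2 ⬝ᵥ ((J p.1)⁻¹ *ᵥ p.2)) (K ×ˢ {v : Fin d → ℝ | ∑ i, v i ^ 2 = 1}) := by
    simp only [dotProduct, Matrix.mulVec]
    refine continuousOn_finsetSum _ fun i _ => ContinuousOn.mul (by fun_prop)
      (continuousOn_finsetSum _ fun j _ => ContinuousOn.mul ?_ (by fun_prop))
    exact (hentry i j).comp continuousOn_fst fun p hp => hp.1
  have hcomp := hK.prod (isCompact_setOf_sum_sq_eq_one (d := d))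
  have hscale : ∀ (B : Matrix (Fin d) (Fin d) ℝ) (v : Fin d → ℝ), v ≠ 0 →
      ∃ u : Fin d → ℝ, ∑ i, u i ^ 2 = 1 ∧
        v ⬝ᵥ (B *ᵥ v) = (u ⬝ᵥ (B *ᵥ u)) * ∑ i, v i ^ 2 := by
    intro B v hv
    have hpos : 0 < ∑ i, v i ^ 2 := by
      obtain ⟨i, hi⟩ := Function.ne_iff.1 hv
      exact Finset.sum_pos' (fun _ _ => sq_nonneg _) ⟨i, Finset.mem_univ i, by
        have : v i ≠ 0 := hi
        positivity⟩
    set r := Real.sqrt (∑ i, v i ^ 2) with hr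
    have hr0 : 0 < r := Real.sqrt_pos.2 hpos
    have hr2 : r ^ 2 = ∑ i, v i ^ 2 := Real.sq_sqrt hpos.le
    refine ⟨r⁻¹ • v, ?_, ?_⟩
    · simp only [Pi.smul_apply, smul_eq_mul, mul_pow]
      rw [← Finset.mul_sum, ← hr2]
      field_simp
    · rw [Matrix.mulVec_smul, smul_dotProduct, dotProduct_smul, ← hr2, smul_eq_mul, smul_eq_mul]
      field_simp
  refine ⟨fun i j => ?_, ?_, ?_, ?_, ?_⟩
  · exact aestronglyMeasurable_of_continuousOn ((hentry i j).mono hΘK) hΘ hρ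
  · filter_upwards [hρ] with θ hθ
    have := (hpos θ (hΘK hθ)).inv.isHermitian
    rwa [Matrix.IsHermitian, Matrix.conjTranspose_eq_transpose_of_trivial] at this
  · obtain ⟨C, hC⟩ := hcomp.exists_bound_of_continuousOn hq
    -- `C` may be negative when the product is empty, for instance if `d = 0`.
    refine ⟨max C 0, le_max_right _ _, ?_⟩
    filter_upwards [hρ] with θ hθ v
    rcases eq_or_ne v 0 with rfl | hv
    · simp
    · obtain ⟨u, hu, h1⟩ := hscale (J θ)⁻¹ v hv
      have h2 := hC (θ, u) ⟨hΘK hθ, hu⟩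
      have h3 : 0 ≤ ∑ i, v i ^ 2 := by positivity
      rw [h1, abs_mul, abs_of_nonneg h3]
      gcongr
      exact h2.trans (le_max_left _ _)
  · choose C hC using fun i j => hK.exists_bound_of_continuousOn (hentry i j)
    refine ⟨∑ i, ∑ j, |C i j|, ?_⟩
    filter_upwards [hρ] with θ hθ i j
    calc _ ≤ C i j := hC i j θ (hΘK hθ)
      _ ≤ |C i j| := le_abs_self _
      _ ≤ ∑ j, |C i j| := Finset.single_le_sum (f := fun j => |C i j|)
          (fun _ _ => abs_nonneg _) (Finset.mem_univ j)
      _ ≤ _ := Finset.single_le_sum (f := fun i => ∑ j, |C i j|)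
          (fun _ _ => Finset.sum_nonneg fun _ _ => abs_nonneg _) (Finset.mem_univ i)
  · obtain ⟨c, hc, hle⟩ := hcomp.exists_forall_le' hq (a := 0) fun p hp => by
      have hp2 : ∑ i, p.2 i ^ 2 = 1 := hp.2
      have hne : p.2 ≠ 0 := fun h0 => by simp [h0] at hp2
      have := (hpos p.1 hp.1).inv.dotProduct_mulVec_pos hne
      simpa using this
    refine ⟨c, hc, ?_⟩
    filter_upwards [hρ] with θ hθ v
    rcases eq_or_ne v 0 with rfl | hv
    · simp
    · obtain ⟨u, hu, h1⟩ := hscale (J θ)⁻¹ v hv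
      rw [h1]
      gcongr
      exact hle (θ, u) ⟨hΘK hθ, hu⟩

end Elliptic

/-! ### Closability of the gradient under a positive density -/

section PositiveDensity

variable {d : ℕ} {Θ : Set (EuclideanSpace ℝ (Fin d))} {ρ : Measure (EuclideanSpace ℝ (Fin d))}

theorem tendsto_integral_mul_of_tendsto_eLpNorm {W : Type*} [MeasurableSpace W] {m : Measure W}
    {f : ℕ → W → ℝ} (hf : ∀ n, MemLp (f n) 2 m) {v : Lp ℝ 2 m}
    (h : Tendsto (fun n => eLpNorm (fun w => f n w - v w) 2 m) atTop (𝓝 0)) {k : W → ℝ}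
    (hk : MemLp k 2 m) : Tendsto (fun n => ∫ w, k w * f n w ∂m) atTop (𝓝 (∫ w, k w * v w ∂m)) := by
  have h1 : Tendsto (fun n => inner ℝ (hk.toLp k) ((hf n).toLp (f n))) atTop
      (𝓝 (inner ℝ (hk.toLp k) v)) :=
    tendsto_const_nhds.inner ((tendsto_toLp_iff hf).2 h)
  have e : ∀ u : Lp ℝ 2 m, inner ℝ (hk.toLp k) u = ∫ w, k w * u w ∂m := fun u => by
    rw [L2.inner_def]
    refine integral_congr_ae ?_
    filter_upwards [hk.coeFn_toLp] with w hw
    rw [hw]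
    simp [mul_comm]
  rw [e] at h1
  refine h1.congr fun n => ?_
  rw [e]
  refine integral_congr_ae ?_
  filter_upwards [(hf n).coeFn_toLp] with w hw
  rw [hw]

theorem integrable_mul_of_tsupport_subset {g f : EuclideanSpace ℝ (Fin d) → ℝ}
    (hg : Continuous g) (hgc : HasCompactSupport g) (hgΘ : tsupport g ⊆ Θ)
    (hf : ContinuousOn f Θ) : Integrable fun θ => g θ * f θ := by
  rw [← integrableOn_iff_integrable_of_support_subset (s := tsupport g)]
  · exact (hg.continuousOn.mul (hf.mono hgΘ)).integrableOn_compact hgc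
  · exact (Function.support_mul_subset_left g f).trans (subset_tsupport g)

theorem tsupport_grad_subset (g : EuclideanSpace ℝ (Fin d) → ℝ) (i : Fin d) :
    tsupport (fun θ => grad g θ i) ⊆ tsupport g := by
  refine closure_minimal (fun θ hθ => ?_) (isClosed_tsupport g)
  by_contra hn
  have : fderiv ℝ g θ = 0 := by
    by_contra h0
    exact hn (support_fderiv_subset ℝ h0)
  simp [grad, this] at hθ

theorem hasCompactSupport_grad {g : EuclideanSpace ℝ (Fin d) → ℝ} (hg : HasCompactSupport g)
    (i : Fin d) : HasCompactSupport fun θ => grad g θ i :=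
  IsCompact.of_isClosed_subset hg (isClosed_tsupport _) (tsupport_grad_subset g i)

/-- Integration by parts of a `C¹` function on `Θ` against a test function supported in `Θ`. -/
theorem integral_mul_grad_eq {F g : EuclideanSpace ℝ (Fin d) → ℝ} (hΘ : IsOpen Θ)
    (hF : IsLip1 Θ F) (hg : ContDiff ℝ 1 g) (hgc : HasCompactSupport g) (hgΘ : tsupport g ⊆ Θ)
    (i : Fin d) : ∫ θ, g θ * grad F θ i = -∫ θ, grad g θ i * F θ := by
  have hg' : Continuous fun θ => grad g θ i :=
    (hg.continuous_fderiv (by norm_num)).clm_apply continuous_const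
  have hsupp := tsupport_grad_subset g i
  have h := integral_bilinear_hasLineDerivAt_right_eq_neg_left_of_integrable
    (μ := (volume : Measure (EuclideanSpace ℝ (Fin d)))) (B := ContinuousLinearMap.mul ℝ ℝ)
    (f := g) (f' := fun θ => grad g θ i) (g := F) (g' := fun θ => grad F θ i)
    (v := EuclideanSpace.single i (1 : ℝ)) ?_ ?_ ?_ ?_ ?_
  · simpa using h
  · exact integrable_mul_of_tsupport_subset hg'
      (hasCompactSupport_grad hgc i) (hsupp.trans hgΘ) hF.1.continuousOn
  · exact integrable_mul_of_tsupport_subset hg.continuous hgc hgΘ (hF.continuousOn_grad hΘ i)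
  · exact integrable_mul_of_tsupport_subset hg.continuous hgc hgΘ hF.1.continuousOn
  · intro θ _
    exact ((hg.differentiable (by norm_num)) θ).hasFDerivAt.hasLineDerivAt _
  · intro θ hθ
    exact (hF.differentiableAt hΘ (hgΘ hθ)).hasFDerivAt.hasLineDerivAt _

variable {q : EuclideanSpace ℝ (Fin d) → ℝ}

/-- Dividing the test function by `q` cancels the density, so pairings in `L²(ρ)` become Lebesgue
pairings and integration by parts never differentiates `q`. -/
theorem integral_mul_inv_density (hΘ : IsOpen Θ) (hq : ContinuousOn q Θ) (hq0 : ∀ θ ∈ Θ, 0 < q θ)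
    (hρ : ρ = (volume.restrict Θ).withDensity fun θ => ENNReal.ofReal (q θ))
    {g : EuclideanSpace ℝ (Fin d) → ℝ} (hgΘ : tsupport g ⊆ Θ) (u : EuclideanSpace ℝ (Fin d) → ℝ) :
    ∫ θ, (g θ * (q θ)⁻¹) * u θ ∂ρ = ∫ θ, g θ * u θ := by
  have hqm : AEMeasurable (fun θ => ENNReal.ofReal (q θ)) (volume.restrict Θ) :=
    (hq.aemeasurable hΘ.measurableSet).ennreal_ofReal
  rw [hρ, integral_withDensity_eq_integral_toReal_smul₀ hqm
    (ae_of_all _ fun _ => ENNReal.ofReal_lt_top),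
    ← setIntegral_eq_integral_of_forall_compl_eq_zero (s := Θ) (f := fun θ => g θ * u θ)]
  · refine setIntegral_congr_fun hΘ.measurableSet fun θ hθ => ?_
    have h0 : 0 < q θ := hq0 θ hθ
    simp only [smul_eq_mul]
    rw [ENNReal.toReal_ofReal h0.le]
    field_simp
  · intro θ hθ
    rw [image_eq_zero_of_notMem_tsupport fun h => hθ (hgΘ h), zero_mul]

/-- `1/q` is continuous, hence bounded, on the compact support of `g`, even if `q` degenerates at
the boundary of `Θ`. -/
theorem memLp_mul_inv_density [IsFiniteMeasure ρ] (hΘ : IsOpen Θ) (hρΘ : ∀ᵐ θ ∂ρ, θ ∈ Θ)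
    (hq : ContinuousOn q Θ) (hq0 : ∀ θ ∈ Θ, 0 < q θ) {g : EuclideanSpace ℝ (Fin d) → ℝ}
    (hg : Continuous g) (hgc : HasCompactSupport g) (hgΘ : tsupport g ⊆ Θ) :
    MemLp (fun θ => g θ * (q θ)⁻¹) 2 ρ := by
  have hc : ContinuousOn (fun θ => g θ * (q θ)⁻¹) Θ :=
    hg.continuousOn.mul (hq.inv₀ fun θ hθ => (hq0 θ hθ).ne')
  obtain ⟨C, hC⟩ := hgc.exists_bound_of_continuousOn (hc.mono hgΘ)
  refine MemLp.of_bound (aestronglyMeasurable_of_continuousOn hc hΘ hρΘ) |C|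
    (ae_of_all _ fun θ => ?_)
  by_cases hθ : θ ∈ tsupport g
  · exact (hC θ hθ).trans (le_abs_self _)
  · rw [image_eq_zero_of_notMem_tsupport hθ]
    simp

/-- Testing `∂ᵢ F n` against `g / q` and integrating by parts leaves `F n` paired with a fixed
`L²(ρ)` function, which tends to `0`. So `v i / q` is orthogonal to all test functions and vanishes
a.e. on `Θ`. -/
theorem closable_of_density [IsProbabilityMeasure ρ] (hΘ : IsOpen Θ) (hρΘ : ∀ᵐ θ ∂ρ, θ ∈ Θ)
    (h2 : MemLp (fun θ : EuclideanSpace ℝ (Fin d) => θ) 2 ρ)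
    (hq : ContinuousOn q Θ) (hq0 : ∀ θ ∈ Θ, 0 < q θ)
    (hρ : ρ = (volume.restrict Θ).withDensity fun θ => ENNReal.ofReal (q θ))
    {F : ℕ → EuclideanSpace ℝ (Fin d) → ℝ} (hF : ∀ n, IsLip1 Θ (F n))
    (hF0 : Tendsto (fun n => eLpNorm (F n) 2 ρ) atTop (𝓝 0)) {v : Fin d → Lp ℝ 2 ρ}
    (hv : ∀ i, Tendsto (fun n => eLpNorm (fun θ => 1 * grad (F n) θ i - v i θ) 2 ρ) atTop
      (𝓝 0)) : v = 0 := by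
  funext i
  -- Only local integrability on `Θ` is available, `1/q` being possibly unbounded near the boundary.
  have hvi : LocallyIntegrableOn (fun θ => (q θ)⁻¹ * v i θ) Θ ρ := by
    refine LocallyIntegrableOn.continuousOn_mul
      (((Lp.memLp (v i)).integrable (by norm_num)).locallyIntegrable.locallyIntegrableOn _)
      (hq.inv₀ fun θ hθ => (hq0 θ hθ).ne') hΘ.isLocallyClosed
  have hF2 : ∀ n, MemLp (F n) 2 ρ := fun n => (hF n).memLp hΘ hρΘ h2
  have hG2 : ∀ n, MemLp (fun θ => 1 * grad (F n) θ i) 2 ρ := fun n =>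
    (hF n).memLp_grad hΘ hρΘ (w := fun _ => 1) (memLp_const 1) i
  have hF0' : Tendsto (fun n => eLpNorm (fun θ => F n θ - (0 : Lp ℝ 2 ρ) θ) 2 ρ) atTop (𝓝 0) := by
    refine hF0.congr fun n => eLpNorm_congr_ae ?_
    filter_upwards [Lp.coeFn_zero ℝ 2 ρ] with θ hθ
    rw [hθ]; simp
  have h := hΘ.ae_eq_zero_of_integral_contDiff_smul_eq_zero hvi fun g hg hgc hgΘ => by
    have hg1 : ContDiff ℝ 1 g := hg.of_le (by simp)
    have hg' : Continuous fun θ => grad g θ i :=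
      (hg1.continuous_fderiv (by norm_num)).clm_apply continuous_const
    have hsupp := tsupport_grad_subset g i
    have hgc' := hasCompactSupport_grad hgc i
    have h3 := tendsto_integral_mul_of_tendsto_eLpNorm hG2 (hv i)
      (memLp_mul_inv_density hΘ hρΘ hq hq0 hg1.continuous hgc hgΘ)
    have h4 := tendsto_integral_mul_of_tendsto_eLpNorm hF2 hF0'
      (memLp_mul_inv_density hΘ hρΘ hq hq0 hg' hgc' (hsupp.trans hgΘ))
    have h5 : ∀ n, ∫ θ, g θ * (q θ)⁻¹ * (1 * grad (F n) θ i) ∂ρ =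
        -∫ θ, grad g θ i * (q θ)⁻¹ * F n θ ∂ρ := fun n => by
      rw [integral_mul_inv_density hΘ hq hq0 hρ hgΘ,
        integral_mul_inv_density hΘ hq hq0 hρ (hsupp.trans hgΘ)]
      simp only [one_mul]
      exact integral_mul_grad_eq hΘ (hF n) hg1 hgc hgΘ i
    simp only [h5] at h3
    have h6 := tendsto_nhds_unique h3 h4.neg
    have h7 : ∫ θ, grad g θ i * (q θ)⁻¹ * (0 : Lp ℝ 2 ρ) θ ∂ρ = 0 := by
      refine integral_eq_zero_of_ae ?_
      filter_upwards [Lp.coeFn_zero ℝ 2 ρ] with θ hθ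
      rw [hθ]; simp
    rw [h7, neg_zero] at h6
    simpa only [smul_eq_mul, mul_assoc] using h6
  refine (Lp.eq_zero_iff_ae_eq_zero).2 ?_
  filter_upwards [h, hρΘ] with θ h8 hθ
  have h9 := h8 hθ
  have h10 := (hq0 θ hθ).ne'
  simpa [h10] using h9

end PositiveDensity

/-! ### Models that extend beyond a compact closure -/

section Box

variable {E : Type*} [MeasurableSpace E] {d : ℕ} {Θ Θ' : Set (EuclideanSpace ℝ (Fin d))}
  {ρ : Measure (EuclideanSpace ℝ (Fin d))} [IsProbabilityMeasure ρ]
  {q : EuclideanSpace ℝ (Fin d) → ℝ}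

/-- The extended model supplies continuity and invertibility of the information up to the boundary,
hence uniform ellipticity by compactness; `fisher_eq` identifies it on `Θ` with the information of
`M`. -/
theorem RegularModel.isWeightedGradient_of_density (M : RegularModel E Θ) (M' : RegularModel E Θ')
    (hc : IsCompact (closure Θ)) (hΘ' : closure Θ ⊆ Θ') (hP : ∀ θ ∈ Θ, M'.P θ = M.P θ)
    (hdet : ∀ θ ∈ closure Θ, (M'.fisher θ).det ≠ 0) (hq : ContinuousOn q Θ)
    (hq0 : ∀ θ ∈ Θ, 0 < q θ)
    (hρ : ρ = (volume.restrict Θ).withDensity fun θ => ENNReal.ofReal (q θ)) :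
    IsWeightedGradient Θ ρ M.fisher (fun _ => 1) fun θ => (M'.fisher θ)⁻¹ := by
  have hρΘ : ∀ᵐ θ ∂ρ, θ ∈ Θ := by
    have h1 : ρ ≪ volume.restrict Θ := by
      rw [hρ]; exact withDensity_absolutelyContinuous _ _
    exact h1.ae_le (ae_restrict_mem M.isOpen.measurableSet)
  have h2 : MemLp (fun θ : EuclideanSpace ℝ (Fin d) => θ) 2 ρ := by
    obtain ⟨C, hC⟩ := hc.isBounded.exists_norm_le
    exact MemLp.of_bound aestronglyMeasurable_id C
      (hρΘ.mono fun θ hθ => hC θ (subset_closure hθ))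
  exact
    { isOpen := M.isOpen
      ae_mem := hρΘ
      memLp_id := h2
      memLp_weight := memLp_const 1
      elliptic := uniformlyElliptic_inv hc M.isOpen subset_closure hρΘ
        (fun i j => (M'.continuousOn_fisher i j).mono hΘ')
        fun θ hθ => (M'.posSemidef_fisher (hΘ' hθ)).posDef_iff_det_ne_zero.2 (hdet θ hθ)
      inv_eq := by
        filter_upwards [hρΘ] with θ hθ
        rw [M.fisher_eq M' (subset_closure.trans hΘ') hP hθ, one_pow, one_smul]
      closable := fun F hF hF0 v hv => closable_of_density M.isOpen hρΘ h2 hq hq0 hρ hF hF0 hv }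

theorem isCompact_closure_box (θ₀ θ₁ : Fin d → ℝ) :
    IsCompact (closure {θ : EuclideanSpace ℝ (Fin d) | ∀ i, θ i ∈ Ioo (θ₀ i) (θ₁ i)}) := by
  have h1 : IsCompact (WithLp.toLp 2 '' Icc θ₀ θ₁ : Set (EuclideanSpace ℝ (Fin d))) :=
    isCompact_Icc.image (PiLp.continuous_toLp 2 _)
  refine h1.closure_of_subset fun θ hθ => ⟨θ.ofLp, ?_, rfl⟩
  exact ⟨fun i => (hθ i).1.le, fun i => (hθ i).2.le⟩

end Box

/-! ### Transfer between one-parameter models and the form on the real line -/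

section Line

theorem single_zero_apply_zero (θ : EuclideanSpace ℝ (Fin 1)) :
    EuclideanSpace.single (0 : Fin 1) (θ 0) = θ := by
  ext i
  rw [Subsingleton.elim i 0]
  simp

theorem hasFDerivAt_apply_zero (θ : EuclideanSpace ℝ (Fin 1)) :
    HasFDerivAt (fun η : EuclideanSpace ℝ (Fin 1) => η 0)
      (EuclideanSpace.proj (𝕜 := ℝ) (0 : Fin 1) : EuclideanSpace ℝ (Fin 1) →L[ℝ] ℝ) θ :=
  (EuclideanSpace.proj (𝕜 := ℝ) (0 : Fin 1) : EuclideanSpace ℝ (Fin 1) →L[ℝ] ℝ).hasFDerivAt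

theorem hasDerivAt_single_zero (t : ℝ) :
    HasDerivAt (fun s : ℝ => EuclideanSpace.single (0 : Fin 1) s)
      (EuclideanSpace.single (0 : Fin 1) (1 : ℝ)) t := by
  have e : (fun s : ℝ => EuclideanSpace.single (0 : Fin 1) s) =
      fun s : ℝ => s • EuclideanSpace.single (0 : Fin 1) (1 : ℝ) := by
    ext s i; simp
  rw [e]
  simpa using (hasDerivAt_id t).smul_const (EuclideanSpace.single (0 : Fin 1) (1 : ℝ))

theorem contDiff_single_zero :
    ContDiff ℝ 1 fun s : ℝ => EuclideanSpace.single (0 : Fin 1) s := by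
  have e : (fun s : ℝ => EuclideanSpace.single (0 : Fin 1) s) =
      fun s : ℝ => s • EuclideanSpace.single (0 : Fin 1) (1 : ℝ) := by
    ext s i; simp
  rw [e]
  fun_prop

theorem IsLip1.comp_single {F : EuclideanSpace ℝ (Fin 1) → ℝ} (hF : IsLip1 Set.univ F) :
    ContDiff ℝ 1 (fun t : ℝ => F (EuclideanSpace.single 0 t)) ∧
      ∃ K : ℝ≥0, LipschitzWith K fun t : ℝ => F (EuclideanSpace.single 0 t) := by
  obtain ⟨h, K, hK⟩ := hF
  refine ⟨(contDiffOn_univ.1 h).comp contDiff_single_zero, K, ?_⟩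
  refine LipschitzWith.of_dist_le_mul fun s t => ?_
  refine ((lipschitzOnWith_univ.1 hK).dist_le_mul _ _).trans (le_of_eq ?_)
  rw [PiLp.dist_single_same]

theorem IsLip1.deriv_comp_single {F : EuclideanSpace ℝ (Fin 1) → ℝ} (hF : IsLip1 Set.univ F)
    (t : ℝ) : deriv (fun t : ℝ => F (EuclideanSpace.single 0 t)) t =
      grad F (EuclideanSpace.single 0 t) 0 :=
  ((hF.differentiableAt isOpen_univ (mem_univ _)).hasFDerivAt.comp_hasDerivAt t
    (hasDerivAt_single_zero t)).deriv

theorem isLip1_comp_apply_zero {f : ℝ → ℝ} (hf : ContDiff ℝ 1 f)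
    (hL : ∃ K : ℝ≥0, LipschitzWith K f) :
    IsLip1 Set.univ fun θ : EuclideanSpace ℝ (Fin 1) => f (θ 0) := by
  obtain ⟨K, hK⟩ := hL
  refine ⟨(hf.comp (by fun_prop)).contDiffOn, K, LipschitzWith.lipschitzOnWith ?_⟩
  refine LipschitzWith.of_dist_le_mul fun θ η => (hK.dist_le_mul _ _).trans ?_
  gcongr
  rw [dist_eq_norm, dist_eq_norm]
  exact PiLp.norm_apply_le (θ - η) 0

theorem grad_comp_apply_zero {f : ℝ → ℝ} (hf : ContDiff ℝ 1 f) (θ : EuclideanSpace ℝ (Fin 1)) :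
    grad (fun θ : EuclideanSpace ℝ (Fin 1) => f (θ 0)) θ 0 = deriv f (θ 0) := by
  have h1 := ((hf.differentiable (by norm_num) (θ 0)).hasDerivAt.comp_hasFDerivAt θ
    (hasFDerivAt_apply_zero θ)).fderiv
  have e : (f ∘ fun η : EuclideanSpace ℝ (Fin 1) => η 0) =
      fun θ : EuclideanSpace ℝ (Fin 1) => f (θ 0) := rfl
  rw [e] at h1
  rw [grad, h1]
  simp

theorem uniformlyElliptic_one {W : Type*} [MeasurableSpace W] {m : Measure W} {d : ℕ} :
    UniformlyElliptic m fun _ => (1 : Matrix (Fin d) (Fin d) ℝ) := by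
  refine ⟨fun i j => aestronglyMeasurable_const, ae_of_all _ fun _ => Matrix.isSymm_one, ?_, ?_, ?_⟩
  · refine ⟨1, zero_le_one, ae_of_all _ fun _ v => ?_⟩
    have h : v ⬝ᵥ v = ∑ i, v i ^ 2 := by simp [dotProduct, pow_two]
    rw [Matrix.one_mulVec, one_mul, h, abs_of_nonneg (Finset.sum_nonneg fun i _ => sq_nonneg _)]
  · refine ⟨1, ae_of_all _ fun _ i j => ?_⟩
    rcases eq_or_ne i j with rfl | h
    · simp
    · simp [h]
  · refine ⟨1, one_pos, ae_of_all _ fun _ v => ?_⟩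
    rw [Matrix.one_mulVec, one_mul]
    simp [dotProduct, pow_two]

variable {E : Type*} [MeasurableSpace E]
  {M : RegularModel E (Set.univ : Set (EuclideanSpace ℝ (Fin 1)))}

/-- The weight `J^{-1/2}` on the line. -/
def RegularModel.weight (M : RegularModel E (Set.univ : Set (EuclideanSpace ℝ (Fin 1))))
    (θ : EuclideanSpace ℝ (Fin 1)) : ℝ :=
  Real.sqrt (1 / M.fisher θ 0 0)

theorem RegularModel.fisher_pos (hM : ∀ θ, (M.fisher θ).det ≠ 0) (θ) : 0 < M.fisher θ 0 0 :=
  ((M.posSemidef_fisher (mem_univ θ)).posDef_iff_det_ne_zero.2 (hM θ)).diag_pos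

theorem RegularModel.weight_sq (hM : ∀ θ, (M.fisher θ).det ≠ 0) (θ) :
    M.weight θ ^ 2 = 1 / M.fisher θ 0 0 :=
  Real.sq_sqrt (one_div_nonneg.2 (M.fisher_pos hM θ).le)

theorem RegularModel.weight_pos (hM : ∀ θ, (M.fisher θ).det ≠ 0) (θ) : 0 < M.weight θ :=
  Real.sqrt_pos.2 (one_div_pos.2 (M.fisher_pos hM θ))

theorem RegularModel.measurable_weight (M : RegularModel E Set.univ) : Measurable M.weight := by
  have h1 : Continuous fun θ => M.fisher θ 0 0 :=
    continuousOn_univ.1 (M.continuousOn_fisher 0 0)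
  exact (measurable_const.div h1.measurable).sqrt

theorem RegularModel.inv_fisher (hM : ∀ θ, (M.fisher θ).det ≠ 0) (θ) :
    (M.fisher θ)⁻¹ = M.weight θ ^ 2 • (1 : Matrix (Fin 1) (Fin 1) ℝ) := by
  refine Matrix.inv_eq_right_inv ?_
  ext i j
  rw [Subsingleton.elim i 0, Subsingleton.elim j 0, M.weight_sq hM]
  have := (M.fisher_pos hM θ).ne'
  simp [this]

theorem RegularModel.gammaForm_eq (hM : ∀ θ, (M.fisher θ).det ≠ 0)
    (F : EuclideanSpace ℝ (Fin 1) → ℝ) (θ) :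
    gammaForm M.fisher F θ = (M.weight θ * grad F θ 0) ^ 2 := by
  rw [gammaForm, M.inv_fisher hM]
  simp only [Matrix.smul_mulVec, Matrix.one_mulVec, dotProduct_smul, smul_eq_mul]
  simp [dotProduct, pow_two]
  ring

variable {ρ : Measure (EuclideanSpace ℝ (Fin 1))}

theorem measurable_apply_zero : Measurable fun θ : EuclideanSpace ℝ (Fin 1) => θ 0 := by
  fun_prop

/-- The measure `J⁻¹ ρ`, transported to `ℝ`. -/
def lineMeasure (M : RegularModel E (Set.univ : Set (EuclideanSpace ℝ (Fin 1))))
    (ρ : Measure (EuclideanSpace ℝ (Fin 1))) : Measure ℝ :=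
  (ρ.withDensity fun θ => ENNReal.ofReal (1 / M.fisher θ 0 0)).map fun θ => θ 0

theorem lineMeasure_eq (hM : ∀ θ, (M.fisher θ).det ≠ 0) : lineMeasure M ρ =
    (ρ.withDensity fun θ => ENNReal.ofReal (M.weight θ ^ 2)).map fun θ => θ 0 := by
  simp only [lineMeasure, M.weight_sq hM]

/-- The weight squared is the density `1/J`, so `h ↦ w · h(θ 0)` is an isometry from `L²(ν)` to
`L²(ρ)`. It exchanges `f'` with the weighted gradient. -/
theorem eLpNorm_lineMeasure (hM : ∀ θ, (M.fisher θ).det ≠ 0) {h : ℝ → ℝ} (hh : Measurable h) :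
    eLpNorm h 2 (lineMeasure M ρ) = eLpNorm (fun θ => M.weight θ * h (θ 0)) 2 ρ := by
  have hd : Measurable fun θ => ENNReal.ofReal (M.weight θ ^ 2) :=
    (M.measurable_weight.pow_const 2).ennreal_ofReal
  have hm : Measurable fun θ : EuclideanSpace ℝ (Fin 1) => ‖h (θ 0)‖ₑ ^ 2 :=
    (hh.comp measurable_apply_zero).enorm.pow_const 2
  rw [lineMeasure_eq hM, eLpNorm_two_eq, eLpNorm_two_eq,
    lintegral_map (by fun_prop) measurable_apply_zero,
    lintegral_withDensity_eq_lintegral_mul _ hd hm]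
  congr 1
  refine lintegral_congr fun θ => ?_
  rw [Pi.mul_apply, enorm_mul, mul_pow, ← Real.enorm_eq_ofReal (sq_nonneg _), enorm_pow]

theorem memLp_lineMeasure (hM : ∀ θ, (M.fisher θ).det ≠ 0) {h : ℝ → ℝ} (hh : Measurable h)
    (h2 : MemLp (fun θ => M.weight θ * h (θ 0)) 2 ρ) : MemLp h 2 (lineMeasure M ρ) :=
  ⟨hh.aestronglyMeasurable, by rw [eLpNorm_lineMeasure hM hh]; exact h2.2⟩

theorem lineMeasure_absolutelyContinuous : lineMeasure M ρ ≪ ρ.map fun θ => θ 0 :=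
  (withDensity_absolutelyContinuous _ _).map measurable_apply_zero

theorem absolutelyContinuous_lineMeasure (hM : ∀ θ, (M.fisher θ).det ≠ 0) :
    (ρ.map fun θ => θ 0) ≪ lineMeasure M ρ := by
  rw [lineMeasure_eq hM]
  refine (withDensity_absolutelyContinuous'
    (M.measurable_weight.pow_const 2).ennreal_ofReal.aemeasurable
    (ae_of_all _ fun θ => ?_)).map measurable_apply_zero
  have := M.weight_pos hM θ
  simp only [ne_eq, ENNReal.ofReal_eq_zero, not_le]
  positivity

theorem isFiniteMeasure_lineMeasure (hJ : Integrable (fun θ => 1 / M.fisher θ 0 0) ρ) :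
    IsFiniteMeasure (lineMeasure M ρ) := by
  have : IsFiniteMeasure (ρ.withDensity fun θ => ENNReal.ofReal (1 / M.fisher θ 0 0)) :=
    isFiniteMeasure_withDensity_ofReal hJ.2
  exact Measure.isFiniteMeasure_map _ _

theorem eLpNorm_comp_single {h : EuclideanSpace ℝ (Fin 1) → ℝ} (hh : Continuous h) :
    eLpNorm (fun t : ℝ => h (EuclideanSpace.single 0 t)) 2 (ρ.map fun θ => θ 0) =
      eLpNorm h 2 ρ := by
  have hc : Continuous fun t : ℝ => h (EuclideanSpace.single 0 t) :=
    hh.comp contDiff_single_zero.continuous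
  rw [eLpNorm_map_measure hc.aestronglyMeasurable measurable_apply_zero.aemeasurable]
  congr 1
  ext θ
  simp only [Function.comp_apply, single_zero_apply_zero]

theorem memLp_weight (hM : ∀ θ, (M.fisher θ).det ≠ 0)
    (hJ : Integrable (fun θ => 1 / M.fisher θ 0 0) ρ) : MemLp M.weight 2 ρ := by
  rw [memLp_two_iff_integrable_sq M.measurable_weight.aestronglyMeasurable]
  simpa only [M.weight_sq hM] using hJ

theorem memLp_id_of_integrable_sq (hρ : Integrable (fun θ => θ 0 ^ 2) ρ) :
    MemLp (fun θ : EuclideanSpace ℝ (Fin 1) => θ) 2 ρ := by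
  have h1 : MemLp (fun θ : EuclideanSpace ℝ (Fin 1) => θ 0) 2 ρ :=
    (memLp_two_iff_integrable_sq measurable_apply_zero.aestronglyMeasurable).2 hρ
  refine h1.of_le aestronglyMeasurable_id (ae_of_all _ fun θ => le_of_eq ?_)
  simp [EuclideanSpace.norm_eq, Real.sqrt_sq_eq_abs]

/-- Because `w > 0`, a limit field `v` is `w · g(θ 0)` with `g = v / w`, so convergence of weighted
gradients in `L²(ρ)` is convergence of derivatives to `g` in `L²(ν)`. -/
theorem isWeightedGradient_of_lineClosable [IsProbabilityMeasure ρ]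
    (hM : ∀ θ, (M.fisher θ).det ≠ 0) (hρ : Integrable (fun θ => θ 0 ^ 2) ρ)
    (hJ : Integrable (fun θ => 1 / M.fisher θ 0 0) ρ)
    (h : LineClosable (ρ.map fun θ => θ 0) (lineMeasure M ρ)) :
    IsWeightedGradient Set.univ ρ M.fisher M.weight fun _ => 1 where
  isOpen := isOpen_univ
  ae_mem := ae_of_all _ fun _ => mem_univ _
  memLp_id := memLp_id_of_integrable_sq hρ
  memLp_weight := memLp_weight hM hJ
  elliptic := uniformlyElliptic_one
  inv_eq := ae_of_all _ fun θ => M.inv_fisher hM θ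
  closable := by
    intro F hF hF0 v hv
    have hsm : Measurable fun t : ℝ => EuclideanSpace.single (0 : Fin 1) t :=
      contDiff_single_zero.continuous.measurable
    set g : ℝ → ℝ := fun t => v 0 (EuclideanSpace.single 0 t) / M.weight (EuclideanSpace.single 0 t)
      with hg
    have hgm : Measurable g :=
      ((Lp.stronglyMeasurable (v 0)).measurable.comp hsm).div (M.measurable_weight.comp hsm)
    have hwg : (fun θ : EuclideanSpace ℝ (Fin 1) => M.weight θ * g (θ 0)) = v 0 := by
      ext θ
      simp only [hg, single_zero_apply_zero]
      have := (M.weight_pos hM θ).ne'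
      field_simp
    have hg2 : MemLp g 2 (lineMeasure M ρ) :=
      memLp_lineMeasure hM hgm (by rw [hwg]; exact Lp.memLp (v 0))
    have h1 := h (fun n t => F n (EuclideanSpace.single 0 t)) (fun n => (hF n).comp_single)
      (hF0.congr fun n =>
        (eLpNorm_comp_single (contDiffOn_univ.1 (hF n).1).continuous).symm) g hgm hg2
      ((hv 0).congr fun n => by
        have hm : Measurable fun t =>
            deriv (fun t : ℝ => F n (EuclideanSpace.single 0 t)) t - g t :=
          (measurable_deriv _).sub hgm
        rw [eLpNorm_lineMeasure hM hm]
        congr 1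
        ext θ
        rw [(hF n).deriv_comp_single, single_zero_apply_zero, mul_sub]
        exact congrArg _ (congrFun hwg θ).symm)
    have h2 : eLpNorm g 2 (lineMeasure M ρ) = 0 := by
      rw [eLpNorm_congr_ae h1]
      exact eLpNorm_zero
    rw [eLpNorm_lineMeasure hM hgm, hwg,
      eLpNorm_eq_zero_iff (Lp.memLp (v 0)).1 (by norm_num)] at h2
    funext i
    rw [Subsingleton.elim i 0]
    exact (Lp.eq_zero_iff_ae_eq_zero).2 h2

theorem lintegral_gammaForm_eq (hM : ∀ θ, (M.fisher θ).det ≠ 0)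
    {F : EuclideanSpace ℝ (Fin 1) → ℝ} :
    ∫⁻ θ, ‖gammaForm M.fisher F θ‖ₑ ∂ρ =
      eLpNorm (fun θ => M.weight θ * grad F θ 0) 2 ρ ^ 2 := by
  rw [eLpNorm_two_eq, ← ENNReal.rpow_natCast, ← ENNReal.rpow_mul]
  norm_num
  simp only [M.gammaForm_eq hM, enorm_pow, enorm_mul]

theorem IsClosable.lineClosable (hM : ∀ θ, (M.fisher θ).det ≠ 0)
    (h : IsClosable M.fisher Set.univ ρ) :
    LineClosable (ρ.map fun θ => θ 0) (lineMeasure M ρ) := by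
  intro f hf hf0 g hg hg2 hfg
  have hm : ∀ n, Measurable (deriv (f n)) := fun n => measurable_deriv _
  have hpow : ∀ {ι : Type} {l : Filter ι} {u : ι → ℝ≥0∞}, Tendsto u l (𝓝 0) →
      Tendsto (fun i => u i ^ 2) l (𝓝 0) := fun hu => by
    have := ((ENNReal.continuous_pow 2).tendsto 0).comp hu
    rwa [zero_pow two_ne_zero] at this
  have hF : ∀ n, IsLip1 Set.univ fun θ : EuclideanSpace ℝ (Fin 1) => f n (θ 0) := fun n =>
    isLip1_comp_apply_zero (hf n).1 (hf n).2
  have h1 := h (fun n θ => f n (θ 0)) hF (by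
    refine (hpow hf0).congr fun n => ?_
    rw [eLpNorm_two_eq, lintegral_map (by have := (hf n).1.continuous; fun_prop)
      measurable_apply_zero, ← ENNReal.rpow_natCast, ← ENNReal.rpow_mul]
    norm_num) (by
    -- Derivatives converging to `g` in `L²(ν)` are Cauchy there, which is the Cauchy condition on
    -- the form.
    have h2 : Tendsto (fun k : ℕ × ℕ => eLpNorm (fun t => deriv (f k.1) t - g t) 2 (lineMeasure M ρ)
        + eLpNorm (fun t => deriv (f k.2) t - g t) 2 (lineMeasure M ρ)) atTop (𝓝 0) := by
      rw [← prod_atTop_atTop_eq]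
      simpa using (hfg.comp tendsto_fst).add (hfg.comp tendsto_snd)
    refine tendsto_of_tendsto_of_tendsto_of_le_of_le tendsto_const_nhds (hpow h2)
      (fun _ => zero_le) fun k => ?_
    rw [lintegral_gammaForm_eq hM]
    gcongr
    have e : (fun θ => M.weight θ * grad ((fun θ : EuclideanSpace ℝ (Fin 1) => f k.1 (θ 0)) -
        fun θ : EuclideanSpace ℝ (Fin 1) => f k.2 (θ 0)) θ 0) =
        fun θ => M.weight θ * (fun t => (deriv (f k.1) t - g t) - (deriv (f k.2) t - g t)) (θ 0) := by
      ext θ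
      rw [sub_eq_add_neg, ← neg_one_smul ℝ, grad_add isOpen_univ (hF _) ((hF _).const_smul _)
        (mem_univ _), grad_const_smul _ isOpen_univ (hF _) (mem_univ _),
        grad_comp_apply_zero (hf _).1, grad_comp_apply_zero (hf _).1]
      ring
    have hs : Measurable fun t => (deriv (f k.1) t - g t) - (deriv (f k.2) t - g t) :=
      ((hm _).sub hg).sub ((hm _).sub hg)
    rw [e, ← eLpNorm_lineMeasure hM hs]
    exact eLpNorm_sub_le ((hm _).sub hg).aestronglyMeasurable
      ((hm _).sub hg).aestronglyMeasurable (by norm_num))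
  have h3 : Tendsto (fun n => eLpNorm (deriv (f n)) 2 (lineMeasure M ρ)) atTop (𝓝 0) := by
    have h4 := ((ENNReal.continuous_rpow_const (y := 1 / 2)).tendsto (0 : ℝ≥0∞)).comp h1
    rw [ENNReal.zero_rpow_of_pos (by norm_num)] at h4
    refine h4.congr fun n => ?_
    rw [Function.comp_apply, lintegral_gammaForm_eq hM, ← ENNReal.rpow_natCast, ← ENNReal.rpow_mul,
      eLpNorm_lineMeasure hM (hm n)]
    norm_num
    simp only [grad_comp_apply_zero (hf n).1]
  -- Closability sends the derivatives to `0`, and they also tend to `g`.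
  have h5 : eLpNorm g 2 (lineMeasure M ρ) = 0 := by
    have h6 := h3.add hfg
    rw [add_zero] at h6
    refine le_antisymm (ge_of_tendsto h6 (Eventually.of_forall fun n => ?_)) zero_le
    have e : g = deriv (f n) - fun t => deriv (f n) t - g t := by
      ext t; simp
    conv_lhs => rw [e]
    exact eLpNorm_sub_le (hm n).aestronglyMeasurable ((hm n).sub hg).aestronglyMeasurable
      (by norm_num)
  exact (eLpNorm_eq_zero_iff hg.aestronglyMeasurable (by norm_num)).1 h5

end Line

end FisherError

end

theorem proposition2p2p2 {E : Type*} [MeasurableSpace E] :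
    -- (a)
    (∀ (d : ℕ) (θ₀ θ₁ : Fin d → ℝ) (_ : ∀ i, θ₀ i ≤ θ₁ i)
      (Θ Θ' : Set (EuclideanSpace ℝ (Fin d)))
      (_ : Θ = {θ | ∀ i, θ i ∈ Set.Ioo (θ₀ i) (θ₁ i)})
      (q : EuclideanSpace ℝ (Fin d) → ℝ) (_ : IsLip1 Θ q) (_ : ∀ θ ∈ Θ, 0 < q θ)
      (ρ : Measure (EuclideanSpace ℝ (Fin d))) [IsProbabilityMeasure ρ]
      (_ : ρ = (volume.restrict Θ).withDensity fun θ => ENNReal.ofReal (q θ))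
      (M : RegularModel E Θ) (M' : RegularModel E Θ')
      (_ : closure Θ ⊆ Θ') (_ : ∀ θ ∈ Θ, M'.P θ = M.P θ)
      (_ : ∀ θ ∈ closure Θ, (M'.fisher θ).det ≠ 0),
      IsClosable M.fisher Θ ρ ∧ HypothesisE M.fisher Θ ρ) ∧
    -- (b)
    (∀ (M : RegularModel E (Set.univ : Set (EuclideanSpace ℝ (Fin 1))))
      (_ : ∀ θ, (M.fisher θ).det ≠ 0)
      (ρ : Measure (EuclideanSpace ℝ (Fin 1))) [IsProbabilityMeasure ρ]
      (_ : Integrable (fun θ => θ 0 ^ 2) ρ)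
      (_ : Integrable (fun θ => 1 / M.fisher θ 0 0) ρ)
      (ν : Measure ℝ)
      (_ : ν = (ρ.withDensity fun θ => ENNReal.ofReal (1 / M.fisher θ 0 0)).map fun θ => θ 0),
      (HypothesisE M.fisher Set.univ ρ ↔ HamzaConditions ν) ∧
      ((∃ S : ErrorStructure ρ, Identifies M.fisher Set.univ S) ↔ HamzaConditions ν)) := by
  refine ⟨?_, ?_⟩
  · intro d θ₀ θ₁ _ Θ Θ' hΘ q hq hq0 ρ _ hρ M M' hΘ' hP hdet
    have hc : IsCompact (closure Θ) := by
      rw [hΘ]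
      exact isCompact_closure_box θ₀ θ₁
    have h := M.isWeightedGradient_of_density M' hc hΘ' hP hdet hq.1.continuousOn hq0 hρ
    exact ⟨h.identifies.isClosable, h.hypothesisE⟩
  · intro M hM ρ _ hρ2 hJ ν hν
    have hν' : ν = lineMeasure M ρ := hν
    have := isFiniteMeasure_lineMeasure hJ
    have : IsProbabilityMeasure (ρ.map fun θ => θ 0) :=
      Measure.isProbabilityMeasure_map measurable_apply_zero.aemeasurable
    -- Both equivalences follow from two implications: Hamza's conditions give the full hypothesis,
    -- and a bare structure, without minimality or density, already gives Hamza's conditions.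
    have hsuff : HamzaConditions ν → HypothesisE M.fisher Set.univ ρ := by
      rw [hν']
      intro h
      exact (isWeightedGradient_of_lineClosable hM hρ2 hJ
        (h.lineClosable lineMeasure_absolutelyContinuous)).hypothesisE
    have hnec : (∃ S : ErrorStructure ρ, Identifies M.fisher Set.univ S) → HamzaConditions ν := by
      rw [hν']
      rintro ⟨S, hS⟩
      refine (hS.isClosable.lineClosable hM).hamzaConditions ?_
        (absolutelyContinuous_lineMeasure hM)
      refine (memLp_two_iff_integrable_sq (f := fun x : ℝ => x) aestronglyMeasurable_id).2 ?_
      exact (integrable_map_measure (by fun_prop) measurable_apply_zero.aemeasurable).2 hρ2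
    exact ⟨⟨fun ⟨S, hS, _⟩ => hnec ⟨S, hS⟩, hsuff⟩,
      ⟨hnec, fun h => let ⟨S, hS, _⟩ := hsuff h; ⟨S, hS⟩⟩⟩
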